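/- Let $B=(V_1;V_2,E)$ be a bipartite graph with $|V_1|=n_1\le n_2=|V_2|$, $n=n_1+n_2$, $m=|E|$, in which every node of $V_1$ has a neighbour; let $\kappa$ be the cardinality of a maximum matching, and let $1\le\lambda\le n_1$. Write $$T(B,\lambda)=\min\Big\{n_1\kappa,\ \frac{n_1n_2}{\lambda},\ m\Big\}+\kappa^2+\frac{\kappa^{2.5}}{\lambda}.$$ *Machine.* A random access machine with unit-cost arithmetic on integers of size $O(n)$, whose memory also holds words of $\lambda$ bits. One step computes the bitwise AND or OR of two $\lambda$-bit words, or the index of the leading non-zero bit of a $\lambda$-bit word ($0$ if there is none), or reads or writes one bit of a long word that is stored as a sequence of $\lambda$-bit words. The input consists of the lists of out-neighbours of the nodes of $V_1$ and of in-neighbours of the nodes of $V_2$, in any order, together with the characteristic vectors of these neighbourhoods, stored as sequences of $\lambda$-bit words; the rest of the memory is initially zero. *Matching-pseudoflow algorithm.* The algorithm maintains a map that assigns to some nodes of $V_1$ a parent among their neighbours in $V_2$. A $V_1$-node without parent is an $ST_1$ branch; a $V_2$-node with $0$, $1$, $2$ children is (the root of) a $WT_1$, $WT_2$, $ST_2$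 branch, respectively. The residual arcs are all arcs $(u,w)$ with $\{u,w\}\in E$, $u\in V_1$, $w\in V_2$, and the arcs from parents to their children. The two-edge distance label of a node is the number of $V_1$-nodes on a shortest residual path from it to a $WT_1$ branch ($\infty$ if there is none). Initially no node has a parent. Each stage begins by computing all labels and marking all nodes unvisited; its number $\ell$ is the least label of an $ST_1$ branch (stage $1$ is the greedy initialization), and the algorithm stops when $\ell=\infty$. During a stage, as long as this is possible, a merger is made along an arc $(u,w)$ of the graph to an unvisited $w$ with $\mathrm{label}(u)=\mathrm{label}(w)+1$, that is, $w$ becomes the parent of $u$; here $u$ is an $ST_1$ branch of label $\ell$ if there is no $ST_2$ branch, and otherwise the right (original) child of the unique $ST_2$ branch. If $w$ was a $WT_1$ branch, the current sequence of mergers ends as a successful path and all $V_2$-nodes of it are marked visited. If there is an $ST_2$ branch but no such merger, the last merger is undone and the root it led to is marked visited. *Theorem.* (1) There are a single program for this machine (independent of $B$ and $\lambda$) and a constant $C$ such that, for all $B$ and $\lambda$ as above, the program carries out a complete run of the matching-pseudoflow algorithm on $B$, outputs the resulting set of pairs ($V_1$-node, its parent), which is a maximum matching of $B$, and halts after at most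 $C\cdot T(B,\lambda)$ steps. In other words, the matching-pseudoflow algorithm with word operations runs in $O\big(\min\{n_1\kappa,\frac{n_1n_2}{\lambda},m\}+\kappa^2+\frac{\kappa^{2.5}}{\lambda}\big)$. (2) This improves on Cheriyan and Mehlhorn's $O(n^{2.5}/\lambda)$: for all $B$ and $\lambda$ with $1\le\lambda\le n_1\le n_2$ and $\lambda\le\sqrt n$, the bound $T(B,\lambda)$ is $O(n^{2.5}/\lambda)$ with an absolute constant, and it is $o(n^{2.5}/\lambda)$ when $\kappa=o(n)$: for every $\varepsilon>0$ there are $\delta>0$ and $N$ such that $T(B,\lambda)\le\varepsilon\, n^{2.5}/\lambda$ whenever moreover $n\ge N$ and $\kappa\le\delta n$. -/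

import Mathlib

/-! ## Bipartite graphs and matchings

A bipartite graph with sides `V₁ = Fin n₁` and `V₂ = Fin n₂` is its finite set of edges
`E : Finset (Fin n₁ × Fin n₂)`; the number of arcs is `E.card`. -/

/-- A set of pairs in which every node lies on at most one pair. -/
def IsMatching {n₁ n₂ : ℕ} (M : Finset (Fin n₁ × Fin n₂)) : Prop :=
  Set.InjOn Prod.fst (M : Set (Fin n₁ × Fin n₂)) ∧
  Set.InjOn Prod.snd (M : Set (Fin n₁ × Fin n₂))

open Classical in
/-- The cardinality of a maximum matching of the graph. -/
noncomputable def matchingNumber {n₁ n₂ : ℕ} (E : Finset (Fin n₁ × Fin n₂)) : ℕ :=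
  (E.powerset.filter IsMatching).sup Finset.card

/-- Adjacency lists of the graph: for every node its neighbours, each once, in any order. -/
structure AdjLists {n₁ n₂ : ℕ} (E : Finset (Fin n₁ × Fin n₂)) where
  outList : Fin n₁ → List (Fin n₂)
  inList : Fin n₂ → List (Fin n₁)
  outList_nodup : ∀ u, (outList u).Nodup
  inList_nodup : ∀ w, (inList w).Nodup
  mem_outList : ∀ u w, w ∈ outList u ↔ (u, w) ∈ E
  mem_inList : ∀ w u, u ∈ inList w ↔ (u, w) ∈ E

/-! ## The matching-pseudoflow algorithm

All arcs go from `V₁` to `V₂` and have infinite capacity, and the in-tree arcs of the normalized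
tree are the arcs that carry one unit of flow. So the tree and the flow are both given by a map
`par`: `par u = some w` says that `w` is the parent of `u` (the arc `(u, w)` carries one unit), and
`par u = none` that the node `u` is a branch by itself. A node `u` of `V₁` with `par u = none` is an
`ST₁` branch; a node `w` of `V₂` with no child is a `WT₁` branch, with one child it is the root of a
`WT₂` branch, and with two children it is the root of an `ST₂` branch. -/

/-- The parents of the nodes of `V₁`. -/
abbrev Parents (n₁ n₂ : ℕ) := Fin n₁ → Option (Fin n₂)

/-- `u` is an `ST₁` branch. -/
def IsST1 {n₁ n₂ : ℕ} (par : Parents n₁ n₂) (u : Fin n₁) : Prop := par u = none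

/-- `w` is a `WT₁` branch. -/
def IsWT1 {n₁ n₂ : ℕ} (par : Parents n₁ n₂) (w : Fin n₂) : Prop := ∀ u, par u ≠ some w

/-- The arcs of the residual network: all arcs of the graph, and the reverses of those that carry
flow. -/
def Residual {n₁ n₂ : ℕ} (E : Finset (Fin n₁ × Fin n₂)) (par : Parents n₁ n₂) :
    Fin n₁ ⊕ Fin n₂ → Fin n₁ ⊕ Fin n₂ → Prop
  | .inl u, .inr w => (u, w) ∈ E
  | .inr w, .inl u => par u = some w
  | _, _ => False

/-- `ResPath E par x k`: there is a path in the residual network from the node `x` to a `WT₁`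
branch on which `k` nodes of `V₁` (counting `x` if it is one) are met. -/
inductive ResPath {n₁ n₂ : ℕ} (E : Finset (Fin n₁ × Fin n₂)) (par : Parents n₁ n₂) :
    Fin n₁ ⊕ Fin n₂ → ℕ → Prop
  | base {w : Fin n₂} : IsWT1 par w → ResPath E par (.inr w) 0
  | fromV1 {u : Fin n₁} {y : Fin n₁ ⊕ Fin n₂} {k : ℕ} :
      Residual E par (.inl u) y → ResPath E par y k → ResPath E par (.inl u) (k + 1)
  | fromV2 {w : Fin n₂} {y : Fin n₁ ⊕ Fin n₂} {k : ℕ} :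
      Residual E par (.inr w) y → ResPath E par y k → ResPath E par (.inr w) k

/-- The two-edge distance label of a node: the number of nodes of `V₁` on a shortest residual path
from the node to a `WT₁` branch, and `⊤` if there is no such path. -/
noncomputable def twoEdgeLabel {n₁ n₂ : ℕ} (E : Finset (Fin n₁ × Fin n₂)) (par : Parents n₁ n₂)
    (x : Fin n₁ ⊕ Fin n₂) : ℕ∞ :=
  sInf {d : ℕ∞ | ∃ k : ℕ, ResPath E par x k ∧ d = k}

/-- A merger of the current sequence of mergers: the node `node` of `V₁`, whose parent was `old`
(`none` if it was an `ST₁` branch), has become the left child of `root`. -/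
structure Frame (n₁ n₂ : ℕ) where
  node : Fin n₁
  old : Option (Fin n₂)
  root : Fin n₂

/-- A state of the algorithm: the tree, the labels of the current layered network, the number `ℓ` of
the current stage, the visited nodes of `V₂`, and the mergers of the current sequence that have not
been undone, the latest first. If this list is not empty, its first entry belongs to the only `ST₂`
branch. -/
structure State (n₁ n₂ : ℕ) where
  par : Parents n₁ n₂
  label : Fin n₁ ⊕ Fin n₂ → ℕ∞
  stage : ℕ∞
  visited : Set (Fin n₂)
  stack : List (Frame n₁ n₂)

/-- The state after a global relabeling: the labels are the two-edge distances, the stage `ℓ` is the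
lowest label of an `ST₁` branch (`⊤` if there is none), and all nodes are unvisited. -/
noncomputable def State.layered {n₁ n₂ : ℕ} (E : Finset (Fin n₁ × Fin n₂)) (par : Parents n₁ n₂) :
    State n₁ n₂ where
  par := par
  label := twoEdgeLabel E par
  stage := ⨅ (u : Fin n₁) (_ : IsST1 par u), twoEdgeLabel E par (.inl u)
  visited := ∅
  stack := []

/-- The initial state: all nodes are singleton branches. Stage `1` from here is the greedy
initialization. -/
noncomputable def State.initial {n₁ n₂ : ℕ} (E : Finset (Fin n₁ × Fin n₂)) : State n₁ n₂ :=
  State.layered E fun _ => none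

/-- The nodes of `V₁` from which a merger may be looked for: in the middle of a sequence of mergers
the right child of the `ST₂` branch, and otherwise the `ST₁` branches of label `ℓ`. -/
def State.Searching {n₁ n₂ : ℕ} (s : State n₁ n₂) (u : Fin n₁) : Prop :=
  match s.stack with
  | [] => IsST1 s.par u ∧ s.stage ≠ ⊤ ∧ s.label (.inl u) = s.stage
  | f :: _ => u ≠ f.node ∧ s.par u = some f.root

/-- `(u, w)` is a merger arc: it leads from a searching node of some label `p` to an unvisited node
of label `p - 1`. -/
def State.MergerArc {n₁ n₂ : ℕ} (E : Finset (Fin n₁ × Fin n₂)) (s : State n₁ n₂)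
    (u : Fin n₁) (w : Fin n₂) : Prop :=
  s.Searching u ∧ (u, w) ∈ E ∧ w ∉ s.visited ∧ s.label (.inl u) = s.label (.inr w) + 1

/-- The operations of the algorithm; `α` and `β` are the types of names for nodes of `V₁`, `V₂`. -/
inductive Op (α β : Type) where
  | merge (u : α) (w : β)
  | backtrack
  | relabel

/-- Rename the nodes. -/
def Op.map {α β α' β' : Type} (f : α → α') (g : β → β') : Op α β → Op α' β'
  | .merge u w => .merge (f u) (g w)
  | .backtrack => .backtrack
  | .relabel => .relabel

/-- One operation of the algorithm.
* `extend`: a merger to the root of a `WT₂` branch, which makes it an `ST₂` branch.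
* `augment`: a merger to a `WT₁` branch, which completes a successful path; all branches of the
  path are marked as visited.
* `backtrack`: there is no merger from the right child of the `ST₂` branch; the last merger is
  undone and the root is marked as visited.
* `relabel`: there are no more mergers in this stage; a new layered network is generated.

No operation is possible once `stage = ⊤`. -/
inductive Step {n₁ n₂ : ℕ} (E : Finset (Fin n₁ × Fin n₂)) :
    State n₁ n₂ → Op (Fin n₁) (Fin n₂) → State n₁ n₂ → Prop
  | extend {s : State n₁ n₂} {u : Fin n₁} {w : Fin n₂} :
      s.MergerArc E u w → s.label (.inr w) ≠ 0 →
      Step E s (.merge u w)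
        { s with
          par := Function.update s.par u (some w)
          stack := ⟨u, s.par u, w⟩ :: s.stack }
  | augment {s : State n₁ n₂} {u : Fin n₁} {w : Fin n₂} :
      s.MergerArc E u w → s.label (.inr w) = 0 →
      Step E s (.merge u w)
        { s with
          par := Function.update s.par u (some w)
          visited := s.visited ∪ {r | r = w ∨ ∃ f ∈ s.stack, f.root = r}
          stack := [] }
  | backtrack {s : State n₁ n₂} {f : Frame n₁ n₂} {rest : List (Frame n₁ n₂)} :
      s.stack = f :: rest → (∀ u w, ¬ s.MergerArc E u w) →
      Step E s .backtrack
        { s with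
          par := Function.update s.par f.node f.old
          visited := insert f.root s.visited
          stack := rest }
  | relabel {s : State n₁ n₂} :
      s.stack = [] → s.stage ≠ ⊤ → (∀ u w, ¬ s.MergerArc E u w) →
      Step E s .relabel (State.layered E s.par)

/-- A sequence of operations of the algorithm leads from one state to another. -/
inductive Steps {n₁ n₂ : ℕ} (E : Finset (Fin n₁ × Fin n₂)) :
    State n₁ n₂ → List (Op (Fin n₁) (Fin n₂)) → State n₁ n₂ → Prop
  | nil {s : State n₁ n₂} : Steps E s [] s
  | cons {s s' s'' : State n₁ n₂} {o : Op (Fin n₁) (Fin n₂)} {os : List (Op (Fin n₁) (Fin n₂))} :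
      Step E s o s' → Steps E s' os s'' → Steps E s (o :: os) s''

/-- `os` is a complete run of the matching-pseudoflow algorithm, which ends in the state `s`: no
`ST₁` branch can reach a `WT₁` branch any more. -/
def IsRun {n₁ n₂ : ℕ} (E : Finset (Fin n₁ × Fin n₂)) (os : List (Op (Fin n₁) (Fin n₂)))
    (s : State n₁ n₂) : Prop :=
  Steps E (State.initial E) os s ∧ s.stage = ⊤

/-- The set of in-tree edges. -/
def treeEdges {n₁ n₂ : ℕ} (par : Parents n₁ n₂) : Finset (Fin n₁ × Fin n₂) :=
  Finset.univ.filter fun e => par e.1 = some e.2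

/-! ## A random access machine with boolean operations on `lam`-bit words -/

/-- A word of `lam` bits. -/
abbrev Word (lam : ℕ) := Fin lam → Bool

/-- The index (from `1`) of the leading non-zero bit, and `0` if all bits are `0`. -/
noncomputable def Word.lead {lam : ℕ} (W : Word lam) : ℕ :=
  open Classical in
  if h : ∃ k : ℕ, ∃ b : Fin lam, W b = true ∧ k = b.val + 1 then Nat.find h else 0

/-- The bit at the offset `b`. -/
def Word.get {lam : ℕ} (W : Word lam) (b : ℕ) : Bool := if h : b < lam then W ⟨b, h⟩ else false

/-- Overwrite the bit at the offset `b`. -/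
def Word.set {lam : ℕ} (W : Word lam) (b : ℕ) (v : Bool) : Word lam :=
  fun c => if c.val = b then v else W c

/-- The memory: integer registers, two-dimensional arrays of integers, two-dimensional arrays of
words, and a write-only log of the operations that have been carried out. The first argument of
`reg`, `arr` and `wrd` is the name of the register or array. Row `i` of a word array `a`, that is
`wrd a i 0, wrd a i 1, …`, is a long word that is cut into `lam`-bit words. -/
structure Store (lam : ℕ) where
  reg : ℕ → ℕ
  arr : ℕ → ℕ → ℕ → ℕ
  wrd : ℕ → ℕ → ℕ → Word lam
  log : List (Op ℕ ℕ)

/-- Operations on integers; `lt` and `eq` give `1` for true and `0` for false. -/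
inductive BinOp where
  | add | sub | mul | div | mod | lt | eq

def BinOp.eval : BinOp → ℕ → ℕ → ℕ
  | .add, x, y => x + y
  | .sub, x, y => x - y
  | .mul, x, y => x * y
  | .div, x, y => x / y
  | .mod, x, y => x % y
  | .lt, x, y => if x < y then 1 else 0
  | .eq, x, y => if x = y then 1 else 0

/-- Integer expressions: constants, registers, array entries `a[i][j]`, operations. -/
inductive Expr where
  | const (c : ℕ)
  | reg (x : ℕ)
  | read (a : ℕ) (i j : Expr)
  | bin (o : BinOp) (e₁ e₂ : Expr)

def Expr.eval {lam : ℕ} (s : Store lam) : Expr → ℕ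
  | .const c => c
  | .reg x => s.reg x
  | .read a i j => s.arr a (i.eval s) (j.eval s)
  | .bin o e₁ e₂ => o.eval (e₁.eval s) (e₂.eval s)

/-- Word expressions: the zero word, array entries `a[i][j]`, bitwise AND and OR. -/
inductive WExpr where
  | zero
  | read (a : ℕ) (i j : Expr)
  | and (e₁ e₂ : WExpr)
  | or (e₁ e₂ : WExpr)

def WExpr.eval {lam : ℕ} (s : Store lam) : WExpr → Word lam
  | .zero => fun _ => false
  | .read a i j => s.wrd a (i.eval s) (j.eval s)
  | .and e₁ e₂ => fun b => e₁.eval s b && e₂.eval s b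
  | .or e₁ e₂ => fun b => e₁.eval s b || e₂.eval s b

/-- Programs. -/
inductive Cmd where
  | skip
  /-- `x := e` -/
  | assign (x : ℕ) (e : Expr)
  /-- `a[i][j] := e` for an integer array `a` -/
  | write (a : ℕ) (i j e : Expr)
  /-- `a[i][j] := e` for a word array `a` -/
  | wwrite (a : ℕ) (i j : Expr) (e : WExpr)
  /-- `x := lead(e)` -/
  | lead (x : ℕ) (e : WExpr)
  /-- `x :=` the `k`-th bit (counted from `1`) of the long word in row `i` of `a` -/
  | getBit (x : ℕ) (a : ℕ) (i k : Expr)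
  /-- the `k`-th bit (counted from `1`) of the long word in row `i` of `a` becomes `v` -/
  | setBit (a : ℕ) (i k : Expr) (v : Bool)
  /-- announce an operation of the algorithm -/
  | emit (o : Op Expr Expr)
  | seq (c₁ c₂ : Cmd)
  /-- `if e ≠ 0 then c₁ else c₂` -/
  | ite (e : Expr) (c₁ c₂ : Cmd)
  /-- `while e ≠ 0 do c` -/
  | loop (e : Expr) (c : Cmd)

/-- `Exec N c s s' t`: the program `c`, started with the memory `s`, halts with the memory `s'`
after `t` steps, and never stores an integer greater than `N`. Each elementary command and each
test of a condition is one step. (The length of the expressions is fixed by the program.) -/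
inductive Exec {lam : ℕ} (N : ℕ) : Cmd → Store lam → Store lam → ℕ → Prop
  | skip {s : Store lam} : Exec N .skip s s 1
  | assign {s : Store lam} {x : ℕ} {e : Expr} : e.eval s ≤ N →
      Exec N (.assign x e) s { s with reg := Function.update s.reg x (e.eval s) } 1
  | write {s : Store lam} {a : ℕ} {i j e : Expr} : e.eval s ≤ N →
      Exec N (.write a i j e) s
        { s with
          arr := fun a' i' j' =>
            if a' = a ∧ i' = i.eval s ∧ j' = j.eval s then e.eval s else s.arr a' i' j' } 1
  | wwrite {s : Store lam} {a : ℕ} {i j : Expr} {e : WExpr} :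
      Exec N (.wwrite a i j e) s
        { s with
          wrd := fun a' i' j' =>
            if a' = a ∧ i' = i.eval s ∧ j' = j.eval s then e.eval s else s.wrd a' i' j' } 1
  | lead {s : Store lam} {x : ℕ} {e : WExpr} : (e.eval s).lead ≤ N →
      Exec N (.lead x e) s { s with reg := Function.update s.reg x (e.eval s).lead } 1
  | getBit {s : Store lam} {x a : ℕ} {i k : Expr} {p : ℕ} : k.eval s = p + 1 → 1 ≤ N →
      Exec N (.getBit x a i k) s
        { s with
          reg := Function.update s.reg x
            (if (s.wrd a (i.eval s) (p / lam)).get (p % lam) = true then 1 else 0) } 1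
  | setBit {s : Store lam} {a : ℕ} {i k : Expr} {v : Bool} {p : ℕ} : k.eval s = p + 1 →
      Exec N (.setBit a i k v) s
        { s with
          wrd := fun a' i' j' =>
            if a' = a ∧ i' = i.eval s ∧ j' = p / lam then (s.wrd a' i' j').set (p % lam) v
            else s.wrd a' i' j' } 1
  | emit {s : Store lam} {o : Op Expr Expr} :
      Exec N (.emit o) s
        { s with log := s.log ++ [o.map (fun e => e.eval s) (fun e => e.eval s)] } 1
  | seq {c₁ c₂ : Cmd} {s s' s'' : Store lam} {t t' : ℕ} :
      Exec N c₁ s s' t → Exec N c₂ s' s'' t' → Exec N (.seq c₁ c₂) s s'' (t + t')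
  | iteTrue {e : Expr} {c₁ c₂ : Cmd} {s s' : Store lam} {t : ℕ} :
      e.eval s ≠ 0 → Exec N c₁ s s' t → Exec N (.ite e c₁ c₂) s s' (t + 1)
  | iteFalse {e : Expr} {c₁ c₂ : Cmd} {s s' : Store lam} {t : ℕ} :
      e.eval s = 0 → Exec N c₂ s s' t → Exec N (.ite e c₁ c₂) s s' (t + 1)
  | loopStop {e : Expr} {c : Cmd} {s : Store lam} :
      e.eval s = 0 → Exec N (.loop e c) s s 1
  | loopStep {e : Expr} {c : Cmd} {s s' s'' : Store lam} {t t' : ℕ} :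
      e.eval s ≠ 0 → Exec N c s s' t → Exec N (.loop e c) s' s'' t' →
      Exec N (.loop e c) s s'' (t + t' + 1)

/-! ## Input, output, and the bound

In the memory the nodes of each side are numbered from `1`. -/

/-- Entry `k` of a list of nodes, as a number, with `0` behind the end of the list. -/
def entry {n : ℕ} (L : List (Fin n)) (k : ℕ) : ℕ := ((L.map fun v => v.val + 1)[k]?).getD 0

/-- Row `i` of a family of lists of nodes. -/
def row {n n' : ℕ} (L : Fin n → List (Fin n')) (i : ℕ) : List (Fin n') :=
  if h : 1 ≤ i ∧ i - 1 < n then L ⟨i - 1, h.2⟩ else []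

open Classical in
/-- The memory at the start. Registers `0`, `1`, `2` hold `n₁`, `n₂`, `lam`. Integer arrays `0` and
`1` hold the lists of out-neighbours and of in-neighbours (row `i` is the list of node `i`, ended by
a `0`). Word arrays `0` and `1` hold the words OUT and IN (row `i` is the characteristic vector of
the neighbours of node `i`). All the rest is zero. -/
noncomputable def inputStore {n₁ n₂ : ℕ} (lam : ℕ) (E : Finset (Fin n₁ × Fin n₂))
    (A : AdjLists E) : Store lam where
  reg := fun x => if x = 0 then n₁ else if x = 1 then n₂ else if x = 2 then lam else 0
  arr := fun a i k =>
    if a = 0 then entry (row A.outList i) k else if a = 1 then entry (row A.inList i) k else 0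
  wrd := fun a i j b => decide (
    (a = 0 ∧ ∃ e ∈ E, i = e.1.val + 1 ∧ j * lam + b.val = e.2.val) ∨
    (a = 1 ∧ ∃ e ∈ E, i = e.2.val + 1 ∧ j * lam + b.val = e.1.val))
  log := []

/-- The output: entry `[u][0]` of integer array `2` is the node matched with the node `u` of `V₁`,
or `0`. -/
def OutputIs {n₁ n₂ lam : ℕ} (s : Store lam) (par : Parents n₁ n₂) : Prop :=
  ∀ u : Fin n₁, s.arr 2 (u.val + 1) 0 = ((par u).map fun w => w.val + 1).getD 0

/-- `min {n₁ κ, n₁ n₂ / lam, m} + κ² + κ^{2.5} / lam`. -/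
noncomputable def wordBound {n₁ n₂ : ℕ} (lam : ℕ) (E : Finset (Fin n₁ × Fin n₂)) : ℝ :=
  min ((n₁ : ℝ) * matchingNumber E) (min ((n₁ : ℝ) * n₂ / lam) (E.card : ℝ))
    + (matchingNumber E : ℝ) ^ 2 + (matchingNumber E : ℝ) ^ (5 / 2 : ℝ) / lam

set_option linter.unusedSimpArgs false

/-! ## Distance labels -/

/-! Correctness is the Hopcroft–Karp argument, phrased with labels. During a stage the labels are
frozen, although the tree changes. `StageInv` records that along residual arcs they fall no faster
than the count of V₁-nodes (`feas`, `mono`), and that a visited node whose child has the same label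
leads, by admissible arcs out of that child, only to visited nodes (`block`). Suppose that no merger
is left and that an ST₁ branch still reaches a WT₁ branch with only ℓ nodes of V₁ on the path. Then
the path is tight throughout and begins with a merger arc, a contradiction. So ℓ strictly increases
(`StageInv.stage_lt`). Since an unchanged tree would have an unchanged ℓ, every stage after the
greedy one also matches a new pair.

The number of stages comes from vertex covers. Let k pairs be matched and let l < ℓ. For 1 ≤ p ≤ l,
the matched V₁-nodes of label at most p and the matched V₂-nodes of label at least p cover all
edges. This cover has k nodes plus the number of tree edges in layer p, so each of the l disjoint
layers holds at least κ - k tree edges, and l(κ - k) ≤ k (`mul_matchingNumber_sub_le`). Hence O(√κ)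
stages suffice (`stagesLeft_lt`). The analogous cover that separates finite from infinite labels
shows that the matching is maximum once ℓ = ⊤ (`card_treeEdges_eq_of_stage_eq_top`).

For the running time, everything after the greedy stage is confined to matched nodes. They are
numbered in the order in which they become matched and keep their numbers. The adjacency matrix of
the numbered nodes and its transpose are held in words, and an augmentation adds one row and one
column in O(κ) steps, which gives O(κ²) in all. A neighbour that is unlabelled (breadth-first
search) or unvisited in the next layer (depth-first search) is found as the leading bit of the AND
of two rows, in O(κ/λ + 1) steps. Each such search labels or retires a node, or pushes or pops a
merger, so a stage needs O(κ) of them (`phaseCost`). Multiplying by the number of stages gives κ² +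
κ^{2.5}/λ.

About unmatched nodes only one question arises: does a given matched node have an unmatched
neighbour? A pointer into its list answers it. The pointer passes only matched nodes, and these stay
matched, so it never moves back and stays at most κ. The pointers of unmatched nodes stay at 0, so
all pointer moves together cost O(κ²) (`PosRep.posSum_le`).

The greedy stage looks for a free neighbour through at most n₂/λ + 1 list entries and only then
through the words. The entries passed are matched nodes, so a node costs O(min(degree, κ, n₂/λ + 1))
steps, up to a constant. Summation over V₁ gives the minimum in the bound, which also dominates n₁
(`sum_searchCost_le`, `le_searchBound`).

The program is verified with a weakest precondition calculus that carries a clock. Loop invariants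
bound the clock by potentials (pointer positions, matched pairs, free nodes, stages left), and the
log of announced operations is shown to be a run of the abstract algorithm. -/

theorem not_add_one_le_of_ne_top {a : ℕ∞} (h : a ≠ ⊤) : ¬ a + 1 ≤ a := by
  obtain ⟨m, rfl⟩ := ENat.ne_top_iff_exists.1 h
  norm_cast
  omega

section Labels

variable {n₁ n₂ : ℕ} {E : Finset (Fin n₁ × Fin n₂)} {par : Parents n₁ n₂}

theorem twoEdgeLabel_le {x : Fin n₁ ⊕ Fin n₂} {k : ℕ} (h : ResPath E par x k) :
    twoEdgeLabel E par x ≤ k :=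
  sInf_le ⟨k, h, rfl⟩

theorem le_twoEdgeLabel {x : Fin n₁ ⊕ Fin n₂} {d : ℕ∞}
    (h : ∀ k : ℕ, ResPath E par x k → d ≤ k) : d ≤ twoEdgeLabel E par x :=
  le_sInf (by rintro _ ⟨k, hk, rfl⟩; exact h k hk)

theorem exists_resPath_of_ne_top {x : Fin n₁ ⊕ Fin n₂} (h : twoEdgeLabel E par x ≠ ⊤) :
    ∃ k : ℕ, ResPath E par x k ∧ twoEdgeLabel E par x = k := by
  have hne : {d : ℕ∞ | ∃ k : ℕ, ResPath E par x k ∧ d = k}.Nonempty := by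
    by_contra hc
    rw [Set.not_nonempty_iff_eq_empty] at hc
    exact h (by rw [twoEdgeLabel, hc, sInf_empty])
  exact csInf_mem hne

theorem twoEdgeLabel_inl_le {u : Fin n₁} {w : Fin n₂} (h : (u, w) ∈ E) :
    twoEdgeLabel E par (.inl u) ≤ twoEdgeLabel E par (.inr w) + 1 := by
  by_cases ht : twoEdgeLabel E par (.inr w) = ⊤
  · simp [ht]
  · obtain ⟨k, hk, e⟩ := exists_resPath_of_ne_top ht
    rw [e]
    exact_mod_cast twoEdgeLabel_le (.fromV1 (y := .inr w) h hk)

theorem twoEdgeLabel_inr_le {u : Fin n₁} {w : Fin n₂} (h : par u = some w) :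
    twoEdgeLabel E par (.inr w) ≤ twoEdgeLabel E par (.inl u) :=
  le_twoEdgeLabel fun _ hk => twoEdgeLabel_le (.fromV2 (y := .inl u) h hk)

/-- When a node has at most one child, every residual path out of a matched `w` has to go through
that child, and this arc does not change the count of V₁-nodes. -/
theorem twoEdgeLabel_inl_eq (hinj : ∀ u u' w, par u = some w → par u' = some w → u = u')
    {u : Fin n₁} {w : Fin n₂} (h : par u = some w) :
    twoEdgeLabel E par (.inl u) = twoEdgeLabel E par (.inr w) := by
  refine le_antisymm (le_twoEdgeLabel fun k hk => ?_) (twoEdgeLabel_inr_le h)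
  cases hk with
  | base hw => exact absurd h (hw u)
  | @fromV2 _ y _ hr hp =>
    cases y with
    | inl u' => exact twoEdgeLabel_le (hinj u u' w h hr ▸ hp)
    | inr w' => exact hr.elim

theorem twoEdgeLabel_inr_eq_zero {w : Fin n₂} :
    twoEdgeLabel E par (.inr w) = 0 ↔ IsWT1 par w := by
  constructor
  · intro h
    obtain ⟨k, hk, e⟩ := exists_resPath_of_ne_top (E := E) (par := par) (x := .inr w) (by simp [h])
    obtain rfl : k = 0 := by rw [h] at e; exact_mod_cast e.symm
    cases hk with
    | base hw => exact hw
    | @fromV2 _ y _ hr hp =>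
      cases y with
      | inl u' => cases hp
      | inr w' => exact hr.elim
  · intro h
    simpa using twoEdgeLabel_le (ResPath.base (E := E) h)

end Labels

/-! ## Invariants of a stage -/

/-- The facts about the tree, the labels and the visited nodes that hold during a stage whenever
there is no `ST₂` branch. -/
structure StageInv {n₁ n₂ : ℕ} (E : Finset (Fin n₁ × Fin n₂)) (par : Parents n₁ n₂)
    (label : Fin n₁ ⊕ Fin n₂ → ℕ∞) (stage : ℕ∞) (visited : Set (Fin n₂)) : Prop where
  edge : ∀ u w, par u = some w → (u, w) ∈ E
  inj : ∀ u u' w, par u = some w → par u' = some w → u = u'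
  feas : ∀ u w, (u, w) ∈ E → label (.inl u) ≤ label (.inr w) + 1
  mono : ∀ u w, par u = some w → label (.inr w) ≤ label (.inl u)
  eq : ∀ u w, w ∉ visited → par u = some w → label (.inl u) = label (.inr w)
  wt : ∀ w, IsWT1 par w → label (.inr w) = 0 ∧ w ∉ visited
  wt' : ∀ w, label (.inr w) = 0 → w ∉ visited → IsWT1 par w
  block : ∀ u w, w ∈ visited → par u = some w → label (.inl u) = label (.inr w) →
    ∀ w', (u, w') ∈ E → label (.inl u) = label (.inr w') + 1 → w' ∈ visited
  st : ∀ u, par u = none → stage ≤ label (.inl u)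

section StageInv

variable {n₁ n₂ : ℕ} {E : Finset (Fin n₁ × Fin n₂)} {par : Parents n₁ n₂}
  {label : Fin n₁ ⊕ Fin n₂ → ℕ∞} {stage : ℕ∞} {visited : Set (Fin n₂)}

theorem stageInv_layered (hedge : ∀ u w, par u = some w → (u, w) ∈ E)
    (hinj : ∀ u u' w, par u = some w → par u' = some w → u = u') :
    StageInv E par (State.layered E par).label (State.layered E par).stage
      (State.layered E par).visited where
  edge := hedge
  inj := hinj
  feas _ _ h := twoEdgeLabel_inl_le h
  mono _ _ h := twoEdgeLabel_inr_le h
  eq _ _ _ h := twoEdgeLabel_inl_eq hinj h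
  wt w h := ⟨twoEdgeLabel_inr_eq_zero.2 h, by simp [State.layered]⟩
  wt' w h _ := twoEdgeLabel_inr_eq_zero.1 h
  block _ _ h := by simp [State.layered] at h
  st u h := iInf₂_le u h

/-- After a stage the lowest label of an `ST₁` branch has increased. -/
theorem StageInv.stage_lt (h : StageInv E par label stage visited) (hs : stage ≠ ⊤)
    (hno : ∀ u w, ¬ State.MergerArc E ⟨par, label, stage, visited, []⟩ u w) :
    stage + 1 ≤ (State.layered E par).stage := by
  -- Old labels are lower bounds for the new distances. Where the bound is attained, a V₂-node must
  -- be unvisited and a V₁-node must have an admissible arc to an unvisited node. The critical case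
  -- is a visited `w` with a tight child: `block` would make all admissible targets of the child
  -- visited, against the induction hypothesis.
  have key : ∀ x k, ResPath E par x k → label x ≤ k ∧ (label x = k →
      Sum.elim (fun u => ∃ w, (u, w) ∈ E ∧ label (.inl u) = label (.inr w) + 1 ∧ w ∉ visited)
        (fun w => w ∉ visited) x) := by
    intro x k hp
    induction hp with
    | base hw => exact ⟨by simp [(h.wt _ hw).1], fun _ => (h.wt _ hw).2⟩
    | @fromV1 u y k hr hp ih =>
      cases y with
      | inl u' => exact hr.elim
      | inr w =>
        have h1 := h.feas u w hr
        refine ⟨?_, fun e => ⟨w, hr, ?_⟩⟩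
        · push_cast; exact h1.trans (by gcongr; exact ih.1)
        · have : label (.inr w) = k := by
            refine le_antisymm ih.1 ?_
            rw [e] at h1
            push_cast at h1
            exact (ENat.add_le_add_iff_right (by simp)).1 h1
          exact ⟨by rw [e, this]; push_cast; rfl, ih.2 this⟩
    | @fromV2 w y k hr hp ih =>
      cases y with
      | inr w' => exact hr.elim
      | inl u =>
        have h1 := h.mono u w hr
        refine ⟨h1.trans ih.1, fun e hv => ?_⟩
        have e2 : label (.inl u) = k := le_antisymm ih.1 (e ▸ h1)
        obtain ⟨w', hw', e3, hv'⟩ := ih.2 e2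
        exact hv' (h.block u w hv hr (e2.trans e.symm) w' hw' e3)
  refine le_iInf₂ fun u hu => le_twoEdgeLabel fun k hk => ?_
  obtain ⟨h1, h2⟩ := key _ _ hk
  have h3 := h.st u hu
  refine Order.add_one_le_of_lt (lt_of_le_of_ne (h3.trans h1) fun e => ?_)
  have e2 : label (.inl u) = k := le_antisymm h1 (e ▸ h3)
  obtain ⟨w, hw, e3, hv⟩ := h2 e2
  exact hno u w ⟨⟨hu, hs, e2.trans e.symm⟩, hw, hv, e3⟩

end StageInv

/-! ## Sequences of mergers -/

/-- `MergeChain E par₀ label stage visited fs par`: the mergers `fs`, latest first, form a path of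
merger arcs that starts at an `ST₁` branch of the tree `par₀`, and lead to the tree `par`. -/
inductive MergeChain {n₁ n₂ : ℕ} (E : Finset (Fin n₁ × Fin n₂)) (par₀ : Parents n₁ n₂)
    (label : Fin n₁ ⊕ Fin n₂ → ℕ∞) (stage : ℕ∞) (visited : Set (Fin n₂)) :
    List (Frame n₁ n₂) → Parents n₁ n₂ → Prop
  | nil : MergeChain E par₀ label stage visited [] par₀
  | cons {f : Frame n₁ n₂} {rest : List (Frame n₁ n₂)} {par : Parents n₁ n₂} :
      MergeChain E par₀ label stage visited rest par → f.old = par f.node →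
      (f.node, f.root) ∈ E → f.root ∉ visited →
      label (.inl f.node) = label (.inr f.root) + 1 →
      (rest = [] → par₀ f.node = none ∧ label (.inl f.node) = stage) →
      (∀ g rest', rest = g :: rest' → par₀ f.node = some g.root) →
      MergeChain E par₀ label stage visited (f :: rest) (Function.update par f.node (some f.root))

section MergeChain

variable {n₁ n₂ : ℕ} {E : Finset (Fin n₁ × Fin n₂)} {par par₀ : Parents n₁ n₂}
  {label : Fin n₁ ⊕ Fin n₂ → ℕ∞} {stage : ℕ∞} {visited : Set (Fin n₂)}
  {fs rest : List (Frame n₁ n₂)} {f : Frame n₁ n₂}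

/-- Each merger descends one layer, and the right child of an unvisited root has the label of that
root. So the path goes down by exactly one label per merger, starting at `stage`. -/
theorem MergeChain.label_add (hI : StageInv E par₀ label stage visited)
    (h : MergeChain E par₀ label stage visited fs par) :
    ∀ f rest, fs = f :: rest → label (.inl f.node) + rest.length = stage := by
  induction h with
  | nil => intro f rest e; simp at e
  | @cons f rest par hc ho he hv hl h0 h1 ih =>
    rintro f' rest' e
    simp only [List.cons.injEq] at e
    obtain ⟨rfl, rfl⟩ := e
    cases rest with
    | nil => simpa using (h0 rfl).2
    | cons g r =>
      have e1 := ih g r rfl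
      have e2 := h1 g r rfl
      have hg : g.root ∉ visited ∧ label (.inl g.node) = label (.inr g.root) + 1 := by
        cases hc with
        | cons _ _ _ hv' hl' => exact ⟨hv', hl'⟩
      rw [hI.eq _ _ hg.1 e2, ← e1, hg.2]
      push_cast [List.length_cons]
      rw [add_assoc, add_comm (1 : ℕ∞)]

/-- Strict descent is what makes the nodes and the roots of the path pairwise distinct, so the
single updates of the tree do not interfere. -/
theorem MergeChain.label_lt (hI : StageInv E par₀ label stage visited)
    (h : MergeChain E par₀ label stage visited fs par) :
    ∀ f rest, fs = f :: rest → ∀ g ∈ rest, label (.inl f.node) + 1 ≤ label (.inl g.node) := by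
  induction h with
  | nil => intro f rest e; simp at e
  | @cons f rest par hc ho he hv hl h0 h1 ih =>
    rintro f' rest' e g hg
    simp only [List.cons.injEq] at e
    obtain ⟨rfl, rfl⟩ := e
    cases rest with
    | nil => simp at hg
    | cons g' r =>
      have e2 := h1 g' r rfl
      have hg' : g'.root ∉ visited ∧ label (.inl g'.node) = label (.inr g'.root) + 1 := by
        cases hc with
        | cons _ _ _ hv' hl' => exact ⟨hv', hl'⟩
      have e3 : label (.inl f.node) + 1 = label (.inl g'.node) := by
        rw [hI.eq _ _ hg'.1 e2, hg'.2]
      rw [e3]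
      rcases List.mem_cons.1 hg with rfl | hg
      · exact le_rfl
      · exact le_self_add.trans (ih g' r rfl g hg)

theorem MergeChain.forall_mem (h : MergeChain E par₀ label stage visited fs par) :
    ∀ f ∈ fs, (f.node, f.root) ∈ E ∧ f.root ∉ visited ∧
      label (.inl f.node) = label (.inr f.root) + 1 := by
  induction h with
  | nil => simp
  | @cons f rest par hc ho he hv hl h0 h1 ih =>
    rintro g hg
    rcases List.mem_cons.1 hg with rfl | hg
    · exact ⟨he, hv, hl⟩
    · exact ih g hg

theorem MergeChain.label_ne_top (hI : StageInv E par₀ label stage visited) (hs : stage ≠ ⊤)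
    (h : MergeChain E par₀ label stage visited fs par) :
    ∀ f ∈ fs, label (.inl f.node) ≠ ⊤ := by
  induction h with
  | nil => simp
  | @cons f rest par hc ho he hv hl h0 h1 ih =>
    rintro g hg
    rcases List.mem_cons.1 hg with rfl | hg
    · intro e
      have := (MergeChain.cons hc ho he hv hl h0 h1).label_add hI g rest rfl
      rw [e, top_add] at this
      exact hs this.symm
    · exact ih g hg

/-- What a sequence of mergers does to the tree. -/
theorem MergeChain.par_eq (hI : StageInv E par₀ label stage visited) (hs : stage ≠ ⊤)
    (h : MergeChain E par₀ label stage visited fs par) :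
    (∀ f ∈ fs, par f.node = some f.root) ∧
    (∀ u, (∀ f ∈ fs, f.node ≠ u) → par u = par₀ u) ∧
    (fs.map Frame.node).Nodup ∧ (fs.map Frame.root).Nodup := by
  induction h with
  | nil => simp
  | @cons f rest par hc ho he hv hl h0 h1 ih =>
    obtain ⟨i1, i2, i3, i4⟩ := ih
    have hch := MergeChain.cons hc ho he hv hl h0 h1
    have hlt := hch.label_lt hI f rest rfl
    have htop := hch.label_ne_top hI hs
    have hne : ∀ g ∈ rest, label (.inl g.node) ≠ label (.inl f.node) := by
      intro g hg e
      have := hlt g hg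
      rw [e] at this
      exact not_add_one_le_of_ne_top (htop f (by simp)) this
    have hn : ∀ g ∈ rest, g.node ≠ f.node := fun g hg e => hne g hg (by rw [e])
    have hr : ∀ g ∈ rest, g.root ≠ f.root := fun g hg e => hne g hg (by
      rw [hl, (hc.forall_mem g hg).2.2, e])
    refine ⟨?_, ?_, ?_, ?_⟩
    · intro g hg
      rcases List.mem_cons.1 hg with rfl | hg
      · simp
      · rw [Function.update_of_ne (hn g hg)]; exact i1 g hg
    · intro u hu
      rw [Function.update_of_ne (fun e => hu f (by simp) e.symm)]
      exact i2 u fun g hg => hu g (by simp [hg])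
    · simp only [List.map_cons, List.nodup_cons, List.mem_map, not_exists, not_and]
      exact ⟨hn, i3⟩
    · simp only [List.map_cons, List.nodup_cons, List.mem_map, not_exists, not_and]
      exact ⟨hr, i4⟩

/-- The old parents of the nodes of a sequence of mergers are the other roots, and the first node
had none. -/
theorem MergeChain.par₀_eq (h : MergeChain E par₀ label stage visited fs par) :
    (∀ f rest, fs = f :: rest → (∀ g ∈ rest, ∃ g' ∈ fs, par₀ g'.node = some g.root)) ∧
    (∀ f ∈ fs, par₀ f.node = none ∨ ∃ g ∈ fs.tail, par₀ f.node = some g.root) ∧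
    (fs ≠ [] → ∃ f₀ ∈ fs, par₀ f₀.node = none ∧ fs.getLast? = some f₀ ∧
      label (.inl f₀.node) = stage ∧ ∀ f ∈ fs, par₀ f.node = none → f = f₀) := by
  induction h with
  | nil => simp
  | @cons f rest par hc ho he hv hl h0 h1 ih =>
    obtain ⟨i1, i2, i3⟩ := ih
    refine ⟨?_, ?_, fun _ => ?_⟩
    · rintro f' rest' e g hg
      simp only [List.cons.injEq] at e
      obtain ⟨rfl, rfl⟩ := e
      cases rest with
      | nil => simp at hg
      | cons g' r =>
        rcases List.mem_cons.1 hg with rfl | hg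
        · exact ⟨f, by simp, h1 _ _ rfl⟩
        · obtain ⟨a, ha, e⟩ := i1 g' r rfl g hg
          exact ⟨a, List.mem_cons_of_mem _ ha, e⟩
    · intro g hg
      rcases List.mem_cons.1 hg with rfl | hg
      · cases rest with
        | nil => exact Or.inl (h0 rfl).1
        | cons g' r => exact Or.inr ⟨g', by simp, h1 _ _ rfl⟩
      · rcases i2 g hg with h | ⟨a, ha, e⟩
        · exact Or.inl h
        · exact Or.inr ⟨a, by simpa using List.mem_of_mem_tail ha, e⟩
    · cases rest with
      | nil => exact ⟨f, by simp, (h0 rfl).1, by simp, (h0 rfl).2, by simp⟩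
      | cons g' r =>
        obtain ⟨f₀, hf, e1, e2, e3, e4⟩ := i3 (by simp)
        refine ⟨f₀, List.mem_cons_of_mem _ hf, e1, by simpa using e2, e3, ?_⟩
        intro g hg e
        rcases List.mem_cons.1 hg with rfl | hg
        · rw [h1 _ _ rfl] at e; simp at e
        · exact e4 g hg e

/-- The children of the `ST₂` branch. -/
theorem MergeChain.par_eq_root_iff (hI : StageInv E par₀ label stage visited) (hs : stage ≠ ⊤)
    (h : MergeChain E par₀ label stage visited (f :: rest) par) (u : Fin n₁) :
    (u ≠ f.node ∧ par u = some f.root) ↔ par₀ u = some f.root := by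
  obtain ⟨p1, p2, p3, p4⟩ := h.par_eq hI hs
  have hfm := h.forall_mem f (by simp)
  have hft := h.label_ne_top hI hs f (by simp)
  -- A child of the top root has the label of that root, which is below the labels of all nodes on
  -- the path; so it has not been moved by an earlier merger.
  have hnot : par₀ u = some f.root → ∀ g ∈ f :: rest, g.node ≠ u := by
    rintro e g hg rfl
    have e1 := hI.eq _ _ hfm.2.1 e
    have h2 : label (.inl f.node) ≤ label (.inl g.node) := by
      rcases List.mem_cons.1 hg with rfl | hg
      · exact le_rfl
      · exact le_self_add.trans (h.label_lt hI f rest rfl g hg)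
    rw [e1, hfm.2.2] at h2
    rw [hfm.2.2] at hft
    have h3 : label (.inr f.root) ≠ ⊤ := fun e => hft (by simp [e])
    exact not_add_one_le_of_ne_top h3 h2
  constructor
  · rintro ⟨hu, e⟩
    by_cases hm : ∃ g ∈ rest, g.node = u
    · obtain ⟨g, hg, rfl⟩ := hm
      rw [p1 g (by simp [hg])] at e
      simp only [List.map_cons, List.nodup_cons, List.mem_map, not_exists, not_and] at p4
      exact absurd (Option.some_injective _ e) (p4.1 g hg)
    · rw [← p2 u, e]
      intro g hg
      rcases List.mem_cons.1 hg with rfl | hg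
      · exact hu.symm
      · exact fun e => hm ⟨g, hg, e⟩
  · intro e
    have := hnot e
    exact ⟨(this f (by simp)).symm, by rw [p2 u this, e]⟩

/-- A successful path makes one node of each side matched. -/
theorem MergeChain.success (hI : StageInv E par₀ label stage visited) (hs : stage ≠ ⊤)
    (h : MergeChain E par₀ label stage visited (f :: rest) par)
    (h0 : label (.inr f.root) = 0) :
    (∀ g ∈ f :: rest, par g.node = some g.root) ∧
    (∀ u, (∀ g ∈ f :: rest, g.node ≠ u) → par u = par₀ u) ∧
    (∀ w, (∀ g ∈ f :: rest, g.root ≠ w) → ∀ u, par u = some w ↔ par₀ u = some w) ∧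
    (∃ f₀ : Frame n₁ n₂, (f :: rest).getLast? = some f₀ ∧ par₀ f₀.node = none ∧
      ∀ u, par u = none ↔ par₀ u = none ∧ u ≠ f₀.node) ∧
    IsWT1 par₀ f.root ∧ (∀ w, IsWT1 par w ↔ IsWT1 par₀ w ∧ w ≠ f.root) := by
  obtain ⟨p1, p2, p3, p4⟩ := h.par_eq hI hs
  obtain ⟨q1, q2, q3⟩ := h.par₀_eq
  obtain ⟨f₀, m0, m1, m2, -, m3⟩ := q3 (by simp)
  have hwt : IsWT1 par₀ f.root := hI.wt' _ h0 (h.forall_mem f (by simp)).2.1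
  -- Every root on the path except the last was matched before, and its old child is the next node
  -- of the path. The path is therefore alternating, and each old child finds a new parent.
  have hcov : ∀ g ∈ f :: rest, ∀ u, par₀ u = some g.root → ∃ g' ∈ f :: rest, g'.node = u := by
    intro g hg u e
    rcases List.mem_cons.1 hg with rfl | hg
    · exact absurd e (hwt u)
    · obtain ⟨g', hg', e'⟩ := q1 f rest rfl g hg
      exact ⟨g', hg', hI.inj _ _ _ e' e⟩
  have hroot : ∀ w, (∀ g ∈ f :: rest, g.root ≠ w) → ∀ u, par u = some w ↔ par₀ u = some w := by
    intro w hw u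
    by_cases hu : ∃ g ∈ f :: rest, g.node = u
    · obtain ⟨g, hg, rfl⟩ := hu
      rw [p1 g hg]
      refine ⟨fun e => absurd (Option.some_injective _ e) (hw g hg), fun e => ?_⟩
      rcases q2 g hg with h | ⟨a, ha, e'⟩
      · rw [h] at e; simp at e
      · rw [e'] at e
        exact absurd (Option.some_injective _ e) (hw a (List.mem_of_mem_tail ha))
    · push Not at hu
      rw [p2 u hu]
  refine ⟨p1, p2, hroot, ⟨f₀, m2, m1, fun u => ?_⟩, hwt, fun w => ?_⟩
  · by_cases hu : ∃ g ∈ f :: rest, g.node = u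
    · obtain ⟨g, hg, rfl⟩ := hu
      rw [p1 g hg]
      refine ⟨fun e => by simp at e, fun ⟨e, hn⟩ => absurd (by rw [m3 g hg e]) hn⟩
    · push Not at hu
      rw [p2 u hu]
      exact ⟨fun e => ⟨e, (hu f₀ m0).symm⟩, fun e => e.1⟩
  · by_cases hw : ∃ g ∈ f :: rest, g.root = w
    · obtain ⟨g, hg, rfl⟩ := hw
      refine ⟨fun e => absurd (p1 g hg) (e _), fun ⟨e, hn⟩ => ?_⟩
      rcases List.mem_cons.1 hg with rfl | hg
      · exact absurd rfl hn
      · obtain ⟨g', hg', e'⟩ := q1 f rest rfl g hg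
        exact absurd e' (e _)
    · push Not at hw
      have : IsWT1 par w ↔ IsWT1 par₀ w := by
        simp only [IsWT1, ne_eq, hroot w hw]
      rw [this]
      exact ⟨fun e => ⟨e, (hw f (by simp)).symm⟩, fun e => e.1⟩

/-- All new tree edges descend by one label and all their roots become visited. So `eq` makes no
claim about them, and `block` is vacuous because child and parent have different finite labels. -/
theorem MergeChain.stageInv_success (hI : StageInv E par₀ label stage visited) (hs : stage ≠ ⊤)
    (h : MergeChain E par₀ label stage visited (f :: rest) par)
    (h0 : label (.inr f.root) = 0) :
    StageInv E par label stage (visited ∪ {r | ∃ g ∈ f :: rest, g.root = r}) := by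
  obtain ⟨p1, p2, p3, ⟨f₀, m2, m1, m3⟩, p5, p6⟩ := h.success hI hs h0
  obtain ⟨-, -, -, p4⟩ := h.par_eq hI hs
  have hfm := h.forall_mem
  have htop := h.label_ne_top hI hs
  have hmem : ∀ u w, par u = some w → (∃ g ∈ f :: rest, g.node = u ∧ g.root = w) ∨
      ((∀ g ∈ f :: rest, g.root ≠ w) ∧ par₀ u = some w) := by
    intro u w e
    by_cases hu : ∃ g ∈ f :: rest, g.node = u
    · obtain ⟨g, hg, rfl⟩ := hu
      rw [p1 g hg] at e
      exact Or.inl ⟨g, hg, rfl, Option.some_injective _ e⟩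
    · push Not at hu
      by_cases hw : ∃ g ∈ f :: rest, g.root = w
      · obtain ⟨g, hg, rfl⟩ := hw
        rw [p2 u hu] at e
        rcases List.mem_cons.1 hg with rfl | hg
        · exact absurd e (p5 u)
        · obtain ⟨g', hg', e'⟩ := h.par₀_eq.1 f rest rfl g hg
          exact absurd (hI.inj _ _ _ e' e) (hu g' hg')
      · push Not at hw
        exact Or.inr ⟨hw, (p3 w hw u).1 e⟩
  constructor
  · intro u w e
    rcases hmem u w e with ⟨g, hg, rfl, rfl⟩ | ⟨-, e⟩
    · exact (hfm g hg).1
    · exact hI.edge _ _ e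
  · intro u u' w e e'
    rcases hmem u w e with ⟨g, hg, rfl, rfl⟩ | ⟨hn, e⟩
    · rcases hmem u' _ e' with ⟨g', hg', rfl, e2⟩ | ⟨hn, -⟩
      · rw [List.inj_on_of_nodup_map p4 hg' hg e2]
      · exact absurd rfl (hn g hg)
    · rcases hmem u' w e' with ⟨g', hg', rfl, e2⟩ | ⟨-, e'⟩
      · exact absurd e2 (hn g' hg')
      · exact hI.inj _ _ _ e e'
  · exact hI.feas
  · intro u w e
    rcases hmem u w e with ⟨g, hg, rfl, rfl⟩ | ⟨-, e⟩
    · rw [(hfm g hg).2.2]; exact le_self_add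
    · exact hI.mono _ _ e
  · intro u w hv e
    simp only [Set.mem_union, Set.mem_ofPred_eq, not_or, not_exists, not_and] at hv
    rcases hmem u w e with ⟨g, hg, rfl, rfl⟩ | ⟨-, e⟩
    · exact absurd rfl (hv.2 g hg)
    · exact hI.eq _ _ hv.1 e
  · intro w hw
    refine ⟨(hI.wt w ((p6 w).1 hw).1).1, ?_⟩
    simp only [Set.mem_union, Set.mem_ofPred_eq, not_or, not_exists, not_and]
    exact ⟨(hI.wt w ((p6 w).1 hw).1).2, fun g hg e => hw g.node (e ▸ p1 g hg)⟩
  · intro w e hv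
    simp only [Set.mem_union, Set.mem_ofPred_eq, not_or, not_exists, not_and] at hv
    exact (p6 w).2 ⟨hI.wt' w e hv.1, fun e => hv.2 f (by simp) e.symm⟩
  · intro u w hv e el w' hw' el'
    rcases hmem u w e with ⟨g, hg, rfl, rfl⟩ | ⟨hn, e⟩
    · have h1 := (hfm g hg).2.2
      have h2 := htop g hg
      rw [el] at h1 h2
      exact absurd h1 (by
        obtain ⟨m, hm⟩ := ENat.ne_top_iff_exists.1 h2
        rw [← hm]; norm_cast; omega)
    · rcases hv with hv | ⟨g, hg, e2⟩
      · exact Or.inl (hI.block u w hv e el w' hw' el')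
      · exact absurd e2 (hn g hg)
  · intro u e
    exact hI.st u ((m3 u).1 e).1

/-- The failed root keeps its child in `par₀`. The only new obligation is `block` at this root, and
that is exactly the absence of merger arcs. The label is nonzero, so no WT₁ branch becomes visited.
-/
theorem MergeChain.stageInv_fail (hI : StageInv E par₀ label stage visited) (hs : stage ≠ ⊤)
    (h : MergeChain E par₀ label stage visited (f :: rest) par)
    (h0 : label (.inr f.root) ≠ 0)
    (hno : ∀ u w, ¬ State.MergerArc E ⟨par, label, stage, visited, f :: rest⟩ u w) :
    StageInv E par₀ label stage (insert f.root visited) := by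
  refine ⟨hI.edge, hI.inj, hI.feas, hI.mono, ?_, ?_, ?_, ?_, hI.st⟩
  · intro u w hv
    exact hI.eq u w fun h => hv (by simp [h])
  · intro w hw
    refine ⟨(hI.wt w hw).1, ?_⟩
    rintro (rfl | h)
    · exact h0 (hI.wt _ hw).1
    · exact (hI.wt w hw).2 h
  · intro w e hv
    exact hI.wt' w e fun h => hv (by simp [h])
  · rintro u w (rfl | hv) e el w' hw' el'
    · by_contra hc
      refine hno u w' ⟨(h.par_eq_root_iff hI hs u).2 e, hw', fun h => hc (by simp [h]), el'⟩
    · exact Or.inr (hI.block u w hv e el w' hw' el')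

/-- The roots of the path are distinct, so marking the abandoned root as visited does not invalidate
the mergers below it. -/
theorem MergeChain.tail_fail (hI : StageInv E par₀ label stage visited) (hs : stage ≠ ⊤)
    (h : MergeChain E par₀ label stage visited (f :: rest) par) :
    MergeChain E par₀ label stage (insert f.root visited) rest
      (Function.update par f.node f.old) := by
  have p4 := (h.par_eq hI hs).2.2.2
  cases h with
  | @cons _ _ par hc ho he hv hl h0 h1 =>
    rw [ho]
    have : Function.update (Function.update par f.node (some f.root)) f.node (par f.node) = par := by
      simp
    rw [this]
    clear ho he hv hl h0 h1 this
    simp only [List.map_cons, List.nodup_cons] at p4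
    replace p4 := p4.1
    induction hc with
    | nil => exact .nil
    | @cons g rest par hc ho he hv hl h0 h1 ih =>
      simp only [List.map_cons, List.mem_cons, not_or] at p4
      refine .cons (ih p4.2) ho he ?_ hl h0 h1
      rintro (h | h)
      · exact p4.1 h.symm
      · exact hv h

end MergeChain

/-! ## The size of the matching -/

section MatchingNumber

variable {n₁ n₂ : ℕ} {E : Finset (Fin n₁ × Fin n₂)} {par : Parents n₁ n₂}

theorem card_le_matchingNumber {M : Finset (Fin n₁ × Fin n₂)} (hE : M ⊆ E) (hM : IsMatching M) :
    M.card ≤ matchingNumber E := by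
  classical
  refine Finset.le_sup (f := Finset.card) (s := E.powerset.filter IsMatching) ?_
  simp [hE, hM]

theorem matchingNumber_le {b : ℕ} (h : ∀ M ⊆ E, IsMatching M → M.card ≤ b) :
    matchingNumber E ≤ b := by
  classical
  refine Finset.sup_le fun M hM => ?_
  simp only [Finset.mem_filter, Finset.mem_powerset] at hM
  exact h M hM.1 hM.2

theorem matchingNumber_le_left : matchingNumber E ≤ n₁ := by
  refine matchingNumber_le fun M _ hM => ?_
  simpa using Finset.card_le_card_of_injOn Prod.fst (t := Finset.univ) (by simp) hM.1

theorem mem_treeEdges {e : Fin n₁ × Fin n₂} : e ∈ treeEdges par ↔ par e.1 = some e.2 := by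
  simp [treeEdges]

theorem isMatching_treeEdges (hinj : ∀ u u' w, par u = some w → par u' = some w → u = u') :
    IsMatching (treeEdges par) := by
  constructor
  · rintro ⟨u, w⟩ h ⟨u', w'⟩ h' (rfl : u = u')
    simp only [Finset.mem_coe, mem_treeEdges] at h h'
    rw [h] at h'
    simpa using h'
  · rintro ⟨u, w⟩ h ⟨u', w'⟩ h' (rfl : w = w')
    simp only [Finset.mem_coe, mem_treeEdges] at h h'
    rw [hinj u u' w h h']

theorem treeEdges_subset (h : ∀ u w, par u = some w → (u, w) ∈ E) : treeEdges par ⊆ E :=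
  fun _ he => h _ _ (mem_treeEdges.1 he)

theorem card_treeEdges_le (hedge : ∀ u w, par u = some w → (u, w) ∈ E)
    (hinj : ∀ u u' w, par u = some w → par u' = some w → u = u') :
    (treeEdges par).card ≤ matchingNumber E :=
  card_le_matchingNumber (treeEdges_subset hedge) (isMatching_treeEdges hinj)

theorem card_image_fst_treeEdges :
    (Finset.univ.filter fun u => par u ≠ none).card = (treeEdges par).card := by
  symm
  refine Finset.card_bij (fun e _ => e.1) ?_ ?_ ?_
  · intro e he
    simp [mem_treeEdges.1 he]
  · rintro ⟨u, w⟩ h ⟨u', w'⟩ h' (rfl : u = u')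
    rw [mem_treeEdges] at h h'
    simp only at h h'
    rw [h] at h'
    simpa using h'
  · intro u hu
    simp only [ne_eq, Finset.mem_filter, Finset.mem_univ, true_and] at hu
    obtain ⟨w, hw⟩ := Option.ne_none_iff_exists'.1 hu
    exact ⟨(u, w), mem_treeEdges.2 hw, rfl⟩

open Classical in
theorem card_image_snd_treeEdges
    (hinj : ∀ u u' w, par u = some w → par u' = some w → u = u') :
    (Finset.univ.filter fun w => ¬ IsWT1 par w).card = (treeEdges par).card := by
  symm
  refine Finset.card_bij (fun e _ => e.2) ?_ ?_ ?_
  · intro e he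
    simp only [Finset.mem_filter, Finset.mem_univ, true_and, IsWT1, not_forall, not_not]
    exact ⟨_, mem_treeEdges.1 he⟩
  · rintro ⟨u, w⟩ h ⟨u', w'⟩ h' (rfl : w = w')
    rw [mem_treeEdges] at h h'
    rw [hinj u u' w h h']
  · intro w hw
    simp only [IsWT1, not_forall, not_not, Finset.mem_filter, Finset.mem_univ, true_and] at hw
    obtain ⟨u, hu⟩ := hw
    exact ⟨(u, w), mem_treeEdges.2 hu, rfl⟩

/-- A vertex cover that is given by conditions on the labels bounds every matching. -/
theorem matchingNumber_le_of_label_cover {label : Fin n₁ ⊕ Fin n₂ → ℕ∞} (P Q : ℕ∞ → Prop)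
    [DecidablePred P] [DecidablePred Q]
    (h : ∀ u w, (u, w) ∈ E →
      (par u ≠ none ∧ P (label (.inl u))) ∨ (¬ IsWT1 par w ∧ Q (label (.inr w)))) :
    matchingNumber E ≤ ((treeEdges par).filter fun e => P (label (.inl e.1))).card +
      ((treeEdges par).filter fun e => Q (label (.inr e.2))).card := by
  classical
  refine matchingNumber_le fun M hME hM => ?_
  have h1 : (M.filter fun e => par e.1 ≠ none ∧ P (label (.inl e.1))).card ≤
      ((treeEdges par).filter fun e => P (label (.inl e.1))).card := by
    -- An edge covered at its V₁-end is charged to the tree edge at that node; the default `e.2`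
    -- never occurs because the node has a parent.
    refine Finset.card_le_card_of_injOn (fun e => (e.1, (par e.1).getD e.2)) ?_ ?_
    · intro e he
      simp only [ne_eq, Finset.coe_filter, Set.mem_ofPred_eq] at he
      obtain ⟨w, hw⟩ := Option.ne_none_iff_exists'.1 he.2.1
      simp [mem_treeEdges, hw, he.2.2]
    · intro e he e' he' hee
      simp only [Finset.coe_filter, Set.mem_ofPred_eq] at he he'
      exact hM.1 he.1 he'.1 (Prod.ext_iff.1 hee).1
  have h2 : (M.filter fun e => ¬ (par e.1 ≠ none ∧ P (label (.inl e.1)))).card ≤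
      ((treeEdges par).filter fun e => Q (label (.inr e.2))).card := by
    have hex : ∀ e ∈ M.filter fun e => ¬ (par e.1 ≠ none ∧ P (label (.inl e.1))),
        ∃ u, par u = some e.2 ∧ Q (label (.inr e.2)) := by
      intro e he
      rw [Finset.mem_filter] at he
      rcases h e.1 e.2 (hME he.1) with h' | ⟨h', hq⟩
      · exact absurd h' he.2
      · simp only [IsWT1, not_forall, not_not] at h'
        exact ⟨h'.choose, h'.choose_spec, hq⟩
    rcases M.eq_empty_or_nonempty with rfl | ⟨e₀, -⟩
    · simp
    have : Nonempty (Fin n₁) := ⟨e₀.1⟩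
    choose! c hc using hex
    refine Finset.card_le_card_of_injOn (fun e => (c e, e.2)) ?_ ?_
    · intro e he
      simpa [mem_treeEdges] using hc e he
    · intro e he e' he' hee
      simp only [Finset.coe_filter, Set.mem_ofPred_eq] at he he'
      exact hM.2 he.1 he'.1 (Prod.ext_iff.1 hee).2
  rw [← Finset.card_filter_add_card_filter_not
    (s := M) fun e => par e.1 ≠ none ∧ P (label (.inl e.1))]
  exact Nat.add_le_add h1 h2

variable (hedge : ∀ u w, par u = some w → (u, w) ∈ E)
  (hinj : ∀ u u' w, par u = some w → par u' = some w → u = u')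

include hedge hinj

/-- König duality: the V₁-nodes of finite label and the V₂-nodes of infinite label form a cover by
matched nodes. Both ends of a tree edge have the same label, so each tree edge contributes exactly
one node. -/
theorem card_treeEdges_eq_of_stage_eq_top (h : (State.layered E par).stage = ⊤) :
    (treeEdges par).card = matchingNumber E := by
  have hI := stageInv_layered hedge hinj
  refine le_antisymm (card_treeEdges_le hedge hinj) ?_
  refine (matchingNumber_le_of_label_cover (par := par) (label := (State.layered E par).label)
    (fun x => x ≠ ⊤) (fun x => ¬ x ≠ ⊤) ?_).trans_eq ?_
  · intro u w huw
    by_cases hu : (State.layered E par).label (.inl u) = ⊤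
    · right
      have hw := hI.feas u w huw
      rw [hu, top_le_iff] at hw
      have hw' : (State.layered E par).label (.inr w) = ⊤ := by
        by_contra hc
        obtain ⟨m, hm⟩ := ENat.ne_top_iff_exists.1 hc
        rw [← hm] at hw
        exact absurd hw (by norm_cast)
      refine ⟨fun hwt => ?_, by simp [hw']⟩
      rw [(hI.wt w hwt).1] at hw'
      simp at hw'
    · refine Or.inl ⟨fun e => hu ?_, hu⟩
      have := hI.st u e
      rwa [h, top_le_iff] at this
  · rw [← Finset.card_filter_add_card_filter_not (s := treeEdges par)
      fun e => (State.layered E par).label (.inl e.1) ≠ ⊤]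
    congr 2
    refine Finset.filter_congr fun e he => ?_
    rw [← hI.eq e.1 e.2 (by simp [State.layered]) (mem_treeEdges.1 he)]

/-- Cutting at label `p` gives a cover: an edge out of a V₁-node of label above `p` ends at a node
of label at least `p`, which is matched because `p ≥ 1`. The two ends of a tree edge have equal
labels, so only the edges of layer `p` are counted twice. -/
theorem matchingNumber_le_add_layer {p : ℕ} (hp : 1 ≤ p)
    (h : (p : ℕ∞) < (State.layered E par).stage) :
    matchingNumber E ≤ (treeEdges par).card +
      ((treeEdges par).filter fun e => (State.layered E par).label (.inr e.2) = p).card := by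
  have hI := stageInv_layered hedge hinj
  refine (matchingNumber_le_of_label_cover (par := par) (label := (State.layered E par).label)
    (fun x => x ≤ p) (fun x => p ≤ x) ?_).trans_eq ?_
  · intro u w huw
    by_cases hu : (State.layered E par).label (.inl u) ≤ p
    · exact Or.inl ⟨fun e => absurd (h.trans_le ((hI.st u e).trans hu)) (lt_irrefl _), hu⟩
    · right
      have hw := hI.feas u w huw
      have hpw : (p : ℕ∞) ≤ (State.layered E par).label (.inr w) := by
        have h1 := Order.add_one_le_of_lt (not_le.1 hu)
        exact (ENat.add_le_add_iff_right (by simp)).1 (h1.trans hw)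
      refine ⟨fun hwt => ?_, hpw⟩
      rw [(hI.wt w hwt).1] at hpw
      norm_cast at hpw
      omega
  · have h1 : ((treeEdges par).filter fun e => (State.layered E par).label (.inl e.1) ≤ p) =
        (treeEdges par).filter fun e => (State.layered E par).label (.inr e.2) ≤ p :=
      Finset.filter_congr fun e he => by
        rw [hI.eq e.1 e.2 (by simp [State.layered]) (mem_treeEdges.1 he)]
    rw [h1, ← Finset.card_union_add_card_inter, ← Finset.filter_or, ← Finset.filter_and]
    congr 2
    · exact Finset.filter_true_of_mem fun e _ => le_total _ _
    · exact Finset.filter_congr fun e _ => ⟨fun h => le_antisymm h.1 h.2, fun h => ⟨h.le, h.ge⟩⟩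

/-- If the lowest label of an `ST₁` branch is large, few nodes remain to be matched. -/
theorem mul_matchingNumber_sub_le {l : ℕ} (h : (l : ℕ∞) < (State.layered E par).stage) :
    l * (matchingNumber E - (treeEdges par).card) ≤ (treeEdges par).card := by
  -- Each of the `l` layers contains at least as many tree edges as pairs are missing; the layers
  -- are disjoint, so summation gives the claim.
  have h1 : ∀ p ∈ Finset.Icc 1 l, matchingNumber E - (treeEdges par).card ≤
      ((treeEdges par).filter fun e => (State.layered E par).label (.inr e.2) = p).card := by
    intro p hp
    rw [Finset.mem_Icc] at hp
    have := matchingNumber_le_add_layer hedge hinj hp.1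
      (lt_of_le_of_lt (by exact_mod_cast hp.2) h)
    omega
  have h2 := Finset.sum_le_sum h1
  rw [Finset.sum_const, Nat.card_Icc, smul_eq_mul, Nat.add_sub_cancel] at h2
  refine h2.trans ?_
  rw [← Finset.card_biUnion]
  · exact Finset.card_le_card (by
      intro e he
      simp only [Finset.mem_biUnion, Finset.mem_filter] at he
      obtain ⟨_, _, he, _⟩ := he
      exact he)
  · intro p _ p' _ hpp
    simp only [Function.onFun]
    rw [Finset.disjoint_left]
    intro e he he'
    simp only [Finset.mem_filter] at he he'
    exact hpp (by exact_mod_cast he.2.symm.trans he'.2)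

end MatchingNumber

/-- A bound on the number of stages that are still to come when `k` of `κ` pairs are matched and
the lowest label of an `ST₁` branch is `l`. -/
def stagesLeft (κ l k : ℕ) : ℕ :=
  (κ.sqrt + 2 - l) + min (κ - k) (κ.sqrt + 1)

/-- Up to label √κ + 1 the first summand pays for the stage. Beyond it, the product hypothesis
forces κ - k ≤ √κ, so the minimum is κ - k and falls with every new pair. -/
theorem stagesLeft_lt {κ l k l' k' : ℕ} (hl : l < l') (hk : k < k') (hκ : k' ≤ κ)
    (h : (l - 1) * (κ - k) ≤ k) : stagesLeft κ l' k' + 1 ≤ stagesLeft κ l k := by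
  unfold stagesLeft
  rcases Nat.lt_or_ge l (κ.sqrt + 2) with h1 | h1
  · omega
  · have h2 : (κ.sqrt + 1) * (κ - k) ≤ κ :=
      (Nat.mul_le_mul_right _ (by omega)).trans (h.trans (by omega))
    have h3 := Nat.lt_succ_sqrt κ
    have h4 : κ - k ≤ κ.sqrt := by
      by_contra hc
      have := Nat.mul_le_mul_left (κ.sqrt + 1) (show κ.sqrt + 1 ≤ κ - k by omega)
      simp only [Nat.succ_eq_add_one] at h3
      omega
    omega

/-! ## Weakest preconditions -/

infixl:65 " +ₑ " => Expr.bin BinOp.add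
infixl:65 " -ₑ " => Expr.bin BinOp.sub
infixl:70 " *ₑ " => Expr.bin BinOp.mul
infixl:70 " /ₑ " => Expr.bin BinOp.div
infix:50 " <ₑ " => Expr.bin BinOp.lt
infix:50 " =ₑ " => Expr.bin BinOp.eq
prefix:max "ʀ" => Expr.reg
prefix:max "ᴄ" => Expr.const
infixr:30 " ;; " => Cmd.seq

/-! ### Updates of the memory -/

section Store

variable {lam : ℕ}

def Store.setReg (s : Store lam) (x v : ℕ) : Store lam :=
  { s with reg := Function.update s.reg x v }

def Store.setArr (s : Store lam) (a i j v : ℕ) : Store lam :=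
  { s with arr := fun a' i' j' => if a' = a ∧ i' = i ∧ j' = j then v else s.arr a' i' j' }

def Store.setWrd (s : Store lam) (a i j : ℕ) (v : Word lam) : Store lam :=
  { s with wrd := fun a' i' j' => if a' = a ∧ i' = i ∧ j' = j then v else s.wrd a' i' j' }

/-- Overwrite the bit `k`, counted from `1`, of a long word. -/
def Store.setBit (s : Store lam) (a i k : ℕ) (v : Bool) : Store lam :=
  s.setWrd a i ((k - 1) / lam) ((s.wrd a i ((k - 1) / lam)).set ((k - 1) % lam) v)

def Store.addLog (s : Store lam) (o : Op ℕ ℕ) : Store lam :=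
  { s with log := s.log ++ [o] }

/-- The bit `k`, counted from `1`, of a long word. -/
def Store.bit (s : Store lam) (a i k : ℕ) : Bool :=
  (s.wrd a i ((k - 1) / lam)).get ((k - 1) % lam)

variable (s : Store lam) (a a' i i' j j' k k' x y v : ℕ) (b : Bool) (W : Word lam) (o : Op ℕ ℕ)

@[simp] theorem reg_setReg : (s.setReg x v).reg y = if y = x then v else s.reg y := by
  simp [Store.setReg, Function.update_apply]
@[simp] theorem arr_setReg : (s.setReg x v).arr = s.arr := rfl
@[simp] theorem wrd_setReg : (s.setReg x v).wrd = s.wrd := rfl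
@[simp] theorem log_setReg : (s.setReg x v).log = s.log := rfl
@[simp] theorem bit_setReg : (s.setReg x v).bit = s.bit := rfl

@[simp] theorem reg_setArr : (s.setArr a i j v).reg = s.reg := rfl
theorem arr_setArr : (s.setArr a i j v).arr a' i' j' =
    if a' = a ∧ i' = i ∧ j' = j then v else s.arr a' i' j' := rfl
@[simp] theorem arr_setArr_self : (s.setArr a i j v).arr a i' j' =
    if i' = i ∧ j' = j then v else s.arr a i' j' := by simp [arr_setArr]
@[simp] theorem arr_setArr_ne {a a' : ℕ} (h : a' ≠ a) :
    (s.setArr a i j v).arr a' = s.arr a' := by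
  funext i' j'; simp [arr_setArr, h]
@[simp] theorem wrd_setArr : (s.setArr a i j v).wrd = s.wrd := rfl
@[simp] theorem log_setArr : (s.setArr a i j v).log = s.log := rfl
@[simp] theorem bit_setArr : (s.setArr a i j v).bit = s.bit := rfl

@[simp] theorem reg_setWrd : (s.setWrd a i j W).reg = s.reg := rfl
@[simp] theorem wrd_setWrd_ne {a a' : ℕ} (h : a' ≠ a) :
    (s.setWrd a i j W).wrd a' = s.wrd a' := by
  funext i' j'; simp [Store.setWrd, h]

@[simp] theorem reg_setBit : (s.setBit a i k b).reg = s.reg := rfl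
@[simp] theorem arr_setBit : (s.setBit a i k b).arr = s.arr := rfl
@[simp] theorem wrd_setBit_ne {a a' : ℕ} (h : a' ≠ a) :
    (s.setBit a i k b).wrd a' = s.wrd a' := wrd_setWrd_ne _ _ _ _ h
@[simp] theorem log_setBit : (s.setBit a i k b).log = s.log := rfl

@[simp] theorem reg_addLog : (s.addLog o).reg = s.reg := rfl
@[simp] theorem arr_addLog : (s.addLog o).arr = s.arr := rfl
@[simp] theorem wrd_addLog : (s.addLog o).wrd = s.wrd := rfl
@[simp] theorem bit_addLog : (s.addLog o).bit = s.bit := rfl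
@[simp] theorem log_addLog : (s.addLog o).log = s.log ++ [o] := rfl

theorem bit_setWrd : (s.setWrd a i j W).bit a' i' k =
    if a' = a ∧ i' = i ∧ (k - 1) / lam = j then W.get ((k - 1) % lam) else s.bit a' i' k := by
  simp only [Store.bit, Store.setWrd]
  split_ifs <;> rfl

/-- Distinct positive positions differ in the quotient or in the remainder of the shifted position
modulo `lam`, so a long word behaves like one array of bits counted from `1`. -/
theorem bit_setBit (hlam : 0 < lam) (hk : 1 ≤ k) (hk' : 1 ≤ k') :
    (s.setBit a i k b).bit a' i' k' =
      if a' = a ∧ i' = i ∧ k' = k then b else s.bit a' i' k' := by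
  rw [Store.setBit, bit_setWrd]
  have hm : (k' - 1) % lam < lam := Nat.mod_lt _ hlam
  by_cases h : a' = a ∧ i' = i ∧ (k' - 1) / lam = (k - 1) / lam
  · rw [if_pos h]
    obtain ⟨rfl, rfl, h⟩ := h
    simp only [Word.get, Word.set, hm, dite_true]
    by_cases hkk : k' = k
    · simp [hkk]
    · have hne : (k' - 1) % lam ≠ (k - 1) % lam := by
        intro e
        have e1 := Nat.div_add_mod (k' - 1) lam
        have e2 := Nat.div_add_mod (k - 1) lam
        rw [h, e, e2] at e1
        omega
      simp [hkk, hne, Store.bit, Word.get, hm, h]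
  · rw [if_neg h, if_neg]
    rintro ⟨h1, h2, rfl⟩
    exact h ⟨h1, h2, rfl⟩

theorem bit_congr {s s' : Store lam} {a : ℕ} (h : s'.wrd a = s.wrd a) (i k : ℕ) :
    s'.bit a i k = s.bit a i k := by
  rw [Store.bit, h]; rfl

@[simp] theorem bit_setBit_ne {a a' : ℕ} (h : a' ≠ a) :
    (s.setBit a i k b).bit a' = s.bit a' := by
  funext i' k'
  exact bit_congr (wrd_setBit_ne s i k b h) i' k'

/-- The stores agree outside of some registers and arrays. -/
structure Store.Same (R A B : List ℕ) (s s' : Store lam) : Prop where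
  reg : ∀ r, r ∉ R → s'.reg r = s.reg r
  arr : ∀ a, a ∉ A → s'.arr a = s.arr a
  wrd : ∀ a, a ∉ B → s'.wrd a = s.wrd a
  log : s'.log = s.log

theorem Store.Same.refl (R A B : List ℕ) (s : Store lam) : s.Same R A B s :=
  ⟨fun _ _ => rfl, fun _ _ => rfl, fun _ _ => rfl, rfl⟩

theorem Store.Same.mono {R A B R' A' B' : List ℕ} {s s' : Store lam} (h : s.Same R A B s')
    (hR : R ⊆ R') (hA : A ⊆ A') (hB : B ⊆ B') : s.Same R' A' B' s' :=
  ⟨fun r hr => h.reg r fun e => hr (hR e), fun r hr => h.arr r fun e => hr (hA e),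
    fun r hr => h.wrd r fun e => hr (hB e), h.log⟩

theorem Store.Same.trans {R A B : List ℕ} {s s' s'' : Store lam} (h : s.Same R A B s')
    (h' : s'.Same R A B s'') : s.Same R A B s'' :=
  ⟨fun r hr => (h'.reg r hr).trans (h.reg r hr), fun r hr => (h'.arr r hr).trans (h.arr r hr),
    fun r hr => (h'.wrd r hr).trans (h.wrd r hr), h'.log.trans h.log⟩

theorem Store.Same.setReg {R A B : List ℕ} {s : Store lam} {x v : ℕ} (hx : x ∈ R) :
    s.Same R A B (s.setReg x v) :=
  ⟨fun r hr => by rw [reg_setReg, if_neg (by rintro rfl; exact hr hx)], fun _ _ => rfl,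
    fun _ _ => rfl, rfl⟩

theorem Store.Same.setBit {R A B : List ℕ} {s : Store lam} {a i k : ℕ} {b : Bool} (ha : a ∈ B) :
    s.Same R A B (s.setBit a i k b) :=
  ⟨fun _ _ => rfl, fun _ _ => rfl,
    fun c hc => wrd_setBit_ne _ _ _ _ (by rintro rfl; exact hc ha), rfl⟩

end Store

/-- `1` if `p` holds and `0` otherwise. -/
noncomputable def indic (p : Prop) : ℕ := open Classical in if p then 1 else 0

@[simp] theorem indic_eq_zero {p : Prop} : indic p = 0 ↔ ¬ p := by
  unfold indic; split_ifs with h <;> simp [h]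

/-- The value of an expression, without decidability instances. -/
noncomputable def Expr.ev {lam : ℕ} (s : Store lam) : Expr → ℕ
  | .const c => c
  | .reg x => s.reg x
  | .read a i j => s.arr a (i.ev s) (j.ev s)
  | .bin .add e₁ e₂ => e₁.ev s + e₂.ev s
  | .bin .sub e₁ e₂ => e₁.ev s - e₂.ev s
  | .bin .mul e₁ e₂ => e₁.ev s * e₂.ev s
  | .bin .div e₁ e₂ => e₁.ev s / e₂.ev s
  | .bin .mod e₁ e₂ => e₁.ev s % e₂.ev s
  | .bin .lt e₁ e₂ => indic (e₁.ev s < e₂.ev s)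
  | .bin .eq e₁ e₂ => indic (e₁.ev s = e₂.ev s)

theorem Expr.ev_eq {lam : ℕ} (s : Store lam) : ∀ e : Expr, e.ev s = e.eval s
  | .const _ => rfl
  | .reg _ => rfl
  | .read _ i j => by rw [Expr.ev, Expr.eval, Expr.ev_eq s i, Expr.ev_eq s j]
  | .bin o e₁ e₂ => by
    cases o <;> simp only [Expr.ev, Expr.eval, Expr.ev_eq s e₁, Expr.ev_eq s e₂, BinOp.eval, indic]

/-- `wp` for loops. -/
def wpLoop {lam : ℕ} (N : ℕ) (e : Expr) (c : Cmd) (Q : Store lam → ℕ → Prop) (s : Store lam)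
    (T : ℕ) : Prop :=
  ∃ s' t, Exec N (.loop e c) s s' t ∧ Q s' (T + t)

/-- The condition on a memory and a time from which `c` halts with a memory and a time that
satisfy `Q`. -/
def wp {lam : ℕ} (N : ℕ) : Cmd → (Store lam → ℕ → Prop) → Store lam → ℕ → Prop
  | .skip, Q, s, T => Q s (T + 1)
  | .assign x e, Q, s, T => e.ev s ≤ N ∧ Q (s.setReg x (e.ev s)) (T + 1)
  | .write a i j e, Q, s, T =>
      e.ev s ≤ N ∧ Q (s.setArr a (i.ev s) (j.ev s) (e.ev s)) (T + 1)
  | .wwrite a i j e, Q, s, T => Q (s.setWrd a (i.ev s) (j.ev s) (e.eval s)) (T + 1)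
  | .lead x e, Q, s, T => (e.eval s).lead ≤ N ∧ Q (s.setReg x (e.eval s).lead) (T + 1)
  | .getBit x a i k, Q, s, T => 1 ≤ k.ev s ∧ 1 ≤ N ∧
      Q (s.setReg x (indic (s.bit a (i.ev s) (k.ev s) = true))) (T + 1)
  | .setBit a i k v, Q, s, T =>
      1 ≤ k.ev s ∧ Q (s.setBit a (i.ev s) (k.ev s) v) (T + 1)
  | .emit o, Q, s, T => Q (s.addLog (o.map (fun e => e.ev s) (fun e => e.ev s))) (T + 1)
  | .seq c₁ c₂, Q, s, T => wp N c₁ (wp N c₂ Q) s T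
  | .ite e c₁ c₂, Q, s, T =>
      (e.ev s ≠ 0 → wp N c₁ Q s (T + 1)) ∧ (e.ev s = 0 → wp N c₂ Q s (T + 1))
  | .loop e c, Q, s, T => wpLoop N e c Q s T

section wp

variable {lam N : ℕ}

/-- The clock `T` is absolute and passed through the commands, which lets loop invariants state
amortized time bounds. Loops need no argument here, since `wpLoop` is defined by the existence of an
execution. -/
theorem exists_exec_of_wp : ∀ (c : Cmd) (Q : Store lam → ℕ → Prop) (s : Store lam) (T : ℕ),
    wp N c Q s T → ∃ s' t, Exec N c s s' t ∧ Q s' (T + t)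
  | .skip, _, _, _, h => ⟨_, _, .skip, h⟩
  | .assign _ _, _, _, _, h => by
      simp only [wp, Expr.ev_eq] at h
      exact ⟨_, _, .assign h.1, h.2⟩
  | .write _ _ _ _, _, _, _, h => by
      simp only [wp, Expr.ev_eq] at h
      exact ⟨_, _, .write h.1, h.2⟩
  | .wwrite _ _ _ _, _, _, _, h => by
      simp only [wp, Expr.ev_eq] at h
      exact ⟨_, _, .wwrite, h⟩
  | .lead _ _, _, _, _, h => ⟨_, _, .lead h.1, h.2⟩
  | .getBit x a i k, Q, s, T, h => by
      simp only [wp, Expr.ev_eq] at h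
      refine ⟨_, _, .getBit (p := k.eval s - 1) (by have := h.1; omega) h.2.1, ?_⟩
      convert h.2.2 using 1
      simp only [Store.setReg, Store.bit, indic]
      congr
  | .setBit a i k v, Q, s, T, h => by
      simp only [wp, Expr.ev_eq] at h
      refine ⟨_, _, .setBit (p := k.eval s - 1) (by have := h.1; omega), ?_⟩
      convert h.2 using 1
      simp only [Store.setBit, Store.setWrd, Store.mk.injEq, true_and, and_true]
      funext a' i' j'
      by_cases hc : a' = a ∧ i' = i.eval s ∧ j' = (k.eval s - 1) / lam
      · obtain ⟨rfl, rfl, rfl⟩ := hc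
        simp
      · simp [hc]
  | .emit _, _, _, _, h => by
      simp only [wp, Expr.ev_eq] at h
      exact ⟨_, _, .emit, h⟩
  | .seq c₁ c₂, Q, s, T, h => by
      obtain ⟨s', t, h1, h2⟩ := exists_exec_of_wp c₁ _ s T h
      obtain ⟨s'', t', h3, h4⟩ := exists_exec_of_wp c₂ _ s' _ h2
      exact ⟨s'', _, .seq h1 h3, by rwa [← add_assoc]⟩
  | .ite e c₁ c₂, Q, s, T, h => by
      simp only [wp, Expr.ev_eq] at h
      by_cases he : e.eval s = 0
      · obtain ⟨s', t, h1, h2⟩ := exists_exec_of_wp c₂ _ s _ (h.2 he)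
        exact ⟨s', _, .iteFalse he h1, by rwa [add_comm t, ← add_assoc]⟩
      · obtain ⟨s', t, h1, h2⟩ := exists_exec_of_wp c₁ _ s _ (h.1 he)
        exact ⟨s', _, .iteTrue he h1, by rwa [add_comm t, ← add_assoc]⟩
  | .loop _ _, _, _, _, h => h

/-- The rule for loops. An upper bound on the time that the invariant implies yields termination. -/
theorem wp_loop {e : Expr} {c : Cmd} {Q : Store lam → ℕ → Prop} {s : Store lam} {T : ℕ}
    (I : Store lam → ℕ → Prop) (M : ℕ) (h0 : I s T) (hM : ∀ s T, I s T → T ≤ M)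
    (hstep : ∀ s T, I s T → e.ev s ≠ 0 → wp N c I s (T + 1))
    (hexit : ∀ s T, I s T → e.ev s = 0 → Q s (T + 1)) : wpLoop N e c Q s T := by
  -- The test of the loop alone takes a step, so the remaining time `M - T` falls with every
  -- iteration and no separate variant is needed.
  induction hm : M - T using Nat.strong_induction_on generalizing s T with
  | _ m ih =>
    by_cases he : e.ev s = 0
    · exact ⟨s, 1, .loopStop (by rwa [← Expr.ev_eq]), hexit s T h0 he⟩
    · obtain ⟨s', t, h1, h2⟩ := exists_exec_of_wp c _ s _ (hstep s T h0 he)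
      have h3 := hM _ _ h0
      have h4 := hM _ _ h2
      obtain ⟨s'', t', h5, h6⟩ := ih (M - (T + 1 + t)) (by omega) h2 rfl
      exact ⟨s'', t + t' + 1, .loopStep (by rwa [← Expr.ev_eq]) h1 h5, by
        rwa [show T + (t + t' + 1) = T + 1 + t + t' by omega]⟩

end wp

/-! ## Searching in words and in lists -/

section Lead

variable {lam : ℕ} (W : Word lam)

theorem Word.lead_spec : (W.lead = 0 ∧ ∀ b, W b = false) ∨
    ∃ b : Fin lam, W.lead = b.val + 1 ∧ W b = true := by
  classical
  unfold Word.lead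
  split_ifs with h
  · obtain ⟨b, hb, e⟩ := Nat.find_spec h
    exact Or.inr ⟨b, e, hb⟩
  · refine Or.inl ⟨rfl, fun b => ?_⟩
    push Not at h
    by_contra hb
    exact h (b.val + 1) b (by simpa using hb) rfl

end Lead

/-- Register `7` becomes the number of a bit that is set in row `[9]` of the word array `a` and in
row `[10]` of `a'`, as far as the first `[11]` words of the rows are concerned; `0` if there is
none. -/
def scan (a a' : ℕ) : Cmd :=
  .assign 8 (ᴄ 0) ;; .assign 7 (ᴄ 0) ;;
  .loop ((ʀ 7 =ₑ ᴄ 0) *ₑ (ʀ 8 <ₑ ʀ 11))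
    (.lead 7 (.and (.read a (ʀ 9) (ʀ 8)) (.read a' (ʀ 10) (ʀ 8))) ;;
     .ite (ʀ 7) (.assign 7 (ʀ 8 *ₑ ʀ 2 +ₑ ʀ 7)) (.assign 8 (ʀ 8 +ₑ ᴄ 1)))

/-- In row `[6]` of the lists `l`, the position `p` is advanced to the first node that is unmarked
in `d`; register `7` becomes this node, or `0` if there is none. -/
def advance (l p d : ℕ) : Cmd :=
  .loop (.read l (ʀ 6) (.read p (ʀ 6) (ᴄ 0)) *ₑ
      .read d (.read l (ʀ 6) (.read p (ʀ 6) (ᴄ 0))) (ᴄ 0))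
    (.write p (ʀ 6) (ᴄ 0) (.read p (ʀ 6) (ᴄ 0) +ₑ ᴄ 1)) ;;
  .assign 7 (.read l (ʀ 6) (.read p (ʀ 6) (ᴄ 0)))

section Specs

variable {lam N : ℕ}

/-- A word costs four steps: the loop test, `lead`, the branching and the assignment. Failure
excludes all bits of the first `[11]` words, so callers must choose `[11]` large enough to reach
every number of interest. -/
theorem wp_scan (hlam : 0 < lam) {a a' : ℕ} {s : Store lam} {T : ℕ} (h2 : s.reg 2 = lam)
    (hN : s.reg 11 * lam ≤ N) {Q : Store lam → ℕ → Prop}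
    (hQ : ∀ s' T', s.Same [7, 8] [] [] s' → T' ≤ T + 4 * s.reg 11 + 8 →
      ((s'.reg 7 = 0 ∧ ∀ k, 1 ≤ k → (k - 1) / lam < s.reg 11 →
          ¬ (s.bit a (s.reg 9) k = true ∧ s.bit a' (s.reg 10) k = true)) ∨
        (1 ≤ s'.reg 7 ∧ s.bit a (s.reg 9) (s'.reg 7) = true ∧
          s.bit a' (s.reg 10) (s'.reg 7) = true)) → Q s' T') :
    wp N (scan a a') Q s T := by
  have hle : s.reg 11 ≤ N := (Nat.le_mul_of_pos_right _ hlam).trans hN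
  simp only [scan, wp, Expr.ev]
  refine ⟨Nat.zero_le _, Nat.zero_le _, ?_⟩
  apply wp_loop (I := fun s' T' => s.Same [7, 8] [] [] s' ∧ s'.reg 8 ≤ s.reg 11 ∧
      ((s'.reg 7 = 0 ∧ T' ≤ T + 4 * s'.reg 8 + 2 ∧ ∀ k, 1 ≤ k → (k - 1) / lam < s'.reg 8 →
          ¬ (s.bit a (s.reg 9) k = true ∧ s.bit a' (s.reg 10) k = true)) ∨
        (T' ≤ T + 4 * s'.reg 8 + 6 ∧ 1 ≤ s'.reg 7 ∧ s.bit a (s.reg 9) (s'.reg 7) = true ∧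
          s.bit a' (s.reg 10) (s'.reg 7) = true))) (M := T + 4 * s.reg 11 + 6)
  · refine ⟨⟨?_, fun _ _ => rfl, fun _ _ => rfl, rfl⟩, by simp, Or.inl ⟨by simp, ?_, by simp⟩⟩
    · intro r hr
      simp only [List.mem_cons, List.not_mem_nil, or_false, not_or] at hr
      simp [hr]
    · simp
  · rintro s' T' ⟨-, h1, ⟨-, h2, -⟩ | ⟨h2, -⟩⟩ <;> omega
  · rintro s' T' ⟨hs, h1, h3⟩ he
    simp only [Expr.ev, ne_eq, mul_eq_zero, indic_eq_zero, not_or, not_not] at he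
    obtain ⟨he1, he2⟩ := he
    rw [hs.reg 11 (by simp)] at he2
    rcases h3 with ⟨h3, h4, h5⟩ | ⟨h4, h5, -⟩
    swap
    · omega
    simp only [wp, Expr.ev, WExpr.eval, Expr.eval]
    have hmul : s'.reg 8 * lam + lam ≤ s.reg 11 * lam := by
      rw [← Nat.succ_mul]; exact Nat.mul_le_mul_right _ he2
    have hW : ∀ c : ℕ, ∀ b : Fin lam, s'.wrd c (s'.reg 9) (s'.reg 8) b =
        s.bit c (s.reg 9) (s'.reg 8 * lam + b.val + 1) ∧
        s'.wrd c (s'.reg 10) (s'.reg 8) b = s.bit c (s.reg 10) (s'.reg 8 * lam + b.val + 1) := by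
      intro c b
      rw [hs.wrd _ (by simp), hs.reg 9 (by simp), hs.reg 10 (by simp)]
      have e1 : (s'.reg 8 * lam + b.val) / lam = s'.reg 8 := by
        rw [Nat.mul_comm, Nat.mul_add_div hlam, Nat.div_eq_of_lt b.2, add_zero]
      have e2 : (s'.reg 8 * lam + b.val) % lam = b.val := by
        rw [Nat.mul_comm, Nat.mul_add_mod, Nat.mod_eq_of_lt b.2]
      simp [Store.bit, Word.get, e1, e2]
    rcases Word.lead_spec (fun b => s'.wrd a (s'.reg 9) (s'.reg 8) b &&
        s'.wrd a' (s'.reg 10) (s'.reg 8) b) with ⟨hl, hb⟩ | ⟨b, hl, hb⟩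
    · rw [hl]
      refine ⟨Nat.zero_le _, fun h => absurd (by simp) h, fun _ => ⟨?_, ?_⟩⟩
      · simp; omega
      · refine ⟨⟨?_, hs.arr, hs.wrd, hs.log⟩, ?_, Or.inl ⟨?_, ?_, ?_⟩⟩
        · intro r hr
          have := hs.reg r hr
          simp only [List.mem_cons, List.not_mem_nil, or_false, not_or] at hr
          simp [hr, this]
        · simp; omega
        · simp
        · simp; omega
        · intro k hk hkl
          simp only [reg_setReg, Nat.reduceEqDiff, ↓reduceIte] at hkl
          rcases Nat.lt_or_ge ((k - 1) / lam) (s'.reg 8) with h | h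
          · exact h5 k hk h
          · have e : (k - 1) / lam = s'.reg 8 := by omega
            have hm := Nat.mod_lt (k - 1) hlam
            have hk2 : s'.reg 8 * lam + (k - 1) % lam + 1 = k := by
              have := Nat.div_add_mod (k - 1) lam
              rw [e, Nat.mul_comm] at this
              omega
            have := hb ⟨(k - 1) % lam, hm⟩
            rw [(hW _ _).1, (hW _ _).2] at this
            simp only [hk2, Bool.and_eq_false_iff] at this
            rintro ⟨h6, h7⟩
            rw [h6, h7] at this
            simp at this
    · rw [hl]
      have hb2 := b.2
      refine ⟨by omega, fun _ => ⟨?_, ?_⟩, fun h => absurd h (by simp)⟩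
      · simp [hs.reg 2 (by simp), h2]; omega
      · refine ⟨⟨?_, hs.arr, hs.wrd, hs.log⟩, ?_, Or.inr ⟨?_, ?_, ?_⟩⟩
        · intro r hr
          have := hs.reg r hr
          simp only [List.mem_cons, List.not_mem_nil, or_false, not_or] at hr
          simp [hr, this]
        · simp; omega
        · simp only [reg_setReg, ↓reduceIte, Nat.reduceEqDiff]; omega
        · simp only [reg_setReg, ↓reduceIte, Nat.reduceEqDiff]; omega
        · rw [(hW _ _).1, (hW _ _).2, Bool.and_eq_true] at hb
          simpa [hs.reg 2 (by simp), h2, ← add_assoc] using hb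
  · rintro s' T' ⟨hs, h1, h3⟩ he
    simp only [Expr.ev, mul_eq_zero, indic_eq_zero, not_lt] at he
    rw [hs.reg 11 (by simp)] at he
    refine hQ _ _ hs ?_ ?_
    · rcases h3 with ⟨-, h3, -⟩ | ⟨h3, -⟩ <;> omega
    · rcases h3 with ⟨h3, -, h4⟩ | ⟨-, h3⟩
      · refine Or.inl ⟨h3, fun k hk hkl => h4 k hk ?_⟩
        omega
      · exact Or.inr h3

/-- The first `p` nodes of the list are in `S`. -/
def Skipped {n : ℕ} (L : List (Fin n)) (S : Finset (Fin n)) (p : ℕ) : Prop :=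
  ∀ i < p, ∃ x ∈ S, L[i]? = some x

/-- The skipped prefix of a duplicate-free list consists of distinct elements of `S`. This keeps
pointers, and list searches, below the number of matched nodes. -/
theorem Skipped.le_card {n : ℕ} {L : List (Fin n)} {S : Finset (Fin n)} {p : ℕ}
    (h : Skipped L S p) (hL : L.Nodup) : p ≤ S.card := by
  classical
  have hp : p ≤ L.length := by
    by_contra hc
    obtain ⟨x, -, hx⟩ := h L.length (by omega)
    simp at hx
  have h1 : (L.take p).toFinset ⊆ S := by
    intro x hx
    rw [List.mem_toFinset, List.mem_take_iff_getElem] at hx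
    obtain ⟨i, hi, rfl⟩ := hx
    obtain ⟨y, hy, e⟩ := h i (by omega)
    rw [List.getElem?_eq_getElem (by omega)] at e
    simp only [Option.some.injEq] at e
    rwa [e]
  have h2 := Finset.card_le_card h1
  rw [List.toFinset_card_of_nodup (hL.sublist (List.take_sublist _ _)), List.length_take] at h2
  omega

theorem Skipped.le_length {n : ℕ} {L : List (Fin n)} {S : Finset (Fin n)} {p : ℕ}
    (h : Skipped L S p) : p ≤ L.length := by
  by_contra hc
  obtain ⟨x, -, hx⟩ := h L.length (by omega)
  simp at hx

theorem Skipped.mono {n : ℕ} {L : List (Fin n)} {S S' : Finset (Fin n)} {p : ℕ}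
    (h : Skipped L S p) (hS : S ⊆ S') : Skipped L S' p :=
  fun i hi => (h i hi).imp fun _ hx => ⟨hS hx.1, hx.2⟩

theorem entry_cases {n : ℕ} (L : List (Fin n)) (k : ℕ) :
    (entry L k = 0 ∧ L.length ≤ k) ∨ ∃ x ∈ L, entry L k = x.val + 1 ∧ L[k]? = some x := by
  rcases Nat.lt_or_ge k L.length with h | h
  · right
    refine ⟨L[k], List.getElem_mem h, ?_, List.getElem?_eq_getElem h⟩
    simp [entry, h]
  · left
    refine ⟨?_, h⟩
    simp [entry, h]

theorem Skipped.forall_mem {n : ℕ} {L : List (Fin n)} {S : Finset (Fin n)} {p : ℕ}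
    (h : Skipped L S p) (hp : L.length ≤ p) : ∀ x ∈ L, x ∈ S := by
  intro x hx
  obtain ⟨i, hi, rfl⟩ := List.mem_iff_getElem.1 hx
  obtain ⟨y, hy, e⟩ := h i (by omega)
  rw [List.getElem?_eq_getElem hi] at e
  simp only [Option.some.injEq] at e
  rwa [e]

theorem Skipped.succ {n : ℕ} {L : List (Fin n)} {S : Finset (Fin n)} {p : ℕ}
    (h : Skipped L S p) {x : Fin n} (hx : x ∈ S) (e : L[p]? = some x) : Skipped L S (p + 1) := by
  intro i hi
  rcases Nat.lt_succ_iff_lt_or_eq.1 hi with h' | rfl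
  · exact h i h'
  · exact ⟨x, hx, e⟩

/-- Apart from two final steps, the time is twice the distance that the pointer moves, so it can be
charged to the position. The end marker `0` stops the loop through the first factor of the test. -/
theorem wp_advance {n : ℕ} {L : List (Fin n)} {S : Finset (Fin n)} {l p d : ℕ} {s : Store lam}
    {T : ℕ} (hL : L.Nodup) (hlp : l ≠ p) (hdp : d ≠ p) (hl : ∀ j, s.arr l (s.reg 6) j = entry L j)
    (hd : ∀ x : Fin n, s.arr d (x.val + 1) 0 ≠ 0 ↔ x ∈ S)
    (hp : Skipped L S (s.arr p (s.reg 6) 0)) (hN : n + 1 ≤ N)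
    {Q : Store lam → ℕ → Prop}
    (hQ : ∀ s' T', s.Same [7] [p] [] s' →
      (∀ i j, ¬ (i = s.reg 6 ∧ j = 0) → s'.arr p i j = s.arr p i j) →
      Skipped L S (s'.arr p (s.reg 6) 0) → s.arr p (s.reg 6) 0 ≤ s'.arr p (s.reg 6) 0 →
      T' + 2 * s.arr p (s.reg 6) 0 ≤ T + 2 * s'.arr p (s.reg 6) 0 + 2 →
      ((s'.reg 7 = 0 ∧ ∀ x ∈ L, x ∈ S) ∨ ∃ x ∈ L, x ∉ S ∧ s'.reg 7 = x.val + 1) → Q s' T') :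
    wp N (advance l p d) Q s T := by
  simp only [advance, wp, Expr.ev]
  have hS : S.card ≤ n := by simpa using Finset.card_le_univ S
  apply wp_loop (I := fun s' T' => s.Same [] [p] [] s' ∧
      (∀ i j, ¬ (i = s.reg 6 ∧ j = 0) → s'.arr p i j = s.arr p i j) ∧
      Skipped L S (s'.arr p (s.reg 6) 0) ∧ s.arr p (s.reg 6) 0 ≤ s'.arr p (s.reg 6) 0 ∧
      T' + 2 * s.arr p (s.reg 6) 0 ≤ T + 2 * s'.arr p (s.reg 6) 0)
      (M := T + 2 * S.card)
  · exact ⟨.refl _ _ _ _, fun _ _ _ => rfl, hp, le_rfl, le_rfl⟩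
  · rintro s' T' ⟨-, -, h1, h2, h3⟩
    have := h1.le_card hL
    omega
  · rintro s' T' ⟨hs, h1, h2, h3, h4⟩ he
    simp only [Expr.ev, ne_eq, mul_eq_zero, not_or] at he
    rw [hs.reg 6 (by simp), hs.arr l (by simpa), hs.arr d (by simpa), hl] at he
    simp only [wp, Expr.ev]
    rw [hs.reg 6 (by simp)]
    rcases entry_cases L (s'.arr p (s.reg 6) 0) with ⟨h5, -⟩ | ⟨x, hx, h5, h6⟩
    · exact absurd h5 he.1
    rw [h5] at he
    have hx := h2.succ ((hd x).1 he.2) h6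
    refine ⟨?_, ⟨hs.reg, ?_, hs.wrd, hs.log⟩, ?_, ?_, ?_, ?_⟩
    · have := hx.le_card hL
      omega
    · intro a ha
      rw [arr_setArr_ne _ _ _ _ (by simpa using ha), hs.arr a ha]
    · intro i j hij
      simp [hij, h1]
    · simpa using hx
    · simp; omega
    · simp; omega
  · rintro s' T' ⟨hs, h1, h2, h3, h4⟩ he
    simp only [Expr.ev, mul_eq_zero] at he
    rw [hs.reg 6 (by simp), hs.arr l (by simpa), hs.arr d (by simpa), hl] at he
    rw [hs.reg 6 (by simp), hs.arr l (by simpa), hl]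
    have hQ' : ∀ v, ((v = 0 ∧ ∀ x ∈ L, x ∈ S) ∨ ∃ x ∈ L, x ∉ S ∧ v = x.val + 1) →
        Q (s'.setReg 7 v) (T' + 1 + 1) := by
      intro v hv
      refine hQ _ _ ⟨?_, hs.arr, hs.wrd, hs.log⟩ h1 h2 h3 ?_ (by simpa using hv)
      · intro r hr
        simp only [List.mem_singleton] at hr
        simp [hr, hs.reg]
      · simp; omega
    rcases entry_cases L (s'.arr p (s.reg 6) 0) with ⟨h5, h6⟩ | ⟨x, hx, h5, h6⟩
    · exact ⟨by omega, hQ' _ (Or.inl ⟨h5, h2.forall_mem h6⟩)⟩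
    · refine ⟨by omega, hQ' _ (Or.inr ⟨x, hx, fun hxS => ?_, h5⟩)⟩
      rw [h5] at he
      rcases he with h | h
      · omega
      · exact (hd x).2 hxS h

end Specs

/-! ## The representation of the tree in the memory -/

section Representation

variable {n₁ n₂ lam : ℕ} {E : Finset (Fin n₁ × Fin n₂)}

/-- The number of a node, and `0` for none. -/
def nodeNum {n : ℕ} (o : Option (Fin n)) : ℕ := (o.map fun w => w.val + 1).getD 0

@[simp] theorem nodeNum_none {n : ℕ} : nodeNum (none : Option (Fin n)) = 0 := rfl
@[simp] theorem nodeNum_some {n : ℕ} (w : Fin n) : nodeNum (some w) = w.val + 1 := rfl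

/-- The nodes of `V₁` that have a parent. -/
def matched₁ (par : Parents n₁ n₂) : Finset (Fin n₁) := Finset.univ.filter fun u => par u ≠ none

open Classical in
/-- The nodes of `V₂` that have a child. -/
noncomputable def matched₂ (par : Parents n₁ n₂) : Finset (Fin n₂) :=
  Finset.univ.filter fun w => ¬ IsWT1 par w

theorem mem_matched₁ {par : Parents n₁ n₂} {u : Fin n₁} : u ∈ matched₁ par ↔ par u ≠ none := by
  simp [matched₁]

theorem mem_matched₂ {par : Parents n₁ n₂} {w : Fin n₂} : w ∈ matched₂ par ↔ ¬ IsWT1 par w := by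
  simp [matched₂]

/-- The part of the input that is used. -/
structure Input (A : AdjLists E) (s : Store lam) : Prop where
  reg0 : s.reg 0 = n₁
  reg1 : s.reg 1 = n₂
  reg2 : s.reg 2 = lam
  out : ∀ (u : Fin n₁) j, s.arr 0 (u.val + 1) j = entry (A.outList u) j
  inn : ∀ (w : Fin n₂) j, s.arr 1 (w.val + 1) j = entry (A.inList w) j
  bit : ∀ (u : Fin n₁) k, 1 ≤ k →
    (s.bit 0 (u.val + 1) k = true ↔ ∃ w : Fin n₂, k = w.val + 1 ∧ (u, w) ∈ E)

/-- The tree `par`, with its `reg 3` edges: the parents are stored in array `2` and the children in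
array `7`; the nodes on the tree edges are numbered in arrays `3`, `4`, with the inverses in `5`,
`6`; the adjacency matrix of these nodes and its transpose are stored in the word arrays `2`, `3`. -/
structure TreeRep (E : Finset (Fin n₁ × Fin n₂)) (s : Store lam) (par : Parents n₁ n₂) : Prop where
  card : s.reg 3 = (treeEdges par).card
  out : ∀ u : Fin n₁, s.arr 2 (u.val + 1) 0 = nodeNum (par u)
  le₁ : ∀ u : Fin n₁, s.arr 3 (u.val + 1) 0 ≤ s.reg 3
  le₂ : ∀ w : Fin n₂, s.arr 4 (w.val + 1) 0 ≤ s.reg 3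
  ne₁ : ∀ u : Fin n₁, s.arr 3 (u.val + 1) 0 ≠ 0 ↔ par u ≠ none
  ne₂ : ∀ w : Fin n₂, s.arr 4 (w.val + 1) 0 ≠ 0 ↔ ¬ IsWT1 par w
  node₁ : ∀ u : Fin n₁, par u ≠ none → s.arr 5 (s.arr 3 (u.val + 1) 0) 0 = u.val + 1
  node₂ : ∀ w : Fin n₂, ¬ IsWT1 par w → s.arr 6 (s.arr 4 (w.val + 1) 0) 0 = w.val + 1
  idx₁ : ∀ a, 1 ≤ a → a ≤ s.reg 3 →
    ∃ u : Fin n₁, s.arr 5 a 0 = u.val + 1 ∧ s.arr 3 (u.val + 1) 0 = a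
  idx₂ : ∀ a, 1 ≤ a → a ≤ s.reg 3 →
    ∃ w : Fin n₂, s.arr 6 a 0 = w.val + 1 ∧ s.arr 4 (w.val + 1) 0 = a
  child : ∀ (u : Fin n₁) (w : Fin n₂), par u = some w → s.arr 7 (w.val + 1) 0 = u.val + 1
  bit₂ : ∀ (u : Fin n₁) (w : Fin n₂), par u ≠ none → ¬ IsWT1 par w →
    (s.bit 2 (s.arr 3 (u.val + 1) 0) (s.arr 4 (w.val + 1) 0) = true ↔ (u, w) ∈ E)
  bit₃ : ∀ (u : Fin n₁) (w : Fin n₂), par u ≠ none → ¬ IsWT1 par w →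
    (s.bit 3 (s.arr 4 (w.val + 1) 0) (s.arr 3 (u.val + 1) 0) = true ↔ (u, w) ∈ E)

/-- Arrays `8` and `9` hold positions in the lists of neighbours; the nodes before these positions
lie on tree edges. -/
structure PosRep (A : AdjLists E) (s : Store lam) (par : Parents n₁ n₂) : Prop where
  pos₁ : ∀ u : Fin n₁, Skipped (A.outList u) (matched₂ par) (s.arr 8 (u.val + 1) 0)
  pos₂ : ∀ w : Fin n₂, Skipped (A.inList w) (matched₁ par) (s.arr 9 (w.val + 1) 0)
  zero₁ : ∀ u : Fin n₁, par u = none → s.arr 8 (u.val + 1) 0 = 0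
  zero₂ : ∀ w : Fin n₂, IsWT1 par w → s.arr 9 (w.val + 1) 0 = 0

/-- The stack of mergers in arrays `12` and `13`. -/
def StackRep (s : Store lam) : List (Frame n₁ n₂) → Prop
  | [] => True
  | f :: rest => s.arr 12 (rest.length + 1) 0 = f.node.val + 1 ∧
      s.arr 13 (rest.length + 1) 0 = f.root.val + 1 ∧ StackRep s rest

theorem Input.congr {A : AdjLists E} {s s' : Store lam} (h : Input A s)
    (hr : ∀ r < 3, s'.reg r = s.reg r) (ha : ∀ a < 2, s'.arr a = s.arr a)
    (hw : s'.wrd 0 = s.wrd 0) : Input A s' where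
  reg0 := by rw [hr 0 (by simp), h.reg0]
  reg1 := by rw [hr 1 (by simp), h.reg1]
  reg2 := by rw [hr 2 (by simp), h.reg2]
  out := by rw [ha 0 (by simp)]; exact h.out
  inn := by rw [ha 1 (by simp)]; exact h.inn
  bit u k hk := by rw [bit_congr hw]; exact h.bit u k hk

theorem TreeRep.congr {s s' : Store lam} {par : Parents n₁ n₂} (h : TreeRep E s par)
    (hr : s'.reg 3 = s.reg 3) (ha : ∀ a, 2 ≤ a → a ≤ 7 → s'.arr a = s.arr a)
    (h2 : s'.wrd 2 = s.wrd 2) (h3 : s'.wrd 3 = s.wrd 3) : TreeRep E s' par := by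
  constructor <;> simp only [hr, ha 2, ha 3, ha 4, ha 5, ha 6, ha 7, Nat.reduceLeDiff, le_refl,
    bit_congr h2, bit_congr h3]
  exacts [h.card, h.out, h.le₁, h.le₂, h.ne₁, h.ne₂, h.node₁, h.node₂, h.idx₁, h.idx₂, h.child,
    h.bit₂, h.bit₃]

theorem PosRep.congr {A : AdjLists E} {s s' : Store lam} {par : Parents n₁ n₂} (h : PosRep A s par)
    (h8 : s'.arr 8 = s.arr 8) (h9 : s'.arr 9 = s.arr 9) : PosRep A s' par := by
  constructor <;> simp only [h8, h9]
  exacts [h.pos₁, h.pos₂, h.zero₁, h.zero₂]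

theorem StackRep.congr {s s' : Store lam} : ∀ {fs : List (Frame n₁ n₂)}, StackRep s fs →
    (∀ i ≤ fs.length, s'.arr 12 i 0 = s.arr 12 i 0 ∧ s'.arr 13 i 0 = s.arr 13 i 0) → StackRep s' fs
  | [], _, _ => trivial
  | f :: rest, h, hs => ⟨by rw [(hs _ (by simp)).1, h.1], by rw [(hs _ (by simp)).2, h.2.1],
      h.2.2.congr fun i hi => hs i (hi.trans (by simp))⟩

theorem TreeRep.idx₁_inj {s : Store lam} {par : Parents n₁ n₂} (h : TreeRep E s par)
    {u u' : Fin n₁} (hu : par u ≠ none) (e : s.arr 3 (u.val + 1) 0 = s.arr 3 (u'.val + 1) 0) :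
    u = u' := by
  have hu' : par u' ≠ none := by rw [← h.ne₁, ← e, h.ne₁]; exact hu
  have h1 := h.node₁ u hu
  rw [e, h.node₁ u' hu'] at h1
  exact Fin.ext (by omega)

theorem TreeRep.idx₂_inj {s : Store lam} {par : Parents n₁ n₂} (h : TreeRep E s par)
    {w w' : Fin n₂} (hw : ¬ IsWT1 par w) (e : s.arr 4 (w.val + 1) 0 = s.arr 4 (w'.val + 1) 0) :
    w = w' := by
  have hw' : ¬ IsWT1 par w' := by rw [← h.ne₂, ← e, h.ne₂]; exact hw
  have h1 := h.node₂ w hw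
  rw [e, h.node₂ w' hw'] at h1
  exact Fin.ext (by omega)

end Representation

/-! ## Augmentation -/

/-- The bit `k` of row `i` of `a` becomes `e ≠ 0`. -/
def putBit (a : ℕ) (i k e : Expr) : Cmd := .ite e (.setBit a i k true) (.setBit a i k false)

/-- The entries of the adjacency matrices for the nodes numbered `[3]` are computed. -/
def addAdj : Cmd :=
  .assign 20 (ᴄ 1) ;;
  .loop (ʀ 20 <ₑ ʀ 3 +ₑ ᴄ 1)
    (.getBit 21 0 (.read 5 (ʀ 3) (ᴄ 0)) (.read 6 (ʀ 20) (ᴄ 0)) ;;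
     putBit 2 (ʀ 3) (ʀ 20) (ʀ 21) ;; putBit 3 (ʀ 20) (ʀ 3) (ʀ 21) ;;
     .getBit 21 0 (.read 5 (ʀ 20) (ᴄ 0)) (.read 6 (ʀ 3) (ᴄ 0)) ;;
     putBit 2 (ʀ 20) (ʀ 3) (ʀ 21) ;; putBit 3 (ʀ 3) (ʀ 20) (ʀ 21) ;;
     .assign 20 (ʀ 20 +ₑ ᴄ 1))

/-- The flow is changed along the path on the stack. -/
def flipPath : Cmd :=
  .loop (ʀ 12)
    (.write 2 (.read 12 (ʀ 12) (ᴄ 0)) (ᴄ 0) (.read 13 (ʀ 12) (ᴄ 0)) ;;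
     .write 7 (.read 13 (ʀ 12) (ᴄ 0)) (ᴄ 0) (.read 12 (ʀ 12) (ᴄ 0)) ;;
     .setBit 4 (.read 10 (.read 13 (ʀ 12) (ᴄ 0)) (ᴄ 0)) (.read 4 (.read 13 (ʀ 12) (ᴄ 0)) (ᴄ 0))
       false ;;
     .assign 12 (ʀ 12 -ₑ ᴄ 1))

/-- The path on the stack, from the node `[4]` to the node `[5]`, is successful. -/
def augmentPath : Cmd :=
  .assign 3 (ʀ 3 +ₑ ᴄ 1) ;;
  .write 3 (ʀ 4) (ᴄ 0) (ʀ 3) ;; .write 5 (ʀ 3) (ᴄ 0) (ʀ 4) ;;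
  .write 4 (ʀ 5) (ᴄ 0) (ʀ 3) ;; .write 6 (ʀ 3) (ᴄ 0) (ʀ 5) ;;
  addAdj ;; flipPath

section AugmentSpecs

variable {n₁ n₂ lam N : ℕ} {E : Finset (Fin n₁ × Fin n₂)}

theorem wp_putBit {a : ℕ} {i k e : Expr} {Q : Store lam → ℕ → Prop} {s : Store lam} {T : ℕ}
    (hk : 1 ≤ k.ev s) (hQ : Q (s.setBit a (i.ev s) (k.ev s) (decide (e.ev s ≠ 0))) (T + 2)) :
    wp N (putBit a i k e) Q s T := by
  refine ⟨fun h => ⟨hk, ?_⟩, fun h => ⟨hk, ?_⟩⟩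
  · simpa [h] using hQ
  · simpa [h] using hQ

/-- Numbers are never reassigned, so only the row and the column of the newest number have to be
filled in both matrices. One pass of the loop takes twelve steps. -/
theorem wp_addAdj (hlam : 0 < lam) {s : Store lam} {T : ℕ} (hN : s.reg 3 + 1 ≤ N)
    (hk : 1 ≤ s.reg 3)
    (h6 : ∀ c, 1 ≤ c → c ≤ s.reg 3 → 1 ≤ s.arr 6 c 0) {Q : Store lam → ℕ → Prop}
    (hQ : ∀ s' T', s.Same [20, 21] [] [2, 3] s' → T' ≤ T + 12 * s.reg 3 + 2 →
      (∀ i j, 1 ≤ i → i ≤ s.reg 3 → 1 ≤ j → j ≤ s.reg 3 → (i = s.reg 3 ∨ j = s.reg 3) →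
        s'.bit 2 i j = s.bit 0 (s.arr 5 i 0) (s.arr 6 j 0) ∧
        s'.bit 3 j i = s.bit 0 (s.arr 5 i 0) (s.arr 6 j 0)) →
      (∀ i j, 1 ≤ i → 1 ≤ j → i ≠ s.reg 3 → j ≠ s.reg 3 →
        s'.bit 2 i j = s.bit 2 i j ∧ s'.bit 3 j i = s.bit 3 j i) → Q s' T') :
    wp N addAdj Q s T := by
  simp only [addAdj, wp, Expr.ev]
  refine ⟨by omega, ?_⟩
  apply wp_loop (I := fun s' T' => s.Same [20, 21] [] [2, 3] s' ∧ 1 ≤ s'.reg 20 ∧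
      s'.reg 20 ≤ s.reg 3 + 1 ∧ T' + 12 ≤ T + 12 * s'.reg 20 + 1 ∧
      (∀ i j, 1 ≤ i → i ≤ s.reg 3 → 1 ≤ j → j ≤ s.reg 3 →
        ((i = s.reg 3 ∧ j < s'.reg 20) ∨ (j = s.reg 3 ∧ i < s'.reg 20)) →
        s'.bit 2 i j = s.bit 0 (s.arr 5 i 0) (s.arr 6 j 0) ∧
        s'.bit 3 j i = s.bit 0 (s.arr 5 i 0) (s.arr 6 j 0)) ∧
      (∀ i j, 1 ≤ i → 1 ≤ j → i ≠ s.reg 3 → j ≠ s.reg 3 →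
        s'.bit 2 i j = s.bit 2 i j ∧ s'.bit 3 j i = s.bit 3 j i)) (M := T + 12 * s.reg 3 + 1)
  · refine ⟨⟨?_, fun _ _ => rfl, fun _ _ => rfl, rfl⟩, by simp, by simp, by simp, ?_, by simp⟩
    · intro r hr
      simp only [List.mem_cons, List.not_mem_nil, or_false, not_or] at hr
      simp [hr]
    · intro i j h1 h2 h3 h4 h5
      simp only [reg_setReg, ↓reduceIte] at h5
      omega
  · rintro s' T' ⟨-, h1, h2, h3, -⟩
    omega
  · rintro s' T' ⟨hs, h1, h2, h3, h4, h5⟩ he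
    simp only [Expr.ev, ne_eq, indic_eq_zero, not_not, hs.reg 3 (by simp)] at he
    have r3 := hs.reg 3 (by simp)
    have a5 := hs.arr 5 (by simp)
    have a6 := hs.arr 6 (by simp)
    have b0 := bit_congr (hs.wrd 0 (by simp))
    simp only [wp, Expr.ev]
    refine ⟨by rw [a6]; exact h6 _ h1 (by omega), by omega, ?_⟩
    refine wp_putBit (by simpa [Expr.ev] using h1) (wp_putBit (by simp [Expr.ev, r3, hk]) ?_)
    simp only [Expr.ev]
    refine ⟨by simp [a6, r3, h6 _ hk le_rfl], by omega, ?_⟩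
    refine wp_putBit (by simp [Expr.ev, r3, hk]) (wp_putBit (by simp [Expr.ev, h1]) ?_)
    simp only [Expr.ev, reg_setReg, reg_setBit, Nat.reduceEqDiff, ↓reduceIte, ne_eq,
      indic_eq_zero, not_not, arr_setReg, arr_setBit, r3, a5, a6, b0]
    refine ⟨by omega, ⟨?_, ?_, ?_, ?_⟩, ?_, ?_, ?_, ?_, ?_⟩
    · intro r hr
      have := hs.reg r hr
      simp only [List.mem_cons, List.not_mem_nil, or_false, not_or] at hr
      simp [hr, this]
    · intro a ha
      simp [hs.arr a ha]
    · intro a ha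
      have := hs.wrd a ha
      simp only [List.mem_cons, List.not_mem_nil, or_false, not_or] at ha
      simp [ha, this]
    · simp [hs.log]
    · simp
    · simp; omega
    · simp; omega
    · intro i j hi hi' hj hj' hij
      simp only [bit_setReg, bit_setBit _ _ _ _ _ _ _ _ hlam h1 hi, bit_setBit _ _ _ _ _ _ _ _ hlam h1 hj,
        bit_setBit _ _ _ _ _ _ _ _ hlam hk hi, bit_setBit _ _ _ _ _ _ _ _ hlam hk hj]
      have := h4 i j hi hi' hj hj'
      by_cases c1 : i = s'.reg 20 ∧ j = s.reg 3
      · simp [c1, b0]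
      · by_cases c2 : i = s.reg 3 ∧ j = s'.reg 20
        · simp [c2]
          grind
        · have c3 := this (by omega)
          simp [c1, c2, c3]
          grind
    · intro i j hi hj hik hjk
      simp only [bit_setReg, bit_setBit _ _ _ _ _ _ _ _ hlam h1 hi, bit_setBit _ _ _ _ _ _ _ _ hlam h1 hj,
        bit_setBit _ _ _ _ _ _ _ _ hlam hk hi, bit_setBit _ _ _ _ _ _ _ _ hlam hk hj]
      simpa [hik, hjk] using h5 i j hi hj hik hjk
  · rintro s' T' ⟨hs, h1, h2, h3, h4, h5⟩ he
    simp only [Expr.ev, indic_eq_zero, hs.reg 3 (by simp)] at he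
    refine hQ _ _ hs (by omega) ?_ h5
    intro i j hi hi' hj hj' hij
    exact h4 i j hi hi' hj hj' (by omega)

end AugmentSpecs

section AugmentSpecs

variable {n₁ n₂ lam N : ℕ} {E : Finset (Fin n₁ × Fin n₂)}

theorem StackRep.of_append {s : Store lam} {fs' : List (Frame n₁ n₂)} :
    ∀ {l : List (Frame n₁ n₂)}, StackRep s (l ++ fs') → StackRep s fs'
  | [], h => h
  | _ :: _, h => StackRep.of_append h.2.2

/-- During a sequence of mergers the arrays still hold the tree from before it, and the changes
exist only on the stack. They are now written out, at five steps per merger, and the roots are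
deleted from the layers because they become visited. -/
theorem wp_flipPath (hlam : 0 < lam) {s : Store lam} {T : ℕ} {fs : List (Frame n₁ n₂)}
    {par : Parents n₁ n₂} (hD : s.reg 12 = fs.length) (hfs : StackRep s fs)
    (hDN : fs.length ≤ N) (hN : n₁ + n₂ ≤ N)
    (hinj : ∀ u u' w, par u = some w → par u' = some w → u = u')
    (hroot : ∀ f ∈ fs, par f.node = some f.root)
    (hout : ∀ u : Fin n₁, (∀ f ∈ fs, f.node ≠ u) → s.arr 2 (u.val + 1) 0 = nodeNum (par u))
    (hchild : ∀ w : Fin n₂, (∀ f ∈ fs, f.root ≠ w) →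
      ∀ u : Fin n₁, par u = some w → s.arr 7 (w.val + 1) 0 = u.val + 1)
    (hidx : ∀ f ∈ fs, 1 ≤ s.arr 4 (f.root.val + 1) 0) {Q : Store lam → ℕ → Prop}
    (hQ : ∀ s' T', s.Same [12] [2, 7] [4] s' → T' ≤ T + 5 * fs.length + 1 → s'.reg 12 = 0 →
      (∀ u : Fin n₁, s'.arr 2 (u.val + 1) 0 = nodeNum (par u)) →
      (∀ (u : Fin n₁) (w : Fin n₂), par u = some w → s'.arr 7 (w.val + 1) 0 = u.val + 1) →
      (∀ p c, 1 ≤ c → (s'.bit 4 p c = true ↔ s.bit 4 p c = true ∧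
        ¬ ∃ f ∈ fs, p = s.arr 10 (f.root.val + 1) 0 ∧ c = s.arr 4 (f.root.val + 1) 0)) →
      Q s' T') :
    wp N flipPath Q s T := by
  simp only [flipPath, wp]
  -- `l` is the part of the stack already written out and `fs'` the part still to come. The arrays
  -- are correct away from `fs'`, so no intermediate tree has to be described.
  apply wp_loop (I := fun s' T' => s.Same [12] [2, 7] [4] s' ∧ ∃ l fs', fs = l ++ fs' ∧
      s'.reg 12 = fs'.length ∧ T' + 5 * fs'.length ≤ T + 5 * fs.length ∧
      (∀ u : Fin n₁, (∀ f ∈ fs', f.node ≠ u) → s'.arr 2 (u.val + 1) 0 = nodeNum (par u)) ∧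
      (∀ w : Fin n₂, (∀ f ∈ fs', f.root ≠ w) →
        ∀ u : Fin n₁, par u = some w → s'.arr 7 (w.val + 1) 0 = u.val + 1) ∧
      (∀ p c, 1 ≤ c → (s'.bit 4 p c = true ↔ s.bit 4 p c = true ∧
        ¬ ∃ f ∈ l, p = s.arr 10 (f.root.val + 1) 0 ∧ c = s.arr 4 (f.root.val + 1) 0)))
    (M := T + 5 * fs.length)
  · exact ⟨.refl _ _ _ _, [], fs, rfl, hD, le_rfl, hout, hchild, by simp⟩
  · rintro s' T' ⟨-, l, fs', -, -, h, -⟩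
    omega
  · rintro s' T' ⟨hs, l, fs', rfl, h1, h2, h3, h4, h5⟩ he
    cases fs' with
    | nil => exact absurd h1 he
    | cons f rest =>
      have hst := StackRep.of_append hfs
      have hf : f ∈ l ++ f :: rest := by simp
      simp only [List.length_cons] at h1 h2
      have e12 : s'.arr 12 (rest.length + 1) 0 = f.node.val + 1 := by
        rw [hs.arr 12 (by simp), hst.1]
      have e13 : s'.arr 13 (rest.length + 1) 0 = f.root.val + 1 := by
        rw [hs.arr 13 (by simp), hst.2.1]
      have i4 := hidx f hf
      simp only [wp, Expr.ev, h1, arr_setReg, arr_setArr_ne, arr_setBit, ne_eq,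
        Nat.reduceEqDiff, not_false_eq_true, e12, e13, reg_setArr, reg_setBit, hs.arr 4 (by simp),
        hs.arr 10 (by simp)]
      refine ⟨by omega, by omega, i4, ?_, ⟨?_, ?_, ?_, ?_⟩, l ++ [f], rest, by simp, ?_, ?_, ?_, ?_, ?_⟩
      · simp at hDN; omega
      · intro r hr
        have := hs.reg r hr
        simp only [List.mem_singleton] at hr
        simp [hr, this]
      · intro a ha
        have := hs.arr a ha
        simp only [List.mem_cons, List.not_mem_nil, or_false, not_or] at ha
        simp [ha, this]
      · intro a ha
        have := hs.wrd a ha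
        simp only [List.mem_singleton] at ha
        simp [ha, this]
      · simp [hs.log]
      · simp
      · omega
      · intro u hu
        simp only [arr_setReg, arr_setBit, ne_eq, Nat.reduceEqDiff, not_false_eq_true,
          arr_setArr_ne, arr_setArr_self, and_true]
        by_cases hfu : f.node = u
        · simp [← hfu, hroot f hf]
        · rw [if_neg (by intro e; exact hfu (Fin.ext (by omega)))]
          exact h3 u (by simpa [hfu] using hu)
      · intro w hw u hu
        simp only [arr_setReg, arr_setBit, arr_setArr_self, and_true]
        by_cases hfw : f.root = w
        · subst hfw
          simp [hinj _ _ _ hu (hroot f hf)]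
        · rw [if_neg (by intro e; exact hfw (Fin.ext (by omega)))]
          simp only [ne_eq, Nat.reduceEqDiff, not_false_eq_true, arr_setArr_ne]
          exact h4 w (by simpa [hfw] using hw) u hu
      · intro p c hc
        simp only [bit_setReg, bit_setBit _ _ _ _ _ _ _ _ hlam i4 hc, true_and, bit_setArr]
        by_cases hpc : p = s.arr 10 (f.root.val + 1) 0 ∧ c = s.arr 4 (f.root.val + 1) 0
        · rw [if_pos hpc]
          simp only [Bool.false_eq_true, false_iff, not_and, not_not]
          exact fun _ => ⟨f, by simp, hpc⟩
        · rw [if_neg hpc, h5 p c hc]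
          simp only [List.mem_append, List.mem_singleton, or_and_right, exists_or, exists_eq_left,
            hpc, or_false]
  · rintro s' T' ⟨hs, l, fs', rfl, h1, h2, h3, h4, h5⟩ he
    rw [Expr.ev, h1, List.length_eq_zero_iff] at he
    subst he
    refine hQ _ _ hs (by simp at h2 ⊢; omega) (by simpa using h1) (fun u => h3 u (by simp))
      (fun u w hu => h4 w (by simp) u hu) ?_
    simpa using h5

/-- The effect on the tree of the path `fs` from the node `u₀` to the node `w₀`. -/
structure FlipSpec (E : Finset (Fin n₁ × Fin n₂)) (par par' : Parents n₁ n₂)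
    (fs : List (Frame n₁ n₂)) (u₀ : Fin n₁) (w₀ : Fin n₂) : Prop where
  inj : ∀ u u' w, par' u = some w → par' u' = some w → u = u'
  root : ∀ f ∈ fs, par' f.node = some f.root
  other : ∀ u, (∀ f ∈ fs, f.node ≠ u) → par' u = par u
  child : ∀ w, (∀ f ∈ fs, f.root ≠ w) → ∀ u, par' u = some w ↔ par u = some w
  none₀ : par u₀ = none
  none_iff : ∀ u, par' u = none ↔ par u = none ∧ u ≠ u₀
  wt₀ : IsWT1 par w₀
  wt_iff : ∀ w, IsWT1 par' w ↔ IsWT1 par w ∧ w ≠ w₀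
  nodup : (fs.map Frame.node).Nodup

theorem FlipSpec.card {par par' : Parents n₁ n₂} {fs : List (Frame n₁ n₂)} {u₀ : Fin n₁}
    {w₀ : Fin n₂} (h : FlipSpec E par par' fs u₀ w₀) :
    (treeEdges par').card = (treeEdges par).card + 1 := by
  rw [← card_image_fst_treeEdges, ← card_image_fst_treeEdges]
  rw [← Finset.card_insert_of_notMem (a := u₀) (by simp [h.none₀])]
  congr 1
  ext u
  simp only [ne_eq, h.none_iff, Finset.mem_filter, Finset.mem_univ, true_and, Finset.mem_insert]
  tauto

/-- The nodes of the path are distinct and matched afterwards, so the path is no longer than the new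
matching and flipping it costs O(κ). -/
theorem FlipSpec.length_le {par par' : Parents n₁ n₂} {fs : List (Frame n₁ n₂)} {u₀ : Fin n₁}
    {w₀ : Fin n₂} (h : FlipSpec E par par' fs u₀ w₀) : fs.length ≤ (treeEdges par').card := by
  classical
  rw [← card_image_fst_treeEdges, ← List.length_map (f := Frame.node),
    ← List.toFinset_card_of_nodup h.nodup]
  refine Finset.card_le_card fun u hu => ?_
  simp only [List.mem_toFinset, List.mem_map] at hu
  obtain ⟨f, hf, rfl⟩ := hu
  simp [h.root f hf]

/-- Only the two ends of the path are newly matched. Both receive the next number, and all older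
numbers and matrix entries stay valid. The factor 17 is 12 for the matrices plus 5 for the path. -/
theorem wp_augmentPath (hlam : 0 < lam) {A : AdjLists E} {s : Store lam} {T : ℕ}
    {fs : List (Frame n₁ n₂)} {par par' : Parents n₁ n₂} {u₀ : Fin n₁} {w₀ : Fin n₂}
    (hI : Input A s) (hM : TreeRep E s par) (hF : FlipSpec E par par' fs u₀ w₀)
    (hD : s.reg 12 = fs.length) (hfs : StackRep s fs)
    (hu : s.reg 4 = u₀.val + 1) (hw : s.reg 5 = w₀.val + 1)
    (hk : (treeEdges par').card ≤ n₁) (hN : n₁ + n₂ + 2 ≤ N)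
    {Q : Store lam → ℕ → Prop}
    (hQ : ∀ s' T', s.Same [3, 12, 20, 21] [2, 3, 4, 5, 6, 7] [2, 3, 4] s' →
      T' ≤ T + 17 * (treeEdges par').card + 8 → s'.reg 12 = 0 → TreeRep E s' par' →
      (∀ w : Fin n₂, w ≠ w₀ → s'.arr 4 (w.val + 1) 0 = s.arr 4 (w.val + 1) 0) →
      (s'.arr 4 (w₀.val + 1) 0 = s'.reg 3) →
      (∀ a ≤ s.reg 3, s'.arr 6 a 0 = s.arr 6 a 0) →
      (∀ p c, 1 ≤ c → (s'.bit 4 p c = true ↔ s.bit 4 p c = true ∧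
        ¬ ∃ f ∈ fs, p = s.arr 10 (f.root.val + 1) 0 ∧ c = s'.arr 4 (f.root.val + 1) 0)) →
      Q s' T') :
    wp N augmentPath Q s T := by
  have hc := hF.card
  have hlen := hF.length_le
  have h3 := hM.card
  have hlN : fs.length ≤ N := by omega
  simp only [augmentPath, wp, Expr.ev, reg_setReg, reg_setArr, arr_setArr_self,
    ne_eq, arr_setArr_ne, not_false_eq_true, ↓reduceIte, Nat.reduceEqDiff, hu, hw]
  refine ⟨by omega, by omega, by omega, by omega, by omega, ?_⟩
  set s1 := ((((s.setReg 3 (s.reg 3 + 1)).setArr 3 (u₀.val + 1) 0 (s.reg 3 + 1)).setArr 5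
      (s.reg 3 + 1) 0 (u₀.val + 1)).setArr 4 (w₀.val + 1) 0 (s.reg 3 + 1)).setArr 6
      (s.reg 3 + 1) 0 (w₀.val + 1) with hs1
  have r1 : ∀ r, r ≠ 3 → s1.reg r = s.reg r := by intro r hr; simp [hs1, hr]
  have r3 : s1.reg 3 = s.reg 3 + 1 := by simp [hs1]
  have a1 : ∀ a, a ≠ 3 → a ≠ 4 → a ≠ 5 → a ≠ 6 → s1.arr a = s.arr a := by
    intro a _ _ _ _; simp [hs1, *]
  have a3 : ∀ u : Fin n₁, s1.arr 3 (u.val + 1) 0 =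
      if u = u₀ then s.reg 3 + 1 else s.arr 3 (u.val + 1) 0 := by
    intro u; simp [hs1, Fin.ext_iff]
  have a4 : ∀ w : Fin n₂, s1.arr 4 (w.val + 1) 0 =
      if w = w₀ then s.reg 3 + 1 else s.arr 4 (w.val + 1) 0 := by
    intro u; simp [hs1, Fin.ext_iff]
  have a5 : ∀ a, s1.arr 5 a 0 = if a = s.reg 3 + 1 then u₀.val + 1 else s.arr 5 a 0 := by
    intro u; simp [hs1]
  have a6 : ∀ a, s1.arr 6 a 0 = if a = s.reg 3 + 1 then w₀.val + 1 else s.arr 6 a 0 := by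
    intro u; simp [hs1]
  have w1 : s1.wrd = s.wrd := by simp [hs1]
  have b1 : s1.bit = s.bit := by simp [hs1]
  have l1 : s1.log = s.log := by simp [hs1]
  clear_value s1
  have idx1 : ∀ a, 1 ≤ a → a ≤ s1.reg 3 →
      ∃ u : Fin n₁, s1.arr 5 a 0 = u.val + 1 ∧ s1.arr 3 (u.val + 1) 0 = a := by
    intro a h1 h2
    rcases Nat.lt_or_ge (s.reg 3) a with h | h
    · obtain rfl : a = s.reg 3 + 1 := by omega
      exact ⟨u₀, by simp [a5], by simp [a3]⟩
    · obtain ⟨u, e1, e2⟩ := hM.idx₁ a h1 h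
      refine ⟨u, by rw [a5, if_neg (by omega), e1], ?_⟩
      rw [a3, if_neg, e2]
      rintro rfl
      have := (hM.ne₁ u).1 (by omega)
      exact this hF.none₀
  have idx2 : ∀ a, 1 ≤ a → a ≤ s1.reg 3 →
      ∃ w : Fin n₂, s1.arr 6 a 0 = w.val + 1 ∧ s1.arr 4 (w.val + 1) 0 = a := by
    intro a h1 h2
    rcases Nat.lt_or_ge (s.reg 3) a with h | h
    · obtain rfl : a = s.reg 3 + 1 := by omega
      exact ⟨w₀, by simp [a6], by simp [a4]⟩
    · obtain ⟨u, e1, e2⟩ := hM.idx₂ a h1 h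
      refine ⟨u, by rw [a6, if_neg (by omega), e1], ?_⟩
      rw [a4, if_neg, e2]
      rintro rfl
      have := (hM.ne₂ u).1 (by omega)
      exact this hF.wt₀
  have ne1 : ∀ u : Fin n₁, s1.arr 3 (u.val + 1) 0 ≠ 0 ↔ par' u ≠ none := by
    intro u
    rw [a3, ne_eq (par' u), hF.none_iff]
    by_cases h : u = u₀
    · simp [h]
    · simp [h, hM.ne₁ u]
  have ne2 : ∀ w : Fin n₂, s1.arr 4 (w.val + 1) 0 ≠ 0 ↔ ¬ IsWT1 par' w := by
    intro u
    rw [a4, hF.wt_iff]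
    by_cases h : u = w₀
    · simp [h]
    · simp [h, hM.ne₂ u]
  have hpar : ∀ u, par' u ≠ none → u ≠ u₀ → par u ≠ none := by
    intro u h1 h2 h3
    exact h1 ((hF.none_iff u).2 ⟨h3, h2⟩)
  have hwt : ∀ u, ¬ IsWT1 par' u → u ≠ w₀ → ¬ IsWT1 par u := by
    intro u h1 h2 h3
    exact h1 ((hF.wt_iff u).2 ⟨h3, h2⟩)
  have le1 : ∀ u : Fin n₁, s1.arr 3 (u.val + 1) 0 ≤ s1.reg 3 := by
    intro u
    have := hM.le₁ u
    rw [a3, r3]; split_ifs <;> omega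
  have le2 : ∀ u : Fin n₂, s1.arr 4 (u.val + 1) 0 ≤ s1.reg 3 := by
    intro u
    have := hM.le₂ u
    rw [a4, r3]; split_ifs <;> omega
  have node1 : ∀ u : Fin n₁, par' u ≠ none → s1.arr 5 (s1.arr 3 (u.val + 1) 0) 0 = u.val + 1 := by
    intro u hu
    by_cases h : u = u₀
    · simp [a3, a5, h]
    · have := hM.le₁ u
      rw [a3, if_neg h, a5, if_neg (by omega), hM.node₁ u (hpar u hu h)]
  have node2 : ∀ u : Fin n₂, ¬ IsWT1 par' u →
      s1.arr 6 (s1.arr 4 (u.val + 1) 0) 0 = u.val + 1 := by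
    intro u hu
    by_cases h : u = w₀
    · simp [a4, a6, h]
    · have := hM.le₂ u
      rw [a4, if_neg h, a6, if_neg (by omega), hM.node₂ u (hwt u hu h)]
  refine wp_addAdj hlam (by omega) (by omega) ?_ ?_
  · intro c h1 h2
    obtain ⟨w, e, -⟩ := idx2 c h1 h2
    omega
  intro s2 T2 hs2 hT2 hb2 hb2'
  have e12 := hs2.arr 12 (by simp)
  have e13 := hs2.arr 13 (by simp)
  refine wp_flipPath hlam (fs := fs) (par := par') ?_ ?_ (by omega) (by omega) hF.inj hF.root ?_ ?_ ?_ ?_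
  · rw [hs2.reg 12 (by simp), r1 _ (by simp), hD]
  · refine hfs.congr fun i _ => ?_
    rw [e12, e13, a1 12 (by simp) (by simp) (by simp) (by simp),
      a1 13 (by simp) (by simp) (by simp) (by simp)]
    exact ⟨rfl, rfl⟩
  · intro u hu
    rw [hs2.arr 2 (by simp), a1 2 (by simp) (by simp) (by simp) (by simp), hM.out, hF.other u hu]
  · intro w hw u hu
    rw [hs2.arr 7 (by simp), a1 7 (by simp) (by simp) (by simp) (by simp)]
    exact hM.child _ _ ((hF.child w hw u).1 hu)
  · intro f hf
    rw [hs2.arr 4 (by simp), Nat.one_le_iff_ne_zero, ne2]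
    exact fun h => h _ (hF.root f hf)
  intro s3 T3 hs3 hT3 h12 hout hchild hbit
  have r33 : s3.reg 3 = s1.reg 3 := by rw [hs3.reg 3 (by simp), hs2.reg 3 (by simp)]
  have aa : ∀ a, a ≠ 2 → a ≠ 7 → s3.arr a = s1.arr a := by
    intro a h2 h7
    rw [hs3.arr a (by simp [h2, h7]), hs2.arr a (by simp)]
  have c2 := bit_congr (hs3.wrd 2 (by simp))
  have c3 := bit_congr (hs3.wrd 3 (by simp))
  -- A pair that involves the newest number has just been read from the input; for any other pair
  -- the old matrix entry survives.
  have hadj : ∀ (u : Fin n₁) (w : Fin n₂), par' u ≠ none → ¬ IsWT1 par' w →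
      (s2.bit 2 (s1.arr 3 (u.val + 1) 0) (s1.arr 4 (w.val + 1) 0) = true ↔ (u, w) ∈ E) ∧
      (s2.bit 3 (s1.arr 4 (w.val + 1) 0) (s1.arr 3 (u.val + 1) 0) = true ↔ (u, w) ∈ E) := by
    intro u w hu hw
    have i1 := Nat.one_le_iff_ne_zero.2 ((ne1 u).2 hu)
    have i2 := Nat.one_le_iff_ne_zero.2 ((ne2 w).2 hw)
    by_cases h : s1.arr 3 (u.val + 1) 0 = s1.reg 3 ∨ s1.arr 4 (w.val + 1) 0 = s1.reg 3
    · obtain ⟨q1, q2⟩ := hb2 _ _ i1 (le1 u) i2 (le2 w) h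
      rw [q1, q2, node1 u hu, node2 w hw, b1, hI.bit u _ (by omega)]
      simp [← Fin.ext_iff]
    · push Not at h
      obtain ⟨q1, q2⟩ := hb2' _ _ i1 i2 h.1 h.2
      have hu0 : u ≠ u₀ := by rintro rfl; exact h.1 (by rw [a3, r3]; simp)
      have hw0 : w ≠ w₀ := by rintro rfl; exact h.2 (by rw [a4, r3]; simp)
      rw [q1, q2, b1, a3, a4, if_neg hu0, if_neg hw0]
      exact ⟨hM.bit₂ u w (hpar u hu hu0) (hwt w hw hw0), hM.bit₃ u w (hpar u hu hu0) (hwt w hw hw0)⟩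
  refine hQ s3 T3 ⟨?_, ?_, ?_, ?_⟩ ?_ h12 ?_ ?_ ?_ ?_ ?_
  · intro r hr
    simp only [List.mem_cons, List.not_mem_nil, or_false, not_or] at hr
    rw [hs3.reg r (by simp [hr]), hs2.reg r (by simp [hr]), r1 r (by simp [hr])]
  · intro a ha
    simp only [List.mem_cons, List.not_mem_nil, or_false, not_or] at ha
    rw [aa a ha.1 ha.2.2.2.2.2, a1 a ha.2.1 ha.2.2.1 ha.2.2.2.1 ha.2.2.2.2.1]
  · intro a ha
    simp only [List.mem_cons, List.not_mem_nil, or_false, not_or] at ha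
    rw [hs3.wrd a (by simp [ha]), hs2.wrd a (by simp [ha]), w1]
  · rw [hs3.log, hs2.log, l1]
  · omega
  · constructor <;> (try simp only [r33, aa 3, aa 4, aa 5, aa 6, ne_eq, Nat.reduceEqDiff,
      not_false_eq_true])
    · omega
    · exact hout
    · exact le1
    · exact le2
    · exact ne1
    · exact ne2
    · exact node1
    · exact node2
    · exact idx1
    · exact idx2
    · exact hchild
    · intro u w hu hw; rw [c2]; exact (hadj u w hu hw).1
    · intro u w hu hw; rw [c3]; exact (hadj u w hu hw).2
  · intro w hw
    rw [aa 4 (by simp) (by simp), a4, if_neg hw]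
  · rw [aa 4 (by simp) (by simp), a4, if_pos rfl, r33, r3]
  · intro a ha
    rw [aa 6 (by simp) (by simp), a6, if_neg (by omega)]
  · intro p c hpc
    rw [hbit p c hpc, bit_congr (hs2.wrd 4 (by simp)), b1, aa 4 (by simp) (by simp),
      hs2.arr 10 (by simp), hs2.arr 4 (by simp), a1 10 (by simp) (by simp) (by simp) (by simp)]

end AugmentSpecs

/-! ## Runs of the algorithm -/

section Runs

variable {n₁ n₂ : ℕ} {E : Finset (Fin n₁ × Fin n₂)}

theorem Steps.snoc {s s' s'' : State n₁ n₂} {os : List (Op (Fin n₁) (Fin n₂))}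
    {o : Op (Fin n₁) (Fin n₂)} (h : Steps E s os s') (h' : Step E s' o s'') :
    Steps E s (os ++ [o]) s'' := by
  induction h with
  | nil => exact .cons h' .nil
  | cons h1 _ ih => exact .cons h1 (ih h')

/-- The operations in `log` lead from the initial state to `q`. -/
def Reached (E : Finset (Fin n₁ × Fin n₂)) (log : List (Op ℕ ℕ)) (q : State n₁ n₂) : Prop :=
  ∃ os, Steps E (State.initial E) os q ∧
    log = os.map (Op.map (fun u => u.val + 1) (fun w => w.val + 1))

theorem Reached.step {log : List (Op ℕ ℕ)} {q q' : State n₁ n₂} {o : Op (Fin n₁) (Fin n₂)}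
    (h : Reached E log q) (h' : Step E q o q') :
    Reached E (log ++ [o.map (fun u => u.val + 1) (fun w => w.val + 1)]) q' := by
  obtain ⟨os, h1, rfl⟩ := h
  exact ⟨os ++ [o], h1.snoc h', by simp⟩

variable {par par₀ : Parents n₁ n₂}
  {label : Fin n₁ ⊕ Fin n₂ → ℕ∞} {stage : ℕ∞} {visited : Set (Fin n₂)}
  {fs : List (Frame n₁ n₂)} {u : Fin n₁} {w : Fin n₂}

theorem MergeChain.cons_of_mergerArc (hI : StageInv E par₀ label stage visited) (hs : stage ≠ ⊤)
    (h : MergeChain E par₀ label stage visited fs par)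
    (ha : State.MergerArc E ⟨par, label, stage, visited, fs⟩ u w) :
    MergeChain E par₀ label stage visited (⟨u, par u, w⟩ :: fs)
      (Function.update par u (some w)) := by
  obtain ⟨h1, h2, h3, h4⟩ := ha
  refine .cons (f := ⟨u, par u, w⟩) h rfl h2 h3 h4 ?_ ?_
  · rintro rfl
    cases h
    exact ⟨h1.1, h1.2.2⟩
  · rintro g r rfl
    exact (h.par_eq_root_iff hI hs u).1 h1

/-- The searching node can be read off from `par₀`, the tree that is actually stored, although the
abstract state has already been modified by the mergers on the stack. -/
theorem MergeChain.mergerArc_cons_iff {f : Frame n₁ n₂}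
    (hI : StageInv E par₀ label stage visited) (hs : stage ≠ ⊤)
    (h : MergeChain E par₀ label stage visited (f :: fs) par) :
    State.MergerArc E ⟨par, label, stage, visited, f :: fs⟩ u w ↔
      par₀ u = some f.root ∧ (u, w) ∈ E ∧ w ∉ visited ∧ label (.inl u) = label (.inr w) + 1 := by
  rw [← h.par_eq_root_iff hI hs u]
  rfl

theorem Reached.augment {log : List (Op ℕ ℕ)} (hr : Reached E log ⟨par, label, stage, visited, fs⟩)
    (ha : State.MergerArc E ⟨par, label, stage, visited, fs⟩ u w) (h0 : label (.inr w) = 0) :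
    Reached E (log ++ [.merge (u.val + 1) (w.val + 1)])
      ⟨Function.update par u (some w), label, stage,
        visited ∪ {r | ∃ g ∈ (⟨u, par u, w⟩ : Frame n₁ n₂) :: fs, g.root = r}, []⟩ := by
  have e : visited ∪ {r | ∃ g ∈ (⟨u, par u, w⟩ : Frame n₁ n₂) :: fs, g.root = r} =
      visited ∪ {r | r = w ∨ ∃ f ∈ fs, f.root = r} := by
    ext r
    simp [eq_comm]
  rw [e]
  exact hr.step (.augment ha h0)

theorem MergeChain.flipSpec {f : Frame n₁ n₂} (hI : StageInv E par₀ label stage visited)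
    (hs : stage ≠ ⊤) (h : MergeChain E par₀ label stage visited (f :: fs) par)
    (h0 : label (.inr f.root) = 0) {f₀ : Frame n₁ n₂} (hl : (f :: fs).getLast? = some f₀) :
    FlipSpec E par₀ par (f :: fs) f₀.node f.root := by
  obtain ⟨p1, p2, p3, ⟨f₁, q1, q2, q3⟩, p5, p6⟩ := h.success hI hs h0
  rw [hl] at q1
  obtain rfl := Option.some_injective _ q1
  exact ⟨(h.stageInv_success hI hs h0).inj, p1, p2, p3, q2, q3, p5, p6, (h.par_eq hI hs).2.2.1⟩

end Runs

/-! ## The greedy stage -/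

/-- Row `0` of the word array `6` becomes the set of the nodes without a child. -/
def initFree : Cmd :=
  .assign 19 (ᴄ 1) ;; .assign 20 (ᴄ 1) ;;
  .loop (ʀ 20 <ₑ ʀ 2 +ₑ ᴄ 1) (.setBit 6 (ᴄ 0) (ʀ 20) true ;; .assign 20 (ʀ 20 +ₑ ᴄ 1)) ;;
  .assign 20 (ᴄ 1) ;;
  .loop (ʀ 20 <ₑ ʀ 18) (.wwrite 6 (ᴄ 0) (ʀ 20) (.read 6 (ᴄ 0) (ᴄ 0)) ;;
    .assign 20 (ʀ 20 +ₑ ᴄ 1)) ;;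
  .assign 20 (ᴄ 1) ;;
  .loop (ʀ 20 <ₑ ʀ 3 +ₑ ᴄ 1) (.setBit 6 (ᴄ 0) (.read 6 (ʀ 20) (ᴄ 0)) false ;;
    .assign 20 (ʀ 20 +ₑ ᴄ 1))

/-- Register `7` becomes a neighbour without a child of the node `[16]`, or `0`. First the list of
neighbours is searched for `[18]` steps, and then the words. -/
def findFree : Cmd :=
  .assign 20 (ᴄ 0) ;;
  .loop ((ʀ 20 <ₑ ʀ 18) *ₑ (.read 0 (ʀ 16) (ʀ 20) *ₑ .read 4 (.read 0 (ʀ 16) (ʀ 20)) (ᴄ 0)))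
    (.assign 20 (ʀ 20 +ₑ ᴄ 1)) ;;
  .ite (ʀ 20 <ₑ ʀ 18) (.assign 7 (.read 0 (ʀ 16) (ʀ 20)))
    (.ite (ʀ 19) .skip initFree ;;
      .assign 9 (ʀ 16) ;; .assign 10 (ᴄ 0) ;; .assign 11 (ʀ 18) ;; scan 0 6)

section FindFree

variable {n₁ n₂ lam N : ℕ} {E : Finset (Fin n₁ × Fin n₂)}

theorem bit_setWrd_row (hlam : 0 < lam) {s : Store lam} {a i j k : ℕ}
    (h : ∀ k, 1 ≤ k → k ≤ lam → s.bit a i k = true) (hk : (k - 1) / lam = j) :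
    (s.setWrd a i j (s.wrd a i 0)).bit a i k = true := by
  rw [bit_setWrd, if_pos ⟨rfl, rfl, hk⟩]
  have hm := Nat.mod_lt (k - 1) hlam
  have := h ((k - 1) % lam + 1) (by omega) (by omega)
  rwa [Store.bit, Nat.add_sub_cancel, Nat.div_eq_of_lt hm, Nat.mod_mod] at this

/-- No word constant with all bits set is available. So one word is filled bit by bit, copied `n₂ /
lam` times, and the bits of the matched nodes are then cleared one by one; this avoids a term
proportional to `n₂`. -/
theorem wp_initFree (hlam : 0 < lam) {s : Store lam} {T : ℕ} {par : Parents n₁ n₂}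
    (hM : TreeRep E s par) (h2 : s.reg 2 = lam) (hl1 : lam ≤ n₁)
    (h18 : s.reg 18 = n₂ / lam + 1) (h3 : s.reg 3 ≤ n₁) (hN : n₁ + n₂ + 2 ≤ N)
    {Q : Store lam → ℕ → Prop}
    (hQ : ∀ s' T', s.Same [19, 20] [] [6] s' → s'.reg 19 = 1 →
      T' ≤ T + 3 * lam + 3 * s.reg 18 + 3 * s.reg 3 + 7 →
      (∀ w : Fin n₂, s'.bit 6 0 (w.val + 1) = true ↔ IsWT1 par w) → Q s' T') :
    wp N initFree Q s T := by
  have hD : n₂ / lam ≤ n₂ := Nat.div_le_self _ _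
  simp only [initFree, wp, Expr.ev]
  refine ⟨by omega, by omega, ?_⟩
  apply wp_loop (I := fun s' T' => s.Same [19, 20] [] [6] s' ∧ s'.reg 19 = 1 ∧ 1 ≤ s'.reg 20 ∧
      s'.reg 20 ≤ lam + 1 ∧ T' + 3 ≤ T + 3 * s'.reg 20 + 2 ∧
      ∀ k, 1 ≤ k → k < s'.reg 20 → s'.bit 6 0 k = true) (M := T + 3 * lam + 2)
  · refine ⟨⟨?_, fun _ _ => rfl, fun _ _ => rfl, rfl⟩, by simp, by simp, by simp, by simp, ?_⟩
    · intro r hr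
      simp only [List.mem_cons, List.not_mem_nil, or_false, not_or] at hr
      simp [hr]
    · intro k h1 h2
      simp at h2; omega
  · rintro s' T' ⟨-, -, h1, h2, h3, -⟩
    omega
  · rintro s' T' ⟨hs, h4, h5, h6, h7, h8⟩ he
    simp only [Expr.ev, ne_eq, indic_eq_zero, not_not, hs.reg 2 (by simp), h2] at he
    simp only [wp, Expr.ev, reg_setBit]
    refine ⟨h5, by omega, ⟨?_, hs.arr, ?_, hs.log⟩, by simp [h4], by simp, by simp; omega,
      by simp; omega, ?_⟩
    · intro r hr
      have := hs.reg r hr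
      simp only [List.mem_cons, List.not_mem_nil, or_false, not_or] at hr
      simp [hr, this]
    · intro a ha
      have := hs.wrd a ha
      simp only [List.mem_singleton] at ha
      simp [ha, this]
    · intro k hk hk'
      simp only [reg_setReg, ↓reduceIte] at hk'
      rw [bit_setReg, bit_setBit _ _ _ _ _ _ _ _ hlam h5 hk]
      split_ifs with h
      · rfl
      · exact h8 k hk (by omega)
  rintro s1 T1 ⟨hs1, h4, h5, h6, h7, h8⟩ he
  simp only [Expr.ev, indic_eq_zero, hs1.reg 2 (by simp), h2] at he
  refine ⟨by omega, ?_⟩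
  apply wp_loop (I := fun s' T' => s.Same [19, 20] [] [6] s' ∧ s'.reg 19 = 1 ∧ 1 ≤ s'.reg 20 ∧
      s'.reg 20 ≤ s.reg 18 ∧ T' + 3 ≤ T + 3 * lam + 3 * s'.reg 20 + 4 ∧
      ∀ k, 1 ≤ k → (k - 1) / lam < s'.reg 20 → s'.bit 6 0 k = true)
      (M := T + 3 * lam + 3 * s.reg 18 + 4)
  · refine ⟨⟨?_, hs1.arr, hs1.wrd, hs1.log⟩, by simp [h4], by simp, ?_,
      by simp; omega, ?_⟩
    · intro r hr
      have := hs1.reg r hr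
      simp only [List.mem_cons, List.not_mem_nil, or_false, not_or] at hr
      simp [hr, this]
    · rw [reg_setReg, if_pos rfl, h18]
      exact Nat.le_add_left _ _
    · intro k h1 h2
      rw [reg_setReg, if_pos rfl, Nat.lt_one_iff, Nat.div_eq_zero_iff] at h2
      rw [bit_setReg]
      exact h8 k h1 (by omega)
  · rintro s' T' ⟨-, -, h1, h2, h3, -⟩
    omega
  · rintro s' T' ⟨hs, h4, h5, h6, h7, h8⟩ he
    simp only [Expr.ev, ne_eq, indic_eq_zero, not_not, hs.reg 18 (by simp)] at he
    simp only [wp, Expr.ev, reg_setWrd, WExpr.eval, Expr.eval]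
    refine ⟨by omega, ⟨?_, hs.arr, ?_, hs.log⟩, by simp [h4], by simp, by simp; omega,
      by simp; omega, ?_⟩
    · intro r hr
      have := hs.reg r hr
      simp only [List.mem_cons, List.not_mem_nil, or_false, not_or] at hr
      simp [hr, this]
    · intro a ha
      have := hs.wrd a ha
      simp only [List.mem_singleton] at ha
      simp [ha, this]
    · intro k hk hk'
      simp only [reg_setReg, ↓reduceIte] at hk'
      rw [bit_setReg]
      rcases Nat.lt_or_ge ((k - 1) / lam) (s'.reg 20) with h | h
      · rw [bit_setWrd, if_neg (by omega)]
        exact h8 k hk h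
      · refine bit_setWrd_row hlam (fun k h1 h2 => h8 k h1 ?_) (by omega)
        rw [Nat.div_eq_of_lt (by omega)]
        omega
  rintro s2 T2 ⟨hs2, h4, h5, h6, h7, h8⟩ he
  simp only [Expr.ev, indic_eq_zero, hs2.reg 18 (by simp)] at he
  refine ⟨by omega, ?_⟩
  apply wp_loop (I := fun s' T' => s.Same [19, 20] [] [6] s' ∧ s'.reg 19 = 1 ∧ 1 ≤ s'.reg 20 ∧
      s'.reg 20 ≤ s.reg 3 + 1 ∧ T' + 3 ≤ T + 3 * lam + 3 * s.reg 18 + 3 * s'.reg 20 + 6 ∧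
      ∀ w : Fin n₂, s'.bit 6 0 (w.val + 1) = true ↔
        ¬ (1 ≤ s.arr 4 (w.val + 1) 0 ∧ s.arr 4 (w.val + 1) 0 < s'.reg 20))
      (M := T + 3 * lam + 3 * s.reg 18 + 3 * s.reg 3 + 6)
  · refine ⟨⟨?_, hs2.arr, hs2.wrd, hs2.log⟩, by simp [h4], by simp, by simp,
      by simp; omega, ?_⟩
    · intro r hr
      have := hs2.reg r hr
      simp only [List.mem_cons, List.not_mem_nil, or_false, not_or] at hr
      simp [hr, this]
    · intro w
      rw [bit_setReg, h8 (w.val + 1) (by omega)]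
      · simp
        omega
      · have : w.val / lam ≤ n₂ / lam := Nat.div_le_div_right w.2.le
        simp only [Nat.add_sub_cancel]
        omega
  · rintro s' T' ⟨-, -, h1, h2, h3, -⟩
    omega
  · rintro s' T' ⟨hs, h4, h5, h6, h7, h8⟩ he
    simp only [Expr.ev, ne_eq, indic_eq_zero, not_not, hs.reg 3 (by simp)] at he
    obtain ⟨w₀, e1, e2⟩ := hM.idx₂ (s'.reg 20) h5 (by omega)
    simp only [wp, Expr.ev, reg_setBit, hs.arr 6 (by simp), e1]
    refine ⟨by omega, by omega, ⟨?_, hs.arr, ?_, hs.log⟩, by simp [h4], by simp, by simp; omega,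
      by simp; omega, ?_⟩
    · intro r hr
      have := hs.reg r hr
      simp only [List.mem_cons, List.not_mem_nil, or_false, not_or] at hr
      simp [hr, this]
    · intro a ha
      have := hs.wrd a ha
      simp only [List.mem_singleton] at ha
      simp [ha, this]
    · intro w
      rw [bit_setReg, bit_setBit _ _ _ _ _ _ _ _ hlam (by omega) (by omega)]
      simp only [reg_setReg, ↓reduceIte, true_and]
      split_ifs with h
      · obtain rfl : w = w₀ := Fin.ext (by omega)
        simp only [false_iff, not_not]
        omega
      · rw [h8 w]
        have : s.arr 4 (w.val + 1) 0 ≠ s'.reg 20 := by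
          intro e
          have h9 := hM.idx₂_inj (w := w) (w' := w₀) (by rw [← hM.ne₂]; omega) (by omega)
          exact h (by rw [h9])
        omega
  rintro s3 T3 ⟨hs3, h4, h5, h6, h7, h8⟩ he
  simp only [Expr.ev, indic_eq_zero, hs3.reg 3 (by simp)] at he
  refine hQ s3 _ hs3 h4 (by omega) fun w => ?_
  have h9 := hM.le₂ w
  have h10 := hM.ne₂ w
  rw [h8]
  constructor
  · intro h
    by_contra hc
    exact h ⟨Nat.one_le_iff_ne_zero.2 (h10.2 hc), by omega⟩
  · intro h hc
    exact h10.1 (by omega) h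

/-- The time for searching in a list is at most proportional to this number. -/
def searchCost (A : AdjLists E) (κ D : ℕ) (i : ℕ) : ℕ :=
  min (row A.outList (i + 1)).length (min κ D)

theorem row_succ {n n' : ℕ} (L : Fin n → List (Fin n')) (u : Fin n) : row L (u.val + 1) = L u := by
  simp [row]

/-- The list loop passes only matched nodes, so it is bounded by the degree, by κ and by the cutoff
`[18]`. The row of free nodes is set up at most once; the flag `[19]` acts as a potential of `6 *
n₁` that pays for this. -/
theorem wp_findFree (hlam : 0 < lam) {A : AdjLists E} {s : Store lam} {T : ℕ}
    {par : Parents n₁ n₂} {u : Fin n₁} {κ : ℕ} (hI : Input A s) (hM : TreeRep E s par)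
    (hκ : (matched₂ par).card ≤ κ) (h3 : s.reg 3 ≤ κ) (hκ1 : κ ≤ n₁)
    (hl1 : lam ≤ n₁) (h18 : s.reg 18 = n₂ / lam + 1) (hN : n₁ + n₂ + 2 ≤ N)
    (hN2 : s.reg 18 * lam ≤ N) (h19 : s.reg 19 ≤ 1)
    (hfree : s.reg 19 = 1 → ∀ w : Fin n₂, s.bit 6 0 (w.val + 1) = true ↔ IsWT1 par w)
    (hu : s.reg 16 = u.val + 1)
    {Q : Store lam → ℕ → Prop}
    (hQ : ∀ s' T', s.Same [7, 8, 9, 10, 11, 19, 20] [] [6] s' → s'.reg 19 ≤ 1 →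
      s.reg 19 ≤ s'.reg 19 →
      T' + (6 * n₁) * s.reg 19 ≤
        T + (6 * n₁) * s'.reg 19 + 9 * searchCost A κ (s.reg 18) u + 30 →
      (s'.reg 19 = 1 → ∀ w : Fin n₂, s'.bit 6 0 (w.val + 1) = true ↔ IsWT1 par w) →
      ((s'.reg 7 = 0 ∧ ∀ w, (u, w) ∈ E → ¬ IsWT1 par w) ∨
        ∃ w, (u, w) ∈ E ∧ IsWT1 par w ∧ s'.reg 7 = w.val + 1) → Q s' T') :
    wp N findFree Q s T := by
  have hD : n₂ / lam ≤ n₂ := Nat.div_le_self _ _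
  have hnd := A.outList_nodup u
  simp only [findFree, wp, Expr.ev]
  refine ⟨by omega, ?_⟩
  apply wp_loop (I := fun s' T' => s.Same [20] [] [] s' ∧
      Skipped (A.outList u) (matched₂ par) (s'.reg 20) ∧ s'.reg 20 ≤ s.reg 18 ∧
      T' ≤ T + 2 * s'.reg 20 + 1) (M := T + 2 * s.reg 18 + 1)
  · refine ⟨⟨?_, fun _ _ => rfl, fun _ _ => rfl, rfl⟩, ?_, by simp, by simp⟩
    · intro r hr
      simp only [List.mem_singleton] at hr
      simp [hr]
    · intro i hi
      simp at hi
  · rintro s' T' ⟨-, -, h1, h2⟩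
    omega
  · rintro s' T' ⟨hs, h1, h2, h4⟩ he
    simp only [Expr.ev, ne_eq, mul_eq_zero, indic_eq_zero, not_or, not_not, hs.reg 18 (by simp),
      hs.reg 16 (by simp), hs.arr 0 (by simp), hs.arr 4 (by simp), hu, hI.out] at he
    obtain ⟨he1, he2, he3⟩ := he
    rcases entry_cases (A.outList u) (s'.reg 20) with ⟨h5, -⟩ | ⟨w, hw, h5, h6⟩
    · exact absurd h5 he2
    rw [h5] at he3
    have h7 := h1.succ (mem_matched₂.2 ((hM.ne₂ w).1 he3)) h6
    simp only [wp, Expr.ev]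
    refine ⟨by omega, ⟨?_, hs.arr, hs.wrd, hs.log⟩, by simpa using h7, by simp; omega,
      by simp; omega⟩
    intro r hr
    have := hs.reg r hr
    simp only [List.mem_singleton] at hr
    simp [hr, this]
  rintro s1 T1 ⟨hs1, h1, h2, h4⟩ he
  simp only [Expr.ev, mul_eq_zero, indic_eq_zero, hs1.reg 18 (by simp),
    hs1.reg 16 (by simp), hs1.arr 0 (by simp), hs1.arr 4 (by simp), hu, hI.out] at he
  have hcost : s1.reg 20 ≤ searchCost A κ (s.reg 18) u := by
    rw [searchCost, row_succ]
    have := h1.le_length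
    have := h1.le_card hnd
    omega
  refine ⟨fun hlt => ?_, fun hge => ?_⟩
  · rw [ne_eq, indic_eq_zero, not_not, hs1.reg 18 (by simp)] at hlt
    rw [hs1.reg 16 (by simp), hs1.arr 0 (by simp), hu, hI.out]
    have hQ' : ∀ v, ((v = 0 ∧ ∀ w, (u, w) ∈ E → ¬ IsWT1 par w) ∨
        ∃ w, (u, w) ∈ E ∧ IsWT1 par w ∧ v = w.val + 1) → Q (s1.setReg 7 v) (T1 + 1 + 1 + 1) := by
      intro v hv
      refine hQ _ _ ⟨?_, hs1.arr, fun a _ => hs1.wrd a (by simp), hs1.log⟩ ?_ ?_ ?_ ?_ ?_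
      · intro r hr
        simp only [List.mem_cons, List.not_mem_nil, or_false, not_or] at hr
        have := hs1.reg r (by simp [hr])
        simp [hr, this]
      · simp [hs1.reg 19 (by simp), h19]
      · simp [hs1.reg 19 (by simp)]
      · simp [hs1.reg 19 (by simp)]; omega
      · intro h w
        rw [bit_setReg, bit_congr (hs1.wrd 6 (by simp))]
        exact hfree (by simpa [hs1.reg 19 (by simp)] using h) w
      · simpa using hv
    rcases entry_cases (A.outList u) (s1.reg 20) with ⟨h5, h6⟩ | ⟨w, hw, h5, h6⟩
    · refine ⟨by omega, hQ' _ (Or.inl ⟨h5, fun w hw => ?_⟩)⟩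
      exact mem_matched₂.1 (h1.forall_mem h6 w ((A.mem_outList u w).2 hw))
    · refine ⟨by omega, hQ' _ (Or.inr ⟨w, (A.mem_outList u w).1 hw, ?_, h5⟩)⟩
      rw [h5] at he
      by_contra hc
      have := (hM.ne₂ w).2 hc
      rcases he with he | he | he
      · exact he hlt
      · omega
      · exact this he
  · rw [indic_eq_zero, hs1.reg 18 (by simp)] at hge
    -- The word search is the same whether the row of free nodes existed before or has just been
    -- built.
    have hscan : ∀ (s2 : Store lam) (T2 : ℕ), s.Same [19, 20] [] [6] s2 → s2.reg 19 = 1 →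
        (∀ w : Fin n₂, s2.bit 6 0 (w.val + 1) = true ↔ IsWT1 par w) →
        T2 + (6 * n₁) * s.reg 19 ≤
          T + (6 * n₁) * s2.reg 19 + 5 * searchCost A κ (s.reg 18) u + 15 →
        wp N (.assign 9 (ʀ 16) ;; .assign 10 (ᴄ 0) ;; .assign 11 (ʀ 18) ;; scan 0 6) Q s2 T2 := by
      intro s2 T2 hs2 h19 hb hT
      simp only [wp, Expr.ev, reg_setReg, Nat.reduceEqDiff, ↓reduceIte, hs2.reg 16 (by simp), hu,
        hs2.reg 18 (by simp)]
      refine ⟨by omega, by omega, by omega, wp_scan hlam ?_ ?_ ?_⟩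
      · simp [hs2.reg 2 (by simp), hI.reg2]
      · simpa using hN2
      intro s3 T3 hs3 hT3 hres
      simp only [reg_setReg, Nat.reduceEqDiff, ↓reduceIte, bit_setReg] at hres hT3
      have r19 : s3.reg 19 = 1 := by rw [hs3.reg 19 (by simp)]; simpa using h19
      refine hQ s3 T3 ⟨?_, ?_, ?_, ?_⟩ ?_ ?_ ?_ ?_ ?_
      · intro r hr
        simp only [List.mem_cons, List.not_mem_nil, or_false, not_or] at hr
        rw [hs3.reg r (by simp [hr])]
        simp [hr, hs2.reg]
      · intro a _
        rw [hs3.arr a (by simp)]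
        simp [hs2.arr]
      · intro a ha
        rw [hs3.wrd a (by simp)]
        simp only [List.mem_singleton] at ha
        simp [hs2.wrd, ha]
      · rw [hs3.log]
        simp [hs2.log]
      · omega
      · omega
      · rw [r19]
        rw [h19] at hT
        -- The list loop has run up to its cutoff, so `searchCost` is at least the number of words
        -- and pays for the scan.
        have hcost' : s.reg 18 ≤ searchCost A κ (s.reg 18) u := by omega
        omega
      · intro _ w
        rw [bit_congr (hs3.wrd 6 (by simp)), bit_setReg, bit_setReg, bit_setReg, hb w]
      · have b0 : ∀ k, s2.bit 0 (u.val + 1) k = s.bit 0 (u.val + 1) k :=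
          fun k => bit_congr (hs2.wrd 0 (by simp)) _ _
        rcases hres with ⟨h5, h6⟩ | ⟨h5, h6, h7⟩
        · refine Or.inl ⟨h5, fun w hw hwt => h6 (w.val + 1) (by omega) ?_ ⟨?_, ?_⟩⟩
          · have : w.val / lam ≤ n₂ / lam := Nat.div_le_div_right w.2.le
            simp only [Nat.add_sub_cancel]
            omega
          · rw [b0, hI.bit _ _ (by omega)]
            exact ⟨w, rfl, hw⟩
          · rw [hb]; exact hwt
        · rw [b0, hI.bit _ _ h5] at h6
          obtain ⟨w, h8, h9⟩ := h6
          rw [h8, hb] at h7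
          exact Or.inr ⟨w, h9, h7, h8⟩
    refine ⟨fun h => ?_, fun h => ?_⟩
    · rw [hs1.reg 19 (by simp)] at h
      have h19' : s.reg 19 = 1 := by omega
      refine hscan s1 _ (hs1.mono (by simp) (by simp) (by simp)) ?_ ?_ ?_
      · rw [hs1.reg 19 (by simp), h19']
      · intro w
        rw [bit_congr (hs1.wrd 6 (by simp))]
        exact hfree h19' w
      · rw [hs1.reg 19 (by simp)]; omega
    · rw [hs1.reg 19 (by simp)] at h
      refine wp_initFree hlam (E := E) (par := par) (hM.congr (hs1.reg 3 (by simp))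
        (fun a _ _ => hs1.arr a (by simp)) (hs1.wrd 2 (by simp)) (hs1.wrd 3 (by simp)))
        ?_ hl1 ?_ ?_ hN ?_
      · rw [hs1.reg 2 (by simp), hI.reg2]
      · rw [hs1.reg 18 (by simp), h18]
      · rw [hs1.reg 3 (by simp)]; omega
      intro s2 T2 hs2 h19' hT2 hb
      rw [hs1.reg 18 (by simp), hs1.reg 3 (by simp)] at hT2
      refine hscan s2 T2 ((hs1.mono (by simp) (by simp) (by simp)).trans hs2) h19' hb ?_
      rw [h, h19']
      omega

end FindFree

/-- The node `[16]` becomes a child of the node `[7]`, which had none. -/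
def greedyMerge : Cmd :=
  .emit (.merge (ʀ 16) (ʀ 7)) ;; .assign 4 (ʀ 16) ;; .assign 5 (ʀ 7) ;; .assign 12 (ᴄ 1) ;;
  .write 12 (ᴄ 1) (ᴄ 0) (ʀ 16) ;; .write 13 (ᴄ 1) (ᴄ 0) (ʀ 7) ;; augmentPath ;;
  .setBit 6 (ᴄ 0) (ʀ 5) false

/-- The greedy initialization. -/
def greedy : Cmd :=
  .assign 18 (ʀ 1 /ₑ ʀ 2 +ₑ ᴄ 1) ;; .assign 16 (ᴄ 1) ;;
  .loop (ʀ 16 <ₑ ʀ 0 +ₑ ᴄ 1)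
    (findFree ;; .ite (ʀ 7) greedyMerge .skip ;; .assign 16 (ʀ 16 +ₑ ᴄ 1))

section Greedy

variable {n₁ n₂ lam N : ℕ} {E : Finset (Fin n₁ × Fin n₂)}

theorem twoEdgeLabel_none_inr (w : Fin n₂) :
    twoEdgeLabel E (fun _ => none) (.inr w) = 0 :=
  twoEdgeLabel_inr_eq_zero.2 fun _ => by simp

theorem twoEdgeLabel_none_inl {u : Fin n₁} (h : ∃ w, (u, w) ∈ E) :
    twoEdgeLabel E (fun _ => none) (.inl u) = 1 := by
  obtain ⟨w, hw⟩ := h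
  refine le_antisymm ?_ (le_twoEdgeLabel fun k hk => ?_)
  · simpa [twoEdgeLabel_none_inr] using twoEdgeLabel_inl_le (par := fun _ => none) hw
  · cases hk
    push_cast
    exact le_add_self

theorem stage_initial (hn : 1 ≤ n₁) (h : ∀ u : Fin n₁, ∃ w, (u, w) ∈ E) :
    (State.initial E).stage = 1 := by
  have : Nonempty (Fin n₁) := ⟨⟨0, hn⟩⟩
  have h1 : ∀ u : Fin n₁, twoEdgeLabel E (fun _ => none) (.inl u) = 1 :=
    fun u => twoEdgeLabel_none_inl (h u)
  simp [State.initial, State.layered, IsST1, h1]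

/-- The situation after the first nodes of `V₁` have been treated by the greedy initialization. -/
structure GreedyInv (A : AdjLists E) (s : Store lam) (par : Parents n₁ n₂)
    (visited : Set (Fin n₂)) : Prop where
  reached : Reached E s.log
    ⟨par, (State.initial E).label, (State.initial E).stage, visited, []⟩
  inv : StageInv E par (State.initial E).label (State.initial E).stage visited
  input : Input A s
  tree : TreeRep E s par
  zero : ∀ a, 8 ≤ a → a ≤ 10 → ∀ i j, s.arr a i j = 0
  layers : ∀ p c, 1 ≤ c → s.bit 4 p c = false
  unl : ∀ c, s.bit 5 0 c = false

/-- A greedy merger is a successful path with a single frame: in the initial network all V₂-labels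
are `0` and all V₁-labels are `1`. The code for augmentations is therefore reused, and the row of
free nodes loses one bit. -/
theorem wp_greedyMerge (hlam : 0 < lam) {A : AdjLists E} {s : Store lam} {T : ℕ}
    {par : Parents n₁ n₂} {visited : Set (Fin n₂)} {u : Fin n₁} {w : Fin n₂}
    (hn : 1 ≤ n₁) (hne : ∀ u : Fin n₁, ∃ w, (u, w) ∈ E)
    (h : GreedyInv A s par visited) (hN : n₁ + n₂ + 2 ≤ N)
    (hu : s.reg 16 = u.val + 1) (hw : s.reg 7 = w.val + 1) (huw : (u, w) ∈ E)
    (hpu : par u = none) (hpw : IsWT1 par w)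
    (hfree : s.reg 19 = 1 → ∀ w : Fin n₂, s.bit 6 0 (w.val + 1) = true ↔ IsWT1 par w)
    {Q : Store lam → ℕ → Prop}
    (hQ : ∀ s' T' visited', GreedyInv A s' (Function.update par u (some w)) visited' →
      s'.reg 3 = s.reg 3 + 1 → T' ≤ T + 17 * matchingNumber E + 15 → s'.reg 16 = s.reg 16 →
      s'.reg 18 = s.reg 18 → s'.reg 19 = s.reg 19 →
      (s.reg 19 = 1 → ∀ w' : Fin n₂, s'.bit 6 0 (w'.val + 1) = true ↔
        IsWT1 (Function.update par u (some w)) w') → Q s' T') :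
    wp N greedyMerge Q s T := by
  have hstage := stage_initial hn hne
  have hs : (State.initial E).stage ≠ ⊤ := by rw [hstage]; simp
  have hlw : (State.initial E).label (.inr w) = 0 := twoEdgeLabel_none_inr w
  have hlu : (State.initial E).label (.inl u) = 1 := twoEdgeLabel_none_inl (hne u)
  have ha : State.MergerArc E
      ⟨par, (State.initial E).label, (State.initial E).stage, visited, []⟩ u w :=
    ⟨⟨hpu, hs, hlu.trans hstage.symm⟩, huw, (h.inv.wt w hpw).2, by
      change (State.initial E).label _ = (State.initial E).label _ + 1
      rw [hlu, hlw, zero_add]⟩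
  have hch := MergeChain.cons_of_mergerArc h.inv hs .nil ha
  have hinv := hch.stageInv_success h.inv hs hlw
  have hflip := hch.flipSpec h.inv hs hlw (f₀ := ⟨u, par u, w⟩) rfl
  have hcard := card_treeEdges_le hinv.edge hinv.inj
  have hκ : matchingNumber E ≤ n₁ := matchingNumber_le_left
  have hr := h.reached.augment ha hlw
  simp only [greedyMerge, wp, Expr.ev, reg_setReg, reg_setArr, reg_addLog, Nat.reduceEqDiff,
    ↓reduceIte, hu, hw]
  refine ⟨by omega, by omega, by omega, by omega, by omega, ?_⟩
  refine wp_augmentPath hlam (A := A) (fs := [⟨u, par u, w⟩]) (par := par)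
    (h.input.congr ?_ ?_ ?_) (h.tree.congr ?_ ?_ ?_ ?_) hflip ?_ ?_ ?_ ?_ (hcard.trans hκ) hN ?_
  · intro r hr
    simp [show r ≠ 12 by omega, show r ≠ 5 by omega, show r ≠ 4 by omega]
  · intro a ha
    simp [show a ≠ 13 by omega, show a ≠ 12 by omega]
  · simp
  · simp
  · intro a h1 h2
    simp [show a ≠ 13 by omega, show a ≠ 12 by omega]
  · simp
  · simp
  · simp
  · simp [StackRep]
  · simp
  · simp
  intro s' T' hs' hT' h12 htree h4 h4' h6 hbit
  have r5 : s'.reg 5 = w.val + 1 := by rw [hs'.reg 5 (by simp)]; simp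
  rw [r5]
  refine ⟨by omega, hQ _ _ _ ⟨?_, hinv, h.input.congr ?_ ?_ ?_, htree.congr rfl (fun _ _ _ => rfl)
    ?_ ?_, ?_, ?_, ?_⟩ ?_ ?_ ?_ ?_ ?_ ?_⟩
  · rw [log_setBit, hs'.log]
    simpa [Op.map, Expr.ev, hu, hw] using hr
  · intro r hr
    rw [reg_setBit, hs'.reg r (by simp; omega)]
    simp [show r ≠ 12 by omega, show r ≠ 5 by omega, show r ≠ 4 by omega]
  · intro a ha
    rw [arr_setBit, hs'.arr a (by simp; omega)]
    simp [show a ≠ 13 by omega, show a ≠ 12 by omega]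
  · rw [wrd_setBit_ne _ _ _ _ (by simp), hs'.wrd 0 (by simp)]
    simp
  · simp
  · simp
  · intro a h1 h2 i j
    rw [arr_setBit, hs'.arr a (by simp; omega)]
    simp [show a ≠ 13 by omega, show a ≠ 12 by omega, h.zero a h1 h2]
  · intro p c hc
    have := hbit p c hc
    simp only [bit_setArr, bit_setReg, bit_addLog, h.layers p c hc] at this
    rw [bit_setBit_ne _ _ _ _ (by simp)]
    simpa using this
  · intro c
    rw [bit_setBit_ne _ _ _ _ (by simp), bit_congr (hs'.wrd 5 (by simp))]
    simp [h.unl c]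
  · rw [reg_setBit, htree.card, h.tree.card, hflip.card]
  · omega
  · simp [hs'.reg 16]
  · simp [hs'.reg 18]
  · simp [hs'.reg 19]
  · intro h19 w'
    rw [bit_setBit _ _ _ _ _ _ _ _ hlam (by omega) (by omega), bit_congr (hs'.wrd 6 (by simp)),
      hflip.wt_iff]
    simp only [true_and, Nat.add_right_cancel_iff, ← Fin.ext_iff, bit_setArr, bit_setReg,
      bit_addLog]
    split_ifs with hww
    · simp [hww]
    · simp [hww, hfree h19 w']

/-- A treated node without parent had no free neighbour when it was treated, and free nodes only
disappear. So one pass over V₁ exhausts stage 1. -/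
theorem wp_greedy (hlam : 0 < lam) {A : AdjLists E} {s : Store lam} {T : ℕ}
    (hn : 1 ≤ n₁) (hl1 : lam ≤ n₁) (hne : ∀ u : Fin n₁, ∃ w, (u, w) ∈ E)
    (h : GreedyInv A s (fun _ => none) ∅) (hN : 2 * (n₁ + n₂ + 1) ≤ N)
    (h19 : s.reg 19 = 0) {Q : Store lam → ℕ → Prop}
    (hQ : ∀ s' T' par visited, GreedyInv A s' par visited →
      (∀ u w, ¬ State.MergerArc E
        ⟨par, (State.initial E).label, (State.initial E).stage, visited, []⟩ u w) →
      T' ≤ T + ∑ j ∈ Finset.range n₁,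
        (9 * searchCost A (matchingNumber E) (n₂ / lam + 1) j + 50) + 6 * n₁ +
        17 * matchingNumber E * matchingNumber E + 3 → Q s' T') :
    wp N greedy Q s T := by
  have hD : n₂ / lam ≤ n₂ := Nat.div_le_self _ _
  have hDl : (n₂ / lam + 1) * lam ≤ n₂ + lam := by
    rw [Nat.succ_mul]; exact Nat.add_le_add_right (Nat.div_mul_le_self _ _) _
  have hκ : matchingNumber E ≤ n₁ := matchingNumber_le_left
  set f := fun j => 9 * searchCost A (matchingNumber E) (n₂ / lam + 1) j + 50 with hf
  simp only [greedy, wp, Expr.ev, reg_setReg, Nat.reduceEqDiff, ↓reduceIte, h.input.reg1,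
    h.input.reg2]
  refine ⟨by omega, by omega, ?_⟩
  apply wp_loop (I := fun s' T' => ∃ par visited, GreedyInv A s' par visited ∧
      1 ≤ s'.reg 16 ∧ s'.reg 16 ≤ n₁ + 1 ∧ s'.reg 18 = n₂ / lam + 1 ∧ s'.reg 19 ≤ 1 ∧
      (s'.reg 19 = 1 → ∀ w : Fin n₂, s'.bit 6 0 (w.val + 1) = true ↔ IsWT1 par w) ∧
      (∀ u : Fin n₁, s'.reg 16 ≤ u.val + 1 → par u = none) ∧
      (∀ u : Fin n₁, u.val + 1 < s'.reg 16 → par u = none →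
        ∀ w, (u, w) ∈ E → ¬ IsWT1 par w) ∧
      T' ≤ T + ∑ j ∈ Finset.range (s'.reg 16 - 1), f j + 6 * n₁ * s'.reg 19 +
        17 * matchingNumber E * s'.reg 3 + 2)
    (M := T + ∑ j ∈ Finset.range n₁, f j + 6 * n₁ + 17 * matchingNumber E * matchingNumber E + 2)
  · refine ⟨fun _ => none, ∅, ⟨h.reached, h.inv, h.input.congr ?_ (fun _ _ => rfl) rfl,
      h.tree.congr (by simp) (fun _ _ _ => rfl) rfl rfl, h.zero, h.layers, h.unl⟩, by simp, by simp,
      by simp, by simp [h19], by simp [h19], by simp, by simp, by simp; omega⟩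
    intro r hr
    simp [show r ≠ 16 by omega, show r ≠ 18 by omega]
  · rintro s' T' ⟨par, visited, hG, h1, h2, -, h3, -, -, -, h4⟩
    have e1 : ∑ j ∈ Finset.range (s'.reg 16 - 1), f j ≤ ∑ j ∈ Finset.range n₁, f j :=
      Finset.sum_le_sum_of_subset (Finset.range_mono (by omega))
    have e2 : 17 * matchingNumber E * s'.reg 3 ≤ 17 * matchingNumber E * matchingNumber E := by
      gcongr
      rw [hG.tree.card]
      exact card_treeEdges_le hG.inv.edge hG.inv.inj
    have e3 : 6 * n₁ * s'.reg 19 ≤ 6 * n₁ * 1 := by gcongr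
    omega
  · rintro s' T' ⟨par, visited, hG, h1, h2, h18, h3, hfree, hpar, hdone, h4⟩ he
    simp only [Expr.ev, ne_eq, indic_eq_zero, not_not, hG.input.reg0] at he
    obtain ⟨u, hu⟩ : ∃ u : Fin n₁, s'.reg 16 = u.val + 1 :=
      ⟨⟨s'.reg 16 - 1, by omega⟩, by simp; omega⟩
    have hcard := card_treeEdges_le hG.inv.edge hG.inv.inj
    have hpu := hpar u hu.le
    simp only [wp]
    refine wp_findFree hlam (A := A) (u := u) (κ := matchingNumber E) hG.input hG.tree ?_ ?_ hκ hl1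
      h18 (by omega) ?_ h3 hfree hu ?_
    · rw [matched₂, card_image_snd_treeEdges hG.inv.inj]
      exact hcard
    · rw [hG.tree.card]; exact hcard
    · rw [h18]; omega
    intro s1 T1 hs1 h5 h6 h7 h8 h9
    rw [h18] at h7
    have hfu : f u.val = 9 * searchCost A (matchingNumber E) (n₂ / lam + 1) u + 50 := rfl
    have hsum : ∑ j ∈ Finset.range (s'.reg 16 + 1 - 1), f j =
        ∑ j ∈ Finset.range (s'.reg 16 - 1), f j + f u.val := by
      rw [Nat.add_sub_cancel, hu, Finset.sum_range_succ, Nat.add_sub_cancel]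
    have hG1 : GreedyInv A s1 par visited := by
      refine ⟨by rw [hs1.log]; exact hG.reached, hG.inv, hG.input.congr ?_ ?_ (hs1.wrd 0 (by simp)),
        hG.tree.congr (hs1.reg 3 (by simp)) (fun a _ _ => hs1.arr a (by simp))
          (hs1.wrd 2 (by simp)) (hs1.wrd 3 (by simp)), ?_, ?_, ?_⟩
      · exact fun r hr => hs1.reg r (by simp; omega)
      · exact fun a _ => hs1.arr a (by simp)
      · intro a h1 h2 i j
        rw [hs1.arr a (by simp), hG.zero a h1 h2]
      · intro p c hc
        rw [bit_congr (hs1.wrd 4 (by simp)), hG.layers p c hc]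
      · intro c
        rw [bit_congr (hs1.wrd 5 (by simp)), hG.unl c]
    have r16 := hs1.reg 16 (by simp)
    have r18 := hs1.reg 18 (by simp)
    have r3 := hs1.reg 3 (by simp)
    refine ⟨fun h => ?_, fun h => ?_⟩
    · rcases h9 with ⟨h9, -⟩ | ⟨w, hw1, hw2, hw3⟩
      · exact absurd h9 h
      refine wp_greedyMerge hlam hn hne hG1 (by omega) (r16.trans hu) hw3 hw1 hpu hw2 h8 ?_
      intro s2 T2 visited' hG2 q3 qT q16 q18 q19 hb
      -- Nodes free after the merger were free before it, which preserves the statement about the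
      -- nodes treated earlier.
      have hflip : ∀ w', IsWT1 (Function.update par u (some w)) w' → IsWT1 par w' := by
        intro w' h u' hu'
        refine h u' ?_
        rw [Function.update_of_ne, hu']
        rintro rfl
        rw [hpu] at hu'
        simp at hu'
      simp only [wp, Expr.ev]
      refine ⟨by omega, _, visited', ⟨hG2.reached, hG2.inv, hG2.input.congr ?_ (fun _ _ => rfl) rfl,
        hG2.tree.congr (by simp) (fun _ _ _ => rfl) rfl rfl, hG2.zero, hG2.layers, hG2.unl⟩, ?_⟩
      · intro r hr
        simp [show r ≠ 16 by omega]
      simp only [reg_setReg, Nat.reduceEqDiff, ↓reduceIte, q16, r16, q18, r18, q19, bit_setReg]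
      refine ⟨by omega, by omega, h18, h5, fun h => hb h, ?_, ?_, ?_⟩
      · intro u' hu'
        rw [Function.update_of_ne, hpar u' (by omega)]
        rintro rfl
        omega
      · intro u' hu' hpu' w' hw' hwt
        have hne' : u' ≠ u := by
          rintro rfl
          simp at hpu'
        rw [Function.update_of_ne hne'] at hpu'
        refine hdone u' ?_ hpu' w' hw' (hflip w' hwt)
        have : u'.val ≠ u.val := fun e => hne' (Fin.ext e)
        omega
      · rw [hsum, hfu, q3, r3]
        have : 17 * matchingNumber E * (s'.reg 3 + 1) =
            17 * matchingNumber E * s'.reg 3 + 17 * matchingNumber E := by ring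
        omega
    · rcases h9 with ⟨-, h9⟩ | ⟨w, -, -, hw3⟩
      swap
      · change s1.reg 7 = 0 at h
        omega
      simp only [wp, Expr.ev]
      refine ⟨by omega, par, visited, ⟨hG1.reached, hG1.inv,
        hG1.input.congr ?_ (fun _ _ => rfl) rfl,
        hG1.tree.congr (by simp) (fun _ _ _ => rfl) rfl rfl, hG1.zero, hG1.layers, hG1.unl⟩, ?_⟩
      · intro r hr
        simp [show r ≠ 16 by omega]
      simp only [reg_setReg, Nat.reduceEqDiff, ↓reduceIte, r16, r18, bit_setReg]
      refine ⟨by omega, by omega, h18, h5, h8, ?_, ?_, ?_⟩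
      · exact fun u' hu' => hpar u' (by omega)
      · intro u' hu' hpu' w' hw'
        by_cases hne' : u' = u
        · exact h9 w' (hne' ▸ hw')
        · refine hdone u' ?_ hpu' w' hw'
          have : u'.val ≠ u.val := fun e => hne' (Fin.ext e)
          omega
      · rw [hsum, hfu, r3]
        omega
  · rintro s' T' ⟨par, visited, hG, h1, h2, h18, h3, hfree, hpar, hdone, h4⟩ he
    simp only [Expr.ev, indic_eq_zero, hG.input.reg0] at he
    refine hQ _ _ par visited hG ?_ ?_
    · rintro u w ⟨⟨hu, -, -⟩, huw, hv, -⟩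
      refine hdone u (by omega) hu w huw (hG.inv.wt' w ?_ hv)
      exact twoEdgeLabel_none_inr w
    · have e0 : s'.reg 16 - 1 = n₁ := by omega
      have e2 : 17 * matchingNumber E * s'.reg 3 ≤ 17 * matchingNumber E * matchingNumber E := by
        gcongr
        rw [hG.tree.card]
        exact card_treeEdges_le hG.inv.edge hG.inv.inj
      have e3 : 6 * n₁ * s'.reg 19 ≤ 6 * n₁ * 1 := by gcongr
      rw [e0] at h4
      have e4 : (Finset.range n₁).sum f = ∑ j ∈ Finset.range n₁, f j := rfl
      omega

end Greedy

/-! ## Computing the labels -/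

section LabelTheory

variable {n₁ n₂ : ℕ} {E : Finset (Fin n₁ × Fin n₂)} {par : Parents n₁ n₂}

/-- A correctness criterion for the labels of `V₂`; the label `0` stands for `⊤` at the nodes that
have a child. -/
theorem twoEdgeLabel_eq_of_feasible {lab : Fin n₂ → ℕ}
    (hsound : ∀ w, lab w ≠ 0 → ResPath E par (.inr w) (lab w))
    (hwt : ∀ w, IsWT1 par w → lab w = 0)
    (hseed : ∀ u w y, par u = some w → (u, y) ∈ E → IsWT1 par y → lab w = 1)
    (hstep : ∀ u w y, par u = some w → (u, y) ∈ E → lab y ≠ 0 → lab w ≠ 0 ∧ lab w ≤ lab y + 1)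
    (w : Fin n₂) :
    (twoEdgeLabel E par (.inr w) = ⊤ ∧ lab w = 0) ∨ twoEdgeLabel E par (.inr w) = lab w := by
  -- Induction along the path shows that the candidate labels never exceed the length, and that
  -- matched nodes which reach a WT₁ branch carry a nonzero label; so `0` is unambiguous.
  have key : ∀ x k, ResPath E par x k →
      Sum.elim (fun u => ∀ w, par u = some w → lab w ≠ 0 ∧ lab w ≤ k)
        (fun w => (IsWT1 par w ∨ lab w ≠ 0) ∧ lab w ≤ k) x := by
    intro x k hp
    induction hp with
    | base hw => exact ⟨Or.inl hw, (hwt _ hw).le⟩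
    | @fromV1 u y k hr hp ih =>
      cases y with
      | inl u' => exact hr.elim
      | inr y =>
        intro w hw
        obtain ⟨h1 | h1, h2⟩ := ih
        · rw [hseed u w y hw hr h1]
          exact ⟨one_ne_zero, by omega⟩
        · obtain ⟨h3, h4⟩ := hstep u w y hw hr h1
          exact ⟨h3, by omega⟩
    | @fromV2 w y k hr hp ih =>
      cases y with
      | inr w' => exact hr.elim
      | inl u =>
        obtain ⟨h1, h2⟩ := ih w hr
        exact ⟨Or.inr h1, h2⟩
  by_cases ht : twoEdgeLabel E par (.inr w) = ⊤
  · refine Or.inl ⟨ht, ?_⟩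
    by_contra hc
    have := twoEdgeLabel_le (hsound w hc)
    rw [ht] at this
    simp at this
  · right
    obtain ⟨k, hk, e⟩ := exists_resPath_of_ne_top ht
    obtain ⟨h1 | h1, h2⟩ := key _ _ hk
    · rw [hwt w h1, twoEdgeLabel_inr_eq_zero.2 h1]; rfl
    · refine le_antisymm (twoEdgeLabel_le (hsound w h1)) ?_
      rw [e]
      exact_mod_cast h2

theorem exists_pred_of_inl {u : Fin n₁} {k : ℕ} (h : ResPath E par (.inl u) k) :
    ∃ w k', (u, w) ∈ E ∧ k = k' + 1 ∧ ResPath E par (.inr w) k' := by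
  cases h with
  | @fromV1 _ y k hr hp =>
    cases y with
    | inl u' => exact hr.elim
    | inr w => exact ⟨w, k, hr, rfl, hp⟩

end LabelTheory

/-! ### Amortized cost of the list pointers -/

section Positions

variable {n₁ n₂ lam N : ℕ} {E : Finset (Fin n₁ × Fin n₂)}

/-- The sum of all positions in the lists. -/
def posSum (n₁ n₂ : ℕ) (s : Store lam) : ℕ :=
  ∑ u : Fin n₁, s.arr 8 (u.val + 1) 0 + ∑ w : Fin n₂, s.arr 9 (w.val + 1) 0

theorem posSum_congr {s s' : Store lam} (h8 : s'.arr 8 = s.arr 8) (h9 : s'.arr 9 = s.arr 9) :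
    posSum n₁ n₂ s' = posSum n₁ n₂ s := by
  rw [posSum, posSum, h8, h9]

@[simp] theorem posSum_setReg {s : Store lam} {x v : ℕ} :
    posSum n₁ n₂ (s.setReg x v) = posSum n₁ n₂ s := rfl

@[simp] theorem posSum_setBit {s : Store lam} {a i k : ℕ} {b : Bool} :
    posSum n₁ n₂ (s.setBit a i k b) = posSum n₁ n₂ s := rfl

theorem card_matched₁ {par : Parents n₁ n₂} :
    (matched₁ par).card = (treeEdges par).card := card_image_fst_treeEdges

theorem card_matched₂ {par : Parents n₁ n₂}
    (hinj : ∀ u u' w, par u = some w → par u' = some w → u = u') :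
    (matched₂ par).card = (treeEdges par).card := card_image_snd_treeEdges hinj

/-- Only the at most κ matched nodes of each side have nonzero pointers, and each pointer has passed
at most κ matched nodes of the other side. -/
theorem PosRep.posSum_le {A : AdjLists E} {s : Store lam} {par : Parents n₁ n₂} {κ : ℕ}
    (h : PosRep A s par) (hinj : ∀ u u' w, par u = some w → par u' = some w → u = u')
    (hκ : (treeEdges par).card ≤ κ) : posSum n₁ n₂ s ≤ 2 * (κ * κ) := by
  have h1 : ∑ u : Fin n₁, s.arr 8 (u.val + 1) 0 ≤ κ * κ := by
    rw [← Finset.sum_subset (Finset.subset_univ (matched₁ par))]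
    · refine (Finset.sum_le_card_nsmul _ _ κ fun u _ => ?_).trans ?_
      · exact ((h.pos₁ u).le_card (A.outList_nodup u)).trans ((card_matched₂ hinj).le.trans hκ)
      · rw [smul_eq_mul, card_matched₁]
        gcongr
    · intro u _ hu
      rw [mem_matched₁, not_not] at hu
      exact h.zero₁ u hu
  have h2 : ∑ w : Fin n₂, s.arr 9 (w.val + 1) 0 ≤ κ * κ := by
    rw [← Finset.sum_subset (Finset.subset_univ (matched₂ par))]
    · refine (Finset.sum_le_card_nsmul _ _ κ fun u _ => ?_).trans ?_
      · exact ((h.pos₂ u).le_card (A.inList_nodup u)).trans (card_matched₁.le.trans hκ)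
      · rw [smul_eq_mul, card_matched₂ hinj]
        gcongr
    · intro u _ hu
      rw [mem_matched₂, not_not] at hu
      exact h.zero₂ u hu
  rw [posSum]
  omega

theorem sum_add_eq_of_eq_off {n : ℕ} {f g : Fin n → ℕ} {i : Fin n} (h : ∀ j, j ≠ i → g j = f j) :
    ∑ j, g j + f i = ∑ j, f j + g i := by
  rw [← Finset.add_sum_erase _ g (Finset.mem_univ i), ← Finset.add_sum_erase _ f (Finset.mem_univ i),
    Finset.sum_congr rfl fun j hj => h j (Finset.ne_of_mem_erase hj)]
  ring

/-- This is the pointer search of one node restated with `posSum` as potential: over the whole run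
these searches cost O(κ²) plus two steps per call. -/
theorem wp_advance₁ {A : AdjLists E} {s : Store lam} {T : ℕ} {par : Parents n₁ n₂} {u : Fin n₁}
    (hI : Input A s) (hM : TreeRep E s par) (hP : PosRep A s par) (hN : n₁ + n₂ + 2 ≤ N)
    (hu : s.reg 6 = u.val + 1) (hpu : par u ≠ none) {Q : Store lam → ℕ → Prop}
    (hQ : ∀ s' T', s.Same [7] [8] [] s' → PosRep A s' par →
      T' + 2 * posSum n₁ n₂ s ≤ T + 2 * posSum n₁ n₂ s' + 2 →
      posSum n₁ n₂ s ≤ posSum n₁ n₂ s' →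
      ((s'.reg 7 = 0 ∧ ∀ w, (u, w) ∈ E → ¬ IsWT1 par w) ∨
        ∃ w, (u, w) ∈ E ∧ IsWT1 par w ∧ s'.reg 7 = w.val + 1) → Q s' T') :
    wp N (advance 0 8 4) Q s T := by
  refine wp_advance (A.outList_nodup u) (S := matched₂ par) (by simp) (by simp) ?_ ?_ ?_ (by omega) ?_
  · intro j
    rw [hu, hI.out]
  · intro x
    rw [hM.ne₂, mem_matched₂]
  · rw [hu]; exact hP.pos₁ u
  intro s' T' hs h1 h2 h3 h4 h5
  rw [hu] at h1 h2 h3 h4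
  have h6 : ∀ u' : Fin n₁, u' ≠ u → s'.arr 8 (u'.val + 1) 0 = s.arr 8 (u'.val + 1) 0 := by
    intro u' hne
    exact h1 _ _ fun h => hne (Fin.ext (by have := h.1; omega))
  have h9 := hs.arr 9 (by simp)
  have hsum := sum_add_eq_of_eq_off (f := fun u : Fin n₁ => s.arr 8 (u.val + 1) 0)
    (g := fun u : Fin n₁ => s'.arr 8 (u.val + 1) 0) h6
  refine hQ s' T' hs ⟨?_, ?_, ?_, ?_⟩ ?_ ?_ ?_
  · intro u'
    by_cases hne : u' = u
    · rw [hne]; exact h2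
    · rw [h6 u' hne]; exact hP.pos₁ u'
  · rw [h9]; exact hP.pos₂
  · intro u' hu'
    rw [h6 u' (by rintro rfl; exact hpu hu')]
    exact hP.zero₁ u' hu'
  · rw [h9]; exact hP.zero₂
  · rw [posSum, posSum, h9]
    omega
  · rw [posSum, posSum, h9]
    omega
  · rcases h5 with ⟨h5, h7⟩ | ⟨x, h5, h7, h8⟩
    · exact Or.inl ⟨h5, fun w hw => mem_matched₂.1 (h7 w ((A.mem_outList u w).2 hw))⟩
    · rw [mem_matched₂, not_not] at h7
      exact Or.inr ⟨x, (A.mem_outList u x).1 h5, h7, h8⟩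

theorem wp_advance₂ {A : AdjLists E} {s : Store lam} {T : ℕ} {par : Parents n₁ n₂} {w : Fin n₂}
    (hI : Input A s) (hM : TreeRep E s par) (hP : PosRep A s par) (hN : n₁ + n₂ + 2 ≤ N)
    (hw : s.reg 6 = w.val + 1) (hpw : ¬ IsWT1 par w) {Q : Store lam → ℕ → Prop}
    (hQ : ∀ s' T', s.Same [7] [9] [] s' → PosRep A s' par →
      T' + 2 * posSum n₁ n₂ s ≤ T + 2 * posSum n₁ n₂ s' + 2 →
      posSum n₁ n₂ s ≤ posSum n₁ n₂ s' →
      ((s'.reg 7 = 0 ∧ ∀ u, (u, w) ∈ E → par u ≠ none) ∨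
        ∃ u, (u, w) ∈ E ∧ par u = none ∧ s'.reg 7 = u.val + 1) → Q s' T') :
    wp N (advance 1 9 3) Q s T := by
  refine wp_advance (A.inList_nodup w) (S := matched₁ par) (by simp) (by simp) ?_ ?_ ?_ (by omega) ?_
  · intro j
    rw [hw, hI.inn]
  · intro x
    rw [hM.ne₁, mem_matched₁]
  · rw [hw]; exact hP.pos₂ w
  intro s' T' hs h1 h2 h3 h4 h5
  rw [hw] at h1 h2 h3 h4
  have h6 : ∀ u' : Fin n₂, u' ≠ w → s'.arr 9 (u'.val + 1) 0 = s.arr 9 (u'.val + 1) 0 := by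
    intro u' hne
    exact h1 _ _ fun h => hne (Fin.ext (by have := h.1; omega))
  have h9 := hs.arr 8 (by simp)
  have hsum := sum_add_eq_of_eq_off (f := fun u : Fin n₂ => s.arr 9 (u.val + 1) 0)
    (g := fun u : Fin n₂ => s'.arr 9 (u.val + 1) 0) h6
  refine hQ s' T' hs ⟨?_, ?_, ?_, ?_⟩ ?_ ?_ ?_
  · rw [h9]; exact hP.pos₁
  · intro u'
    by_cases hne : u' = w
    · rw [hne]; exact h2
    · rw [h6 u' hne]; exact hP.pos₂ u'
  · rw [h9]; exact hP.zero₁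
  · intro u' hu'
    rw [h6 u' (by rintro rfl; exact hpw hu')]
    exact hP.zero₂ u' hu'
  · rw [posSum, posSum, h9]
    omega
  · rw [posSum, posSum, h9]
    omega
  · rcases h5 with ⟨h5, h7⟩ | ⟨x, h5, h7, h8⟩
    · exact Or.inl ⟨h5, fun u hu => mem_matched₁.1 (h7 u ((A.mem_inList w u).2 hu))⟩
    · rw [mem_matched₁, not_not] at h7
      exact Or.inr ⟨x, (A.mem_inList w x).1 h5, h7, h8⟩

end Positions

/-- The representation of the labels and of the unvisited nodes of a stage. -/
structure StageRep {n₁ n₂ lam : ℕ} {E : Finset (Fin n₁ × Fin n₂)} (A : AdjLists E) (s : Store lam)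
    (par : Parents n₁ n₂) (label : Fin n₁ ⊕ Fin n₂ → ℕ∞) (stage : ℕ∞) (visited : Set (Fin n₂)) :
    Prop where
  inv : StageInv E par label stage visited
  input : Input A s
  tree : TreeRep E s par
  pos : PosRep A s par
  lab : ∀ w : Fin n₂, (label (.inr w) = ⊤ ∧ s.arr 10 (w.val + 1) 0 = 0) ∨
    label (.inr w) = s.arr 10 (w.val + 1) 0
  layers : ∀ p c, 1 ≤ p → 1 ≤ c → (s.bit 4 p c = true ↔ ∃ w : Fin n₂,
    s.arr 4 (w.val + 1) 0 = c ∧ s.arr 10 (w.val + 1) 0 = p ∧ w ∉ visited)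
  unl : ∀ c, 1 ≤ c → s.bit 5 0 c = true → c ≤ s.reg 3
  lab_le : ∀ w : Fin n₂, s.arr 10 (w.val + 1) 0 ≤ n₁

/-- All labels become `0`, and all numbers of nodes of `V₁` are put into row `0` of the word array
`5`. -/
def clearLabels : Cmd :=
  .assign 20 (ᴄ 1) ;;
  .loop (ʀ 20 <ₑ ʀ 3 +ₑ ᴄ 1)
    (.setBit 4 (.read 10 (.read 6 (ʀ 20) (ᴄ 0)) (ᴄ 0)) (ʀ 20) false ;;
     .write 10 (.read 6 (ʀ 20) (ᴄ 0)) (ᴄ 0) (ᴄ 0) ;; .setBit 5 (ᴄ 0) (ʀ 20) true ;;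
     .assign 20 (ʀ 20 +ₑ ᴄ 1))

section Labels

variable {n₁ n₂ lam N : ℕ} {E : Finset (Fin n₁ × Fin n₂)}

/-- Every bit left in a layer sits at the label and the number of some node, so deleting one bit per
numbered node empties all the rows. This takes O(k) steps rather than time proportional to the size
of the rows. -/
theorem wp_clearLabels (hlam : 0 < lam) {s : Store lam} {T : ℕ} {par : Parents n₁ n₂}
    (hM : TreeRep E s par) (hk : s.reg 3 ≤ n₁) (hN : n₁ + n₂ + 2 ≤ N)
    (hlay : ∀ p c, 1 ≤ p → 1 ≤ c → s.bit 4 p c = true → ∃ w : Fin n₂,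
      s.arr 4 (w.val + 1) 0 = c ∧ s.arr 10 (w.val + 1) 0 = p)
    (hwt : ∀ w : Fin n₂, IsWT1 par w → s.arr 10 (w.val + 1) 0 = 0)
    (hunl : ∀ c, 1 ≤ c → s.bit 5 0 c = true → c ≤ s.reg 3)
    {Q : Store lam → ℕ → Prop}
    (hQ : ∀ s' T', s.Same [20] [10] [4, 5] s' → T' ≤ T + 5 * s.reg 3 + 2 →
      (∀ w : Fin n₂, s'.arr 10 (w.val + 1) 0 = 0) →
      (∀ p c, 1 ≤ p → 1 ≤ c → s'.bit 4 p c = false) →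
      (∀ c, 1 ≤ c → (s'.bit 5 0 c = true ↔ c ≤ s.reg 3)) → Q s' T') :
    wp N clearLabels Q s T := by
  simp only [clearLabels, wp, Expr.ev]
  refine ⟨by omega, ?_⟩
  apply wp_loop (I := fun s' T' => s.Same [20] [10] [4, 5] s' ∧ 1 ≤ s'.reg 20 ∧
      s'.reg 20 ≤ s.reg 3 + 1 ∧ T' + 5 ≤ T + 5 * s'.reg 20 + 1 ∧
      (∀ w : Fin n₂, s'.arr 10 (w.val + 1) 0 =
        if s.arr 4 (w.val + 1) 0 < s'.reg 20 then 0 else s.arr 10 (w.val + 1) 0) ∧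
      (∀ p c, 1 ≤ p → 1 ≤ c → s'.bit 4 p c = true → s.bit 4 p c = true ∧ s'.reg 20 ≤ c) ∧
      (∀ c, 1 ≤ c → c < s'.reg 20 → s'.bit 5 0 c = true) ∧
      (∀ c, 1 ≤ c → s'.bit 5 0 c = true → c ≤ s.reg 3)) (M := T + 5 * s.reg 3 + 1)
  · refine ⟨⟨?_, fun _ _ => rfl, fun _ _ => rfl, rfl⟩, by simp, by simp, by simp, ?_, ?_, ?_, hunl⟩
    · intro r hr
      simp only [List.mem_singleton] at hr
      simp [hr]
    · intro w
      simp only [arr_setReg, reg_setReg, ↓reduceIte]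
      split_ifs with h
      · rw [hwt]
        by_contra hc
        have := (hM.ne₂ w).2 hc
        omega
      · rfl
    · intro p c _ hc h
      exact ⟨h, by simpa using hc⟩
    · intro c h1 h2
      simp only [reg_setReg, ↓reduceIte] at h2
      omega
  · rintro s' T' ⟨-, h1, h2, h3, -⟩
    omega
  · rintro s' T' ⟨hs, h1, h2, h3, h4, h5, h6, h6'⟩ he
    simp only [Expr.ev, ne_eq, indic_eq_zero, not_not, hs.reg 3 (by simp)] at he
    obtain ⟨w₀, e1, e2⟩ := hM.idx₂ _ h1 (by omega)
    have hlab : s'.arr 10 (w₀.val + 1) 0 = s.arr 10 (w₀.val + 1) 0 := by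
      rw [h4, if_neg (by omega)]
    simp only [wp, Expr.ev, reg_setBit, reg_setArr, arr_setBit, hs.arr 6 (by simp), e1, hlab]
    refine ⟨h1, by omega, h1, by omega, ⟨?_, ?_, ?_, ?_⟩, by simp, by simp; omega, by simp; omega,
      ?_, ?_, ?_, ?_⟩
    · intro r hr
      have := hs.reg r hr
      simp only [List.mem_singleton] at hr
      simp [hr, this]
    · intro a ha
      have := hs.arr a ha
      simp only [List.mem_singleton] at ha
      simp [ha, this]
    · intro a ha
      have := hs.wrd a ha
      simp only [List.mem_cons, List.not_mem_nil, or_false, not_or] at ha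
      simp [ha, this]
    · simp [hs.log]
    · intro w
      simp only [arr_setReg, arr_setBit, arr_setArr_self, Nat.add_right_cancel_iff, and_true,
        reg_setReg, ↓reduceIte, ← Fin.ext_iff]
      split_ifs with h7 h8 h8
      · rfl
      · rw [h7] at h8; omega
      · rw [h4, if_pos]
        have : s.arr 4 (w.val + 1) 0 ≠ s'.reg 20 := by
          intro e
          exact h7 (hM.idx₂_inj (by rw [← hM.ne₂]; omega) (e.trans e2.symm))
        omega
      · rw [h4, if_neg (by omega)]
    · intro p c hp hc
      rw [bit_setReg, bit_setBit_ne _ _ _ _ (by simp), bit_setArr,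
        bit_setBit _ _ _ _ _ _ _ _ hlam h1 hc]
      simp only [reg_setReg, ↓reduceIte, true_and]
      split_ifs with h7
      · simp
      · intro h
        obtain ⟨h8, h9⟩ := h5 p c hp hc h
        refine ⟨h8, ?_⟩
        obtain ⟨w, h10, h11⟩ := hlay p c hp hc h8
        have : c ≠ s'.reg 20 := by
          rintro rfl
          have := hM.idx₂_inj (w := w) (w' := w₀) (by rw [← hM.ne₂]; omega) (by omega)
          subst this
          exact h7 ⟨h11.symm, rfl⟩
        omega
    · intro c hc hc'
      simp only [reg_setReg, ↓reduceIte] at hc'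
      rw [bit_setReg, bit_setBit _ _ _ _ _ _ _ _ hlam h1 hc]
      split_ifs with h7
      · rfl
      · rw [bit_setArr, bit_setBit_ne _ _ _ _ (by simp)]
        exact h6 c hc (by omega)
    · intro c hc
      rw [bit_setReg, bit_setBit _ _ _ _ _ _ _ _ hlam h1 hc]
      split_ifs with h7
      · omega
      · rw [bit_setArr, bit_setBit_ne _ _ _ _ (by simp)]
        exact h6' c hc
  · rintro s' T' ⟨hs, h1, h2, h3, h4, h5, h6, h6'⟩ he
    simp only [Expr.ev, indic_eq_zero, hs.reg 3 (by simp)] at he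
    refine hQ _ _ hs (by omega) ?_ ?_ ?_
    · intro w
      have := hM.le₂ w
      rw [h4, if_pos (by omega)]
    · intro p c hp hc
      by_contra hb
      obtain ⟨h7, h8⟩ := h5 p c hp hc (by simpa using hb)
      obtain ⟨w, h10, h11⟩ := hlay p c hp hc h7
      have := hM.le₂ w
      omega
    · intro c hc
      exact ⟨h6' c hc, fun hc' => h6 c hc (by omega)⟩

end Labels

/-! ### Breadth-first search for the labels -/

section LabInv

variable {n₁ n₂ : ℕ} {E : Finset (Fin n₁ × Fin n₂)} {par : Parents n₁ n₂}

/-- A partial labelling during the breadth first search; `idx` are the numbers of the nodes of `V₁`,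
at most `k`, and `unl` marks the numbers of the nodes whose parent is not yet labelled. -/
structure LabInv {n₁ n₂ : ℕ} (E : Finset (Fin n₁ × Fin n₂)) (par : Parents n₁ n₂)
    (idx : Fin n₁ → ℕ) (k tail : ℕ) (queue lab : ℕ → ℕ) (unl : ℕ → Bool) : Prop where
  entries : ∀ j, 1 ≤ j → j ≤ tail → ∃ w : Fin n₂, queue j = w.val + 1 ∧ lab (w.val + 1) ≠ 0
  mem : ∀ w : Fin n₂, lab (w.val + 1) ≠ 0 → ∃ j, 1 ≤ j ∧ j ≤ tail ∧ queue j = w.val + 1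
  mono : ∀ i j, 1 ≤ i → i ≤ j → j ≤ tail → lab (queue i) ≤ lab (queue j)
  unl_iff : ∀ u w, par u = some w → (unl (idx u) = true ↔ lab (w.val + 1) = 0)
  unl_le : ∀ c, 1 ≤ c → unl c = true → c ≤ k
  sound : ∀ w : Fin n₂, lab (w.val + 1) ≠ 0 → ResPath E par (.inr w) (lab (w.val + 1))
  card : tail = (Finset.univ.filter fun w : Fin n₂ => lab (w.val + 1) ≠ 0).card
  le : ∀ w : Fin n₂, lab (w.val + 1) ≤ tail

theorem ResPath.eq_zero_of_isWT1 {w : Fin n₂} {k : ℕ} (hw : IsWT1 par w)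
    (h : ResPath E par (.inr w) k) : k = 0 := by
  cases h with
  | base => rfl
  | @fromV2 _ y k hr hp =>
    cases y with
    | inl u => exact absurd hr (hw u)
    | inr w' => exact hr.elim

theorem LabInv.wt {idx : Fin n₁ → ℕ} {k tail : ℕ} {queue lab : ℕ → ℕ} {unl : ℕ → Bool}
    (h : LabInv E par idx k tail queue lab unl) {w : Fin n₂} (hw : IsWT1 par w) :
    lab (w.val + 1) = 0 := by
  by_contra hc
  exact hc ((h.sound w hc).eq_zero_of_isWT1 hw)

theorem LabInv.tail_le {idx : Fin n₁ → ℕ} {k tail : ℕ} {queue lab : ℕ → ℕ} {unl : ℕ → Bool}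
    (h : LabInv E par idx k tail queue lab unl)
    (hinj : ∀ u u' w, par u = some w → par u' = some w → u = u') :
    tail ≤ (treeEdges par).card := by
  rw [h.card, ← card_matched₂ hinj]
  refine Finset.card_le_card fun w hw => ?_
  rw [Finset.mem_filter] at hw
  exact mem_matched₂.2 fun hwt => hw.2 (h.wt hwt)

/-- The new value is at least every label in the queue, so appending keeps the queue sorted. It
exceeds the number of labelled nodes by at most one, which keeps the stored labels small integers.
-/
theorem LabInv.step {idx : Fin n₁ → ℕ} {k tail : ℕ} {queue lab : ℕ → ℕ} {unl : ℕ → Bool}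
    (h : LabInv E par idx k tail queue lab unl)
    (hinj : ∀ u u' w, par u = some w → par u' = some w → u = u')
    (hidx : ∀ u u', par u ≠ none → idx u = idx u' → u = u')
    {u : Fin n₁} {w : Fin n₂} (hu : par u = some w) (hw : lab (w.val + 1) = 0) {v : ℕ}
    (hv : 1 ≤ v) (hvt : v ≤ tail + 1) (hp : ResPath E par (.inr w) v)
    (hle : ∀ j, 1 ≤ j → j ≤ tail → lab (queue j) ≤ v)
    {queue' lab' : ℕ → ℕ} {unl' : ℕ → Bool}
    (hq' : ∀ j, queue' j = if j = tail + 1 then w.val + 1 else queue j)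
    (hl' : ∀ i, lab' i = if i = w.val + 1 then v else lab i)
    (hu' : ∀ c, 1 ≤ c → unl' c = if c = idx u then false else unl c)
    (hi : ∀ u, par u ≠ none → 1 ≤ idx u) :
    LabInv E par idx k (tail + 1) queue' lab' unl' where
  entries j h1 h2 := by
    rw [hq' j]
    split_ifs with hj
    · exact ⟨w, rfl, by rw [hl', if_pos rfl]; omega⟩
    · obtain ⟨x, h3, h4⟩ := h.entries j h1 (by omega)
      refine ⟨x, h3, ?_⟩
      rw [hl']
      split_ifs <;> omega
  mem x hx := by
    rw [hl'] at hx
    split_ifs at hx with he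
    · exact ⟨tail + 1, by omega, le_rfl, by rw [hq', if_pos rfl, he]⟩
    · obtain ⟨j, h1, h2, h3⟩ := h.mem x hx
      exact ⟨j, h1, by omega, by rw [hq', if_neg (by omega), h3]⟩
  mono i j h1 h2 h3 := by
    have key : ∀ i, 1 ≤ i → i ≤ tail → lab' (queue' i) = lab (queue i) := by
      intro i h1 h2
      obtain ⟨x, h4, h5⟩ := h.entries i h1 h2
      rw [hq', if_neg (by omega), hl', if_neg]
      rw [h4]
      intro e
      rw [e] at h5
      exact h5 hw
    rcases Nat.lt_or_ge tail j with hj | hj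
    · obtain rfl : j = tail + 1 := by omega
      rw [hq' (tail + 1), if_pos rfl, hl' (w.val + 1), if_pos rfl]
      rcases Nat.lt_or_ge tail i with hi | hi
      · obtain rfl : i = tail + 1 := by omega
        rw [hq', if_pos rfl, hl', if_pos rfl]
      · rw [key i h1 hi]
        exact hle i h1 hi
    · rw [key i h1 (by omega), key j (by omega) hj]
      exact h.mono i j h1 h2 hj
  unl_iff x y hxy := by
    rw [hu' _ (hi x (by rw [hxy]; simp)), hl']
    by_cases hx : x = u
    · subst hx
      rw [hu] at hxy
      obtain rfl := Option.some_injective _ hxy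
      simp
      omega
    · rw [if_neg fun e => hx (hidx _ _ (by rw [hxy]; simp) e), if_neg, h.unl_iff x y hxy]
      intro e
      obtain rfl : y = w := Fin.ext (by omega)
      exact hx (hinj _ _ _ hxy hu)
  unl_le c hc := by
    rw [hu' c hc]
    split_ifs
    · simp
    · exact h.unl_le c hc
  sound x hx := by
    rw [hl'] at hx ⊢
    split_ifs at hx ⊢ with he
    · obtain rfl : x = w := Fin.ext (by omega)
      exact hp
    · exact h.sound x hx
  card := by
    have : (Finset.univ.filter fun x : Fin n₂ => lab' (x.val + 1) ≠ 0) =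
        insert w (Finset.univ.filter fun x : Fin n₂ => lab (x.val + 1) ≠ 0) := by
      ext x
      simp only [Finset.mem_filter, Finset.mem_univ, true_and, Finset.mem_insert, hl',
        Nat.add_right_cancel_iff, ← Fin.ext_iff]
      by_cases hx : x = w
      · simp [hx]; omega
      · simp [hx]
    rw [this, Finset.card_insert_of_notMem (by simp [hw]), ← h.card]
  le x := by
    rw [hl']
    have := h.le x
    split_ifs <;> omega

end LabInv

/-- The node `[5]`, with the child numbered `[20]`, gets the label `[22]`. -/
def labelNode : Cmd :=
  .assign 14 (ʀ 14 +ₑ ᴄ 1) ;; .write 11 (ʀ 14) (ᴄ 0) (ʀ 5) ;; .write 10 (ʀ 5) (ᴄ 0) (ʀ 22) ;;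
  .setBit 5 (ᴄ 0) (ʀ 20) false

/-- The branches with a child that is adjacent to a `WT₁` branch get the label `1` and are put into
the queue in array `11`. -/
def seedLabels : Cmd :=
  .assign 14 (ᴄ 0) ;; .assign 20 (ᴄ 1) ;;
  .loop (ʀ 20 <ₑ ʀ 3 +ₑ ᴄ 1)
    (.assign 6 (.read 5 (ʀ 20) (ᴄ 0)) ;; advance 0 8 4 ;;
     .ite (ʀ 7) (.assign 5 (.read 2 (ʀ 6) (ᴄ 0)) ;; .assign 22 (ᴄ 1) ;; labelNode) .skip ;;
     .assign 20 (ʀ 20 +ₑ ᴄ 1))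

/-- The other labels are computed by breadth first search. -/
def spreadLabels : Cmd :=
  .assign 13 (ᴄ 1) ;; .assign 11 (ʀ 3 /ₑ ʀ 2 +ₑ ᴄ 1) ;;
  .loop (ʀ 13 <ₑ ʀ 14 +ₑ ᴄ 1)
    (.assign 9 (.read 4 (.read 11 (ʀ 13) (ᴄ 0)) (ᴄ 0)) ;; .assign 10 (ᴄ 0) ;; scan 3 5 ;;
     .ite (ʀ 7)
       (.assign 20 (ʀ 7) ;; .assign 5 (.read 2 (.read 5 (ʀ 7) (ᴄ 0)) (ᴄ 0)) ;;
        .assign 22 (.read 10 (.read 11 (ʀ 13) (ᴄ 0)) (ᴄ 0) +ₑ ᴄ 1) ;; labelNode)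
       (.assign 13 (ʀ 13 +ₑ ᴄ 1)))

section Labels

variable {n₁ n₂ lam N : ℕ} {E : Finset (Fin n₁ × Fin n₂)}

/-- `LabInv` for the arrays `11` and `10` and row `0` of the word array `5`. -/
def LabRep (E : Finset (Fin n₁ × Fin n₂)) (par : Parents n₁ n₂) (s : Store lam) : Prop :=
  LabInv E par (fun u => s.arr 3 (u.val + 1) 0) (s.reg 3) (s.reg 14) (fun j => s.arr 11 j 0)
    (fun i => s.arr 10 i 0) (fun c => s.bit 5 0 c)

theorem LabRep.congr {par : Parents n₁ n₂} {s s' : Store lam} (h : LabRep E par s)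
    (h3 : s'.reg 3 = s.reg 3) (h14 : s'.reg 14 = s.reg 14) (a3 : s'.arr 3 = s.arr 3)
    (a10 : s'.arr 10 = s.arr 10) (a11 : s'.arr 11 = s.arr 11) (w5 : s'.wrd 5 = s.wrd 5) :
    LabRep E par s' := by
  simp only [LabRep, h3, h14, a3, a10, a11, bit_congr w5]
  exact h

theorem wp_labelNode (hlam : 0 < lam) {s : Store lam} {T : ℕ}
    {par : Parents n₁ n₂} (hinj : ∀ u u' w, par u = some w → par u' = some w → u = u')
    (hM : TreeRep E s par) (hL : LabRep E par s) (hk : s.reg 3 ≤ n₁) (hN : n₁ + n₂ + 2 ≤ N)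
    {u : Fin n₁} {w : Fin n₂} (hu : par u = some w) (hw : s.arr 10 (w.val + 1) 0 = 0)
    (h5 : s.reg 5 = w.val + 1) (h20 : s.reg 20 = s.arr 3 (u.val + 1) 0) (hv : 1 ≤ s.reg 22)
    (hvt : s.reg 22 ≤ s.reg 14 + 1) (hp : ResPath E par (.inr w) (s.reg 22))
    (hle : ∀ j, 1 ≤ j → j ≤ s.reg 14 → s.arr 10 (s.arr 11 j 0) 0 ≤ s.reg 22)
    {Q : Store lam → ℕ → Prop}
    (hQ : ∀ s', s.Same [14] [10, 11] [5] s' → s'.reg 14 = s.reg 14 + 1 →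
      (∀ i, s'.arr 10 i 0 = if i = w.val + 1 then s.reg 22 else s.arr 10 i 0) →
      (∀ j, s'.arr 11 j 0 = if j = s.reg 14 + 1 then w.val + 1 else s.arr 11 j 0) →
      LabRep E par s' → Q s' (T + 4)) :
    wp N labelNode Q s T := by
  have htl := hL.tail_le hinj
  rw [← hM.card] at htl
  have hpos : ∀ u, par u ≠ none → 1 ≤ s.arr 3 (u.val + 1) 0 :=
    fun u hu => Nat.one_le_iff_ne_zero.2 ((hM.ne₁ u).2 hu)
  have h1 := hpos u (by rw [hu]; simp)
  simp only [labelNode, wp, Expr.ev, reg_setReg, reg_setArr, Nat.reduceEqDiff, ↓reduceIte, h5, h20]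
  refine ⟨by omega, by omega, by omega, h1, hQ _ ⟨?_, ?_, ?_, by simp⟩ (by simp) (by simp)
    (by simp) ?_⟩
  · intro r hr
    simp only [List.mem_singleton] at hr
    simp [hr]
  · intro a ha
    simp only [List.mem_cons, List.not_mem_nil, or_false, not_or] at ha
    simp [ha]
  · intro a ha
    simp only [List.mem_singleton] at ha
    simp [ha]
  · simp only [LabRep]
    convert hL.step (queue' := fun j => ((((s.setReg 14 (s.reg 14 + 1)).setArr 11 (s.reg 14 + 1) 0
      (w.val + 1)).setArr 10 (w.val + 1) 0 (s.reg 22)).setBit 5 0 (s.arr 3 (u.val + 1) 0) false).arr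
      11 j 0) hinj (fun a b ha e => hM.idx₁_inj ha e) hu hw hv hvt hp hle ?_
      ?_ ?_ hpos using 1
    · simp
    · simp
    · simp
    · intro j; simp
    · intro i; simp
    · intro c hc
      rw [bit_setBit _ _ _ _ _ _ _ _ hlam h1 hc]
      simp

/-- Label `1` means that the child has a neighbour outside the tree. Such neighbours have no number
and no matrix entry, so they are found with the list pointers. -/
theorem wp_seedLabels (hlam : 0 < lam) {A : AdjLists E} {s : Store lam} {T : ℕ}
    {par : Parents n₁ n₂} (hinj : ∀ u u' w, par u = some w → par u' = some w → u = u')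
    (hI : Input A s) (hM : TreeRep E s par) (hP : PosRep A s par) (hk : s.reg 3 ≤ n₁)
    (hN : n₁ + n₂ + 2 ≤ N)
    (hlab : ∀ w : Fin n₂, s.arr 10 (w.val + 1) 0 = 0)
    (hunl : ∀ c, 1 ≤ c → (s.bit 5 0 c = true ↔ c ≤ s.reg 3))
    {Q : Store lam → ℕ → Prop}
    (hQ : ∀ s' T', s.Same [5, 6, 7, 14, 20, 22] [8, 10, 11] [5] s' → PosRep A s' par →
      T' + 2 * posSum n₁ n₂ s ≤ T + 2 * posSum n₁ n₂ s' + 12 * s.reg 3 + 3 →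
      posSum n₁ n₂ s ≤ posSum n₁ n₂ s' →
      LabRep E par s' → (∀ w : Fin n₂, s'.arr 10 (w.val + 1) 0 ≤ 1) →
      (∀ u w y, par u = some w → (u, y) ∈ E → IsWT1 par y → s'.arr 10 (w.val + 1) 0 = 1) →
      Q s' T') :
    wp N seedLabels Q s T := by
  simp only [seedLabels, wp, Expr.ev]
  refine ⟨by omega, by omega, ?_⟩
  apply wp_loop (I := fun s' T' => s.Same [5, 6, 7, 14, 20, 22] [8, 10, 11] [5] s' ∧ PosRep A s' par ∧
      1 ≤ s'.reg 20 ∧ s'.reg 20 ≤ s.reg 3 + 1 ∧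
      T' + 2 * posSum n₁ n₂ s + 12 ≤ T + 2 * posSum n₁ n₂ s' + 12 * s'.reg 20 + 2 ∧
      posSum n₁ n₂ s ≤ posSum n₁ n₂ s' ∧
      LabRep E par s' ∧ (∀ w : Fin n₂, s'.arr 10 (w.val + 1) 0 ≤ 1) ∧
      (∀ u w, par u = some w → s'.arr 10 (w.val + 1) 0 ≠ 0 → s.arr 3 (u.val + 1) 0 < s'.reg 20) ∧
      (∀ u w y, par u = some w → s.arr 3 (u.val + 1) 0 < s'.reg 20 → (u, y) ∈ E → IsWT1 par y →
        s'.arr 10 (w.val + 1) 0 = 1))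
      (M := T + 4 * (s.reg 3 * s.reg 3) + 12 * s.reg 3 + 2)
  · refine ⟨⟨?_, fun _ _ => rfl, fun _ _ => rfl, rfl⟩, hP.congr rfl rfl, by simp, by simp,
      ?_, ?_, ?_, ?_, ?_, ?_⟩
    · intro r hr
      simp only [List.mem_cons, List.not_mem_nil, or_false, not_or] at hr
      simp [hr]
    · simp; omega
    · simp
    · simp only [LabRep, reg_setReg, arr_setReg, bit_setReg, Nat.reduceEqDiff, ↓reduceIte]
      refine ⟨fun j h1 h2 => by omega, fun w h => absurd (hlab w) h, fun i j h1 h2 h3 => by omega,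
        fun u w h => ?_, fun c hc h => (hunl c hc).1 h, fun w h => absurd (hlab w) h, ?_, ?_⟩
      · rw [hunl _ (Nat.one_le_iff_ne_zero.2 ((hM.ne₁ u).2 (by rw [h]; simp))), hlab]
        simp [hM.le₁ u]
      · simp [hlab]
      · intro w; simp [hlab]
    · intro w; simp [hlab]
    · intro u w _ h; exact absurd (hlab w) h
    · intro u w y h h1
      simp only [reg_setReg, ↓reduceIte] at h1
      have := (hM.ne₁ u).2 (by rw [h]; simp)
      omega
  · rintro s' T' ⟨-, hP', h1, h2, h3, -⟩
    have := hP'.posSum_le hinj (hM.card.symm.le)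
    omega
  · rintro s' T' ⟨hs, hP', h1, h2, h3, h4, hL, h5, h6, h7⟩ he
    simp only [Expr.ev, ne_eq, indic_eq_zero, not_not, hs.reg 3 (by simp)] at he
    obtain ⟨u, e1, e2⟩ := hM.idx₁ _ h1 (by omega)
    have hpu : par u ≠ none := by rw [← hM.ne₁]; omega
    obtain ⟨w, hw⟩ := Option.ne_none_iff_exists'.1 hpu
    have hun := hs.arr 5 (by simp)
    simp only [wp, Expr.ev, hun, e1]
    refine ⟨by omega, ?_⟩
    refine wp_advance₁ (s := s'.setReg 6 (u.val + 1)) (A := A) (par := par) (u := u) (hI.congr ?_ ?_ ?_)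
      (hM.congr ?_ ?_ ?_ ?_) (hP'.congr rfl rfl) hN ?_ hpu ?_
    · intro r hr
      simp [show r ≠ 6 by omega, hs.reg r (by simp; omega)]
    · intro a ha
      simp [hs.arr a (by simp; omega)]
    · simp [hs.wrd 0]
    · simp [hs.reg 3]
    · intro a ha1 ha2
      simp [hs.arr a (by simp; omega)]
    · simp [hs.wrd 2]
    · simp [hs.wrd 3]
    · simp
    intro s1 T1 hs1 hP1 c1 c2 hres
    rw [posSum_setReg] at c1 c2
    have r3 : s1.reg 3 = s.reg 3 := by rw [hs1.reg 3 (by simp)]; simp [hs.reg 3]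
    have r6 : s1.reg 6 = u.val + 1 := by rw [hs1.reg 6 (by simp)]; simp
    have r14 : s1.reg 14 = s'.reg 14 := by rw [hs1.reg 14 (by simp)]; simp
    have r20 : s1.reg 20 = s'.reg 20 := by rw [hs1.reg 20 (by simp)]; simp
    have a3 : s1.arr 3 = s.arr 3 := by rw [hs1.arr 3 (by simp), arr_setReg, hs.arr 3 (by simp)]
    have a2 : s1.arr 2 = s.arr 2 := by rw [hs1.arr 2 (by simp), arr_setReg, hs.arr 2 (by simp)]
    have a10 : s1.arr 10 = s'.arr 10 := by rw [hs1.arr 10 (by simp), arr_setReg]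
    have a11 : s1.arr 11 = s'.arr 11 := by rw [hs1.arr 11 (by simp), arr_setReg]
    have w5 : s1.wrd 5 = s'.wrd 5 := by rw [hs1.wrd 5 (by simp), wrd_setReg]
    have hL1 : LabRep E par s1 := hL.congr (by rw [r3, hs.reg 3 (by simp)]) r14
      (by rw [a3, hs.arr 3 (by simp)]) a10 a11 w5
    have hss1 : s.Same [5, 6, 7, 14, 20, 22] [8, 10, 11] [5] s1 := by
      refine hs.trans ((Store.Same.setReg (by simp)).trans (hs1.mono (by simp) (by simp) (by simp)))
    have htl := hL1.tail_le hinj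
    rw [← hM.card] at htl
    have hidx : ∀ u', s.arr 3 (u'.val + 1) 0 < s'.reg 20 + 1 → par u' ≠ none →
        u' = u ∨ s.arr 3 (u'.val + 1) 0 < s'.reg 20 := by
      intro u' h h'
      by_cases hc : s.arr 3 (u'.val + 1) 0 = s'.reg 20
      · exact Or.inl (hM.idx₁_inj h' (hc.trans e2.symm))
      · right; omega
    refine ⟨fun h => ?_, fun h => ?_⟩
    · rcases hres with ⟨hres, -⟩ | ⟨y, hy, hwy, -⟩
      · exact absurd hres h
      have hout : s1.arr 2 (u.val + 1) 0 = w.val + 1 := by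
        rw [a2, hM.out, hw, nodeNum_some]
      have hlw : s'.arr 10 (w.val + 1) 0 = 0 := by
        by_contra hc
        have := h6 u w hw hc
        omega
      simp only [wp, Expr.ev, reg_setReg, arr_setReg, Nat.reduceEqDiff, ↓reduceIte, r6, hout]
      refine ⟨by omega, by omega, ?_⟩
      refine wp_labelNode hlam hinj (u := u) (w := w) (s := (s1.setReg 5 (w.val + 1)).setReg 22 1)
        (hM.congr ?_ ?_ ?_ ?_)
        (hL1.congr (by simp) (by simp) rfl rfl rfl rfl) (by simp [r3]; omega) hN hw ?_ (by simp) ?_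
        (by simp) (by simp) ?_ ?_ ?_
      · simp [r3]
      · intro a ha1 ha2
        rw [arr_setReg, arr_setReg, hss1.arr a (by simp; omega)]
      · rw [wrd_setReg, wrd_setReg, hss1.wrd 2 (by simp)]
      · rw [wrd_setReg, wrd_setReg, hss1.wrd 3 (by simp)]
      · rw [arr_setReg, arr_setReg, a10, hlw]
      · simp [r20, a3, e2]
      · simp only [reg_setReg, ↓reduceIte]
        exact .fromV2 (y := .inl u) hw (.fromV1 (y := .inr y) hy (.base hwy))
      · intro j hj1 hj2
        simp only [reg_setReg, arr_setReg, Nat.reduceEqDiff, ↓reduceIte] at hj2 ⊢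
        obtain ⟨x, hx, -⟩ := hL1.entries j hj1 hj2
        rw [hx, a10]
        exact h5 x
      intro s2 hs2 q14 q10 q11 hL2
      simp only [reg_setReg, arr_setReg, Nat.reduceEqDiff, ↓reduceIte, a10] at q14 q10 q11
      have r20' : s2.reg 20 = s'.reg 20 := by rw [hs2.reg 20 (by simp)]; simp [r20]
      have hp2 : posSum n₁ n₂ s2 = posSum n₁ n₂ s1 :=
        posSum_congr (by rw [hs2.arr 8 (by simp)]; rfl) (by rw [hs2.arr 9 (by simp)]; rfl)
      simp only [wp, Expr.ev, r20', posSum_setReg, hp2, reg_setReg, arr_setReg, ↓reduceIte, q10]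
      refine ⟨by omega, ?_, (hP1.congr ?_ ?_).congr rfl rfl, by omega, by omega, by omega, by omega,
        hL2.congr (by simp) (by simp) rfl rfl rfl rfl, ?_, ?_, ?_⟩
      · refine hss1.trans ⟨?_, ?_, ?_, ?_⟩
        · intro r hr
          simp only [List.mem_cons, List.not_mem_nil, or_false, not_or] at hr
          simp [hr, hs2.reg r (by simp [hr])]
        · intro a ha
          simp only [List.mem_cons, List.not_mem_nil, or_false, not_or] at ha
          simp [hs2.arr a (by simp [ha])]
        · intro a ha
          simp [hs2.wrd a ha]
        · simp [hs2.log]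
      · rw [arr_setReg, hs2.arr 8 (by simp)]; rfl
      · rw [arr_setReg, hs2.arr 9 (by simp)]; rfl
      · intro x
        have := h5 x
        split_ifs <;> omega
      · intro u' w' hw' hx
        split_ifs at hx with he'
        · obtain rfl : w' = w := Fin.ext (by omega)
          obtain rfl := hinj _ _ _ hw' hw
          omega
        · have := h6 u' w' hw' hx
          omega
      · intro u' w' y' hw' hlt hy' hwy'
        rcases hidx u' hlt (by rw [hw']; simp) with rfl | hlt'
        · rw [hw] at hw'
          obtain rfl := Option.some_injective _ hw'
          rw [if_pos rfl]
        · have := h7 u' w' y' hw' hlt' hy' hwy'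
          split_ifs <;> omega
    · rcases hres with ⟨-, hres⟩ | ⟨y, hy, hwy, h7'⟩
      swap
      · change s1.reg 7 = 0 at h
        omega
      simp only [wp, Expr.ev, r20, posSum_setReg, reg_setReg, arr_setReg, ↓reduceIte, a10]
      refine ⟨by omega, ?_, hP1.congr rfl rfl, by omega, by omega, by omega, by omega,
        hL1.congr (by simp) (by simp) rfl rfl rfl rfl, h5, ?_, ?_⟩
      · refine hss1.trans ⟨?_, fun _ _ => rfl, fun _ _ => rfl, rfl⟩
        intro r hr
        simp only [List.mem_cons, List.not_mem_nil, or_false, not_or] at hr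
        simp [hr]
      · intro u' w' hw' hx
        have := h6 u' w' hw' hx
        omega
      · intro u' w' y' hw' hlt hy' hwy'
        rcases hidx u' hlt (by rw [hw']; simp) with rfl | hlt'
        · exact absurd hwy' (hres _ hy')
        · exact h7 u' w' y' hw' hlt' hy' hwy'
  · rintro s' T' ⟨hs, hP', h1, h2, h3, h4, hL, h5, h6, h7⟩ he
    simp only [Expr.ev, indic_eq_zero, hs.reg 3 (by simp)] at he
    refine hQ _ _ hs hP' (by omega) h4 hL h5 fun u w y hw hy hwy => h7 u w y hw ?_ hy hwy
    have := hM.le₁ u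
    omega

/-- Every scan either appends a node to the queue or retires its head, so the sum of `[13]` and
`[14]` counts the scans. The tail is at most k and the head at most one beyond it, whence the factor
`2 * k + 1`. -/
theorem wp_spreadLabels (hlam : 0 < lam) {A : AdjLists E} {s : Store lam} {T : ℕ}
    {par : Parents n₁ n₂} (hinj : ∀ u u' w, par u = some w → par u' = some w → u = u')
    (hI : Input A s) (hM : TreeRep E s par) (hk : s.reg 3 ≤ n₁) (hl1 : lam ≤ n₁)
    (hN : 2 * (n₁ + n₂ + 1) ≤ N)
    (hL : LabRep E par s) (hlab : ∀ w : Fin n₂, s.arr 10 (w.val + 1) 0 ≤ 1)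
    (hseed : ∀ u w y, par u = some w → (u, y) ∈ E → IsWT1 par y → s.arr 10 (w.val + 1) 0 = 1)
    {Q : Store lam → ℕ → Prop}
    (hQ : ∀ s' T', s.Same [5, 7, 8, 9, 10, 11, 13, 14, 20, 22] [10, 11] [5] s' →
      T' ≤ T + (4 * (s.reg 3 / lam + 1) + 19) * (2 * s.reg 3 + 1) + 3 →
      LabRep E par s' →
      (∀ w, (twoEdgeLabel E par (.inr w) = ⊤ ∧ s'.arr 10 (w.val + 1) 0 = 0) ∨
        twoEdgeLabel E par (.inr w) = s'.arr 10 (w.val + 1) 0) → Q s' T') :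
    wp N spreadLabels Q s T := by
  have hkl : s.reg 3 / lam ≤ s.reg 3 := Nat.div_le_self _ _
  have hkm : (s.reg 3 / lam + 1) * lam ≤ s.reg 3 + lam := by
    rw [Nat.succ_mul]; exact Nat.add_le_add_right (Nat.div_mul_le_self _ _) _
  simp only [spreadLabels, wp, Expr.ev, reg_setReg, Nat.reduceEqDiff, ↓reduceIte, hI.reg2]
  refine ⟨by omega, by omega, ?_⟩
  set c := 4 * (s.reg 3 / lam + 1) + 19 with hc
  apply wp_loop (I := fun s' T' => s.Same [5, 7, 8, 9, 10, 11, 13, 14, 20, 22] [10, 11] [5] s' ∧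
      s'.reg 11 = s.reg 3 / lam + 1 ∧
      1 ≤ s'.reg 13 ∧ s'.reg 13 ≤ s'.reg 14 + 1 ∧ T' ≤ T + c * (s'.reg 13 + s'.reg 14) + 2 ∧
      LabRep E par s' ∧
      (∀ u w y, par u = some w → (u, y) ∈ E → IsWT1 par y → s'.arr 10 (w.val + 1) 0 = 1) ∧
      (∀ j (x : Fin n₂), 1 ≤ j → j < s'.reg 13 → s'.arr 11 j 0 = x.val + 1 →
        ∀ u w, par u = some w → (u, x) ∈ E → s'.arr 10 (w.val + 1) 0 ≠ 0 ∧
          s'.arr 10 (w.val + 1) 0 ≤ s'.arr 10 (x.val + 1) 0 + 1) ∧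
      -- The usual breadth-first condition: labels in the queue exceed that of the head by at most
      -- one. It gives feasibility of the arcs checked when the head is retired.
      (s'.reg 13 ≤ s'.reg 14 → ∀ j, 1 ≤ j → j ≤ s'.reg 14 →
        s'.arr 10 (s'.arr 11 j 0) 0 ≤ s'.arr 10 (s'.arr 11 (s'.reg 13) 0) 0 + 1))
      (M := T + c * (2 * s.reg 3 + 1) + 2)
  · refine ⟨⟨?_, fun _ _ => rfl, fun _ _ => rfl, rfl⟩, by simp, by simp, by simp, by simp,
      hL.congr (by simp) (by simp) rfl rfl rfl rfl, hseed, ?_, ?_⟩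
    · intro r hr
      simp only [List.mem_cons, List.not_mem_nil, or_false, not_or] at hr
      simp [hr]
    · intro j x h1 h2
      simp at h2
      omega
    · simp only [reg_setReg, arr_setReg, Nat.reduceEqDiff, ↓reduceIte]
      intro _ j h1 h2
      obtain ⟨x, hx, -⟩ := hL.entries j h1 h2
      rw [hx]
      have := hlab x
      omega
  · rintro s' T' ⟨hs, -, h1, h2, h3, hL', -⟩
    have h4 := hL'.tail_le hinj
    rw [← hM.card] at h4
    have : c * (s'.reg 13 + s'.reg 14) ≤ c * (2 * s.reg 3 + 1) :=
      Nat.mul_le_mul_left _ (by omega)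
    omega
  · rintro s' T' ⟨hs, h11, h1, h2, h3, hL', h4, h5, h6⟩ he
    simp only [Expr.ev, ne_eq, indic_eq_zero, not_not] at he
    have htl := hL'.tail_le hinj
    rw [← hM.card] at htl
    obtain ⟨x, hx, hxl⟩ := hL'.entries (s'.reg 13) h1 (by omega)
    have hwx : ¬ IsWT1 par x := fun h => hxl (hL'.wt h)
    have hix := hM.le₂ x
    simp only [wp, Expr.ev, hx, hs.arr 4 (by simp)]
    refine ⟨by omega, by omega, ?_⟩
    refine wp_scan hlam ?_ ?_ ?_
    · simp [hs.reg 2, hI.reg2]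
    · simp [h11]; omega
    simp only [reg_setReg, bit_setReg, Nat.reduceEqDiff, ↓reduceIte, h11]
    intro s1 T1 hs1 hT1 hres
    simp only [bit_congr (hs.wrd 3 (by simp))] at hres
    have hss1 : s'.Same [7, 8, 9, 10] [] [] s1 :=
      ((Store.Same.setReg (by simp)).trans (.setReg (by simp))).trans
        (hs1.mono (by simp) (by simp) (by simp))
    have hs' : s.Same [5, 7, 8, 9, 10, 11, 13, 14, 20, 22] [10, 11] [5] s1 :=
      hs.trans (hss1.mono (by simp) (by simp) (by simp))
    have r3 := hs'.reg 3 (by simp)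
    have r11 := hss1.reg 11 (by simp)
    have r13 := hss1.reg 13 (by simp)
    have r14 := hss1.reg 14 (by simp)
    have a10 := hss1.arr 10 (by simp)
    have a11 := hss1.arr 11 (by simp)
    have hM1 : TreeRep E s1 par := hM.congr r3
      (fun a h1 h2 => hs'.arr a (by simp; omega)) (hs'.wrd 2 (by simp)) (hs'.wrd 3 (by simp))
    have hL1 : LabRep E par s1 := hL'.congr (hss1.reg 3 (by simp)) r14 (hss1.arr 3 (by simp)) a10 a11
      (hss1.wrd 5 (by simp))
    have hci : ∀ a b, c * (a + b + 1) = c * (a + b) + c := fun a b => by ring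
    refine ⟨fun h => ?_, fun h => ?_⟩
    · rcases hres with ⟨hres, -⟩ | ⟨hr1, hr2, hr3⟩
      · exact absurd hres h
      -- Rows of the matrix may have meaningless bits beyond the numbers in use; the row of
      -- unlabelled nodes masks them out.
      have hck : s1.reg 7 ≤ s.reg 3 := by
        have := hL'.unl_le _ hr1 hr3
        rwa [hs.reg 3 (by simp)] at this
      obtain ⟨u, hu1, hu2⟩ := hM.idx₁ _ hr1 hck
      have hpu : par u ≠ none := by rw [← hM.ne₁]; omega
      obtain ⟨w, hw⟩ := Option.ne_none_iff_exists'.1 hpu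
      rw [← hu2, hM.bit₃ u x hpu hwx] at hr2
      have hlw : s'.arr 10 (w.val + 1) 0 = 0 := by
        refine (hL'.unl_iff u w hw).1 ?_
        simp only [hs.arr 3 (by simp), hu2]
        exact hr3
      have hlx := hL'.le x
      have hout : s.arr 2 (u.val + 1) 0 = w.val + 1 := by rw [hM.out, hw, nodeNum_some]
      simp only [wp, Expr.ev, reg_setReg, arr_setReg, Nat.reduceEqDiff, ↓reduceIte, r13, a10, a11,
        hs'.arr 5 (by simp), hs'.arr 2 (by simp), hu1, hout, hx]
      refine ⟨by omega, by omega, by omega, ?_⟩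
      refine wp_labelNode hlam hinj (u := u) (w := w)
        (s := ((s1.setReg 20 (s1.reg 7)).setReg 5 (w.val + 1)).setReg 22 (s'.arr 10 (x.val + 1) 0 + 1))
        (hM1.congr ?_ ?_ rfl rfl)
        (hL1.congr ?_ ?_ rfl rfl rfl rfl) ?_ (N := N) (by omega) hw ?_ ?_ ?_ ?_ ?_ ?_ ?_ ?_
      · simp
      · exact fun _ _ _ => rfl
      · simp
      · simp
      · simp [r3]; omega
      · simp [a10, hlw]
      · simp
      · simp [hs'.arr 3, hu2]
      · simp
      · simp [r14, hlx]
      · simp only [reg_setReg, ↓reduceIte]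
        exact .fromV2 (y := .inl u) hw (.fromV1 (y := .inr x) hr2 (hL'.sound x hxl))
      · simp only [reg_setReg, arr_setReg, Nat.reduceEqDiff, ↓reduceIte, r14, a10, a11, ← hx]
        exact h6 (by omega)
      intro s2 hs2 q14 q10 q11 hL2
      simp only [reg_setReg, arr_setReg, Nat.reduceEqDiff, ↓reduceIte, a10, a11, r14] at q14 q10 q11
      have hs2' : s1.Same [5, 7, 8, 9, 10, 14, 20, 22] [10, 11] [5] s2 :=
        (((Store.Same.setReg (by simp)).trans (.setReg (by simp))).trans
          (.setReg (by simp))).trans (hs2.mono (by simp) (by simp) (by simp))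
      have q13 := (hs2'.reg 13 (by simp)).trans r13
      have hne : ∀ y : Fin n₂, s'.arr 10 (y.val + 1) 0 ≠ 0 → y.val + 1 ≠ w.val + 1 := by
        intro y hy e
        rw [e] at hy
        exact hy hlw
      have hq11 : ∀ j, j ≤ s'.reg 14 → s2.arr 11 j 0 = s'.arr 11 j 0 := by
        intro j hj
        rw [q11, if_neg (by omega)]
      have hq10 : ∀ y : Fin n₂, s'.arr 10 (y.val + 1) 0 ≠ 0 →
          s2.arr 10 (y.val + 1) 0 = s'.arr 10 (y.val + 1) 0 := by
        intro y hy
        rw [q10, if_neg (hne y hy)]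
      rw [q13, q14, ← add_assoc, hci]
      refine ⟨hs'.trans (hs2'.mono (by simp) (by simp) (by simp)),
        by rw [hs2'.reg 11 (by simp), r11, h11], h1, by omega, by omega, hL2, ?_, ?_, ?_⟩
      · intro u' w' y' hw' hy' hwy'
        have := h4 u' w' y' hw' hy' hwy'
        rw [hq10 _ (by omega), this]
      · intro j y hj1 hj2 hjy u' w' hw' hy'
        rw [hq11 j (by omega)] at hjy
        obtain ⟨h7, h8⟩ := h5 j y hj1 hj2 hjy u' w' hw' hy'
        obtain ⟨y', hy1, hy2⟩ := hL'.entries j hj1 (by omega)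
        obtain rfl : y' = y := Fin.ext (by omega)
        rw [hq10 _ h7, hq10 _ hy2]
        exact ⟨h7, h8⟩
      · intro _ j hj1 hj2
        rw [hq11 (s'.reg 13) (by omega), hx, hq10 x hxl]
        rcases Nat.lt_or_ge (s'.reg 14) j with hj | hj
        · rw [q11, if_pos (by omega), q10, if_pos rfl]
        · obtain ⟨y', hy1, hy2⟩ := hL'.entries j hj1 hj
          have := h6 (by omega) j hj1 hj
          rw [hq11 _ hj, hy1, hq10 _ hy2, ← hx, ← hy1]
          exact this
    · rcases hres with ⟨-, hres⟩ | ⟨hr1, -, -⟩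
      swap
      · change s1.reg 7 = 0 at h
        omega
      -- An unsuccessful scan says that every parent of an in-neighbour of the head is labelled
      -- already.
      have hdone : ∀ u w, par u = some w → (u, x) ∈ E → s'.arr 10 (w.val + 1) 0 ≠ 0 := by
        intro u w hw hux h0
        have hpu : par u ≠ none := by rw [hw]; simp
        have h7 := (hM.ne₁ u).2 hpu
        refine hres (s.arr 3 (u.val + 1) 0) (by omega) ?_ ⟨(hM.bit₃ u x hpu hwx).2 hux, ?_⟩
        · have h8 := hM.le₁ u
          exact Nat.lt_succ_of_le (Nat.div_le_div_right (by omega))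
        · have := (hL'.unl_iff u w hw).2 h0
          simpa only [hs.arr 3 (by simp)] using this
      simp only [wp, Expr.ev, reg_setReg, arr_setReg, Nat.reduceEqDiff, ↓reduceIte, r11, r13, r14, a10,
        a11]
      rw [show s'.reg 13 + 1 + s'.reg 14 = s'.reg 13 + s'.reg 14 + 1 by ring, hci]
      refine ⟨by omega, hs'.trans (.setReg (by simp)), h11, by omega, by omega, by omega,
        hL1.congr (by simp) (by simp) rfl rfl rfl rfl, h4, ?_, ?_⟩
      · intro j y hj1 hj2 hjy u w hw hy
        rcases Nat.lt_or_ge j (s'.reg 13) with hj | hj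
        · exact h5 j y hj1 hj hjy u w hw hy
        · obtain rfl : j = s'.reg 13 := by omega
          obtain rfl : y = x := Fin.ext (by omega)
          have h7 := hdone u w hw hy
          obtain ⟨i, hi1, hi2, hi3⟩ := hL'.mem w h7
          have := h6 (by omega) i hi1 hi2
          rw [hjy, hi3] at this
          exact ⟨h7, this⟩
      · intro h7 j hj1 hj2
        have h8 := h6 (by omega) j hj1 hj2
        have h9 := hL'.mono (s'.reg 13) (s'.reg 13 + 1) h1 (by omega) h7
        exact h8.trans (Nat.add_le_add_right h9 1)
  · rintro s' T' ⟨hs, h11, h1, h2, h3, hL', h4, h5, h6⟩ he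
    simp only [Expr.ev, indic_eq_zero] at he
    have h7 := hL'.tail_le hinj
    rw [← hM.card] at h7
    have : c * (s'.reg 13 + s'.reg 14) ≤ c * (2 * s.reg 3 + 1) :=
      Nat.mul_le_mul_left _ (by omega)
    refine hQ _ _ hs (by omega) hL' (twoEdgeLabel_eq_of_feasible hL'.sound (fun w => hL'.wt) h4 ?_)
    intro u w y hw hy hly
    obtain ⟨j, hj1, hj2, hj3⟩ := hL'.mem y hly
    exact h5 j y hj1 (by omega) hj3 u w hw hy

end Labels

/-- The unvisited nodes of the layers are put into the word array `4`, and register `15` becomes the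
least label of an `ST₁` branch, or `0`. -/
def findStage : Cmd :=
  .assign 15 (ᴄ 0) ;; .assign 20 (ᴄ 1) ;;
  .loop (ʀ 20 <ₑ ʀ 3 +ₑ ᴄ 1)
    (.assign 6 (.read 6 (ʀ 20) (ᴄ 0)) ;;
     .ite (.read 10 (ʀ 6) (ᴄ 0))
       (.setBit 4 (.read 10 (ʀ 6) (ᴄ 0)) (ʀ 20) true ;; advance 1 9 3 ;;
        .ite (ʀ 7)
          (.ite ((ʀ 15 =ₑ ᴄ 0) +ₑ (.read 10 (ʀ 6) (ᴄ 0) +ₑ ᴄ 1 <ₑ ʀ 15))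
            (.assign 15 (.read 10 (ʀ 6) (ᴄ 0) +ₑ ᴄ 1)) .skip)
          .skip)
       .skip ;;
     .assign 20 (ʀ 20 +ₑ ᴄ 1))

/-- A new layered network is generated. -/
def prepare : Cmd :=
  .emit .relabel ;; clearLabels ;; seedLabels ;; spreadLabels ;; findStage

/-! ### Assembling a new layered network -/

section Prepare

variable {n₁ n₂ lam N : ℕ} {E : Finset (Fin n₁ × Fin n₂)}

/-- Since the new stage is at least `2`, no ST₁ branch is adjacent to a WT₁ branch. Hence a shortest
path from an ST₁ branch starts with an arc to a node of nonzero stored label, and the minimum over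
these nodes determines the stage. -/
theorem layered_stage_cases {par : Parents n₁ n₂} {lab : Fin n₂ → ℕ} {r : ℕ}
    (hlab : ∀ w, (twoEdgeLabel E par (.inr w) = ⊤ ∧ lab w = 0) ∨
      twoEdgeLabel E par (.inr w) = lab w)
    (h2 : 2 ≤ (State.layered E par).stage)
    (h : (r = 0 ∧ ∀ u w, lab w ≠ 0 → (u, w) ∈ E → par u ≠ none) ∨
      ∃ u w, lab w ≠ 0 ∧ (u, w) ∈ E ∧ par u = none ∧ r = lab w + 1 ∧
        ∀ u' w', lab w' ≠ 0 → (u', w') ∈ E → par u' = none → r ≤ lab w' + 1) :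
    ((State.layered E par).stage = ⊤ ∧ r = 0) ∨ ((State.layered E par).stage = r ∧ 2 ≤ r) := by
  have hle : ∀ u, par u = none → (State.layered E par).stage ≤ twoEdgeLabel E par (.inl u) :=
    fun u hu => iInf₂_le u hu
  have key : ∀ u k, par u = none → ResPath E par (.inl u) k →
      ∃ w, lab w ≠ 0 ∧ (u, w) ∈ E ∧ lab w + 1 ≤ k := by
    intro u k hu hk
    obtain ⟨w, k', hw, rfl, hk'⟩ := exists_pred_of_inl hk
    have h3 := twoEdgeLabel_le hk'
    have h5 : twoEdgeLabel E par (.inr w) = lab w := by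
      rcases hlab w with ⟨h4, -⟩ | h4
      · rw [h4] at h3; simp at h3
      · exact h4
    refine ⟨w, fun h0 => ?_, hw, ?_⟩
    · have h6 := (h2.trans (hle u hu)).trans (twoEdgeLabel_inl_le hw)
      rw [h5, h0] at h6
      norm_num at h6
    · rw [h5] at h3
      exact Nat.succ_le_succ (by exact_mod_cast h3)
  rcases h with ⟨h0, h⟩ | ⟨u, w, hlw, hw, hu, hr, hmin⟩
  · refine Or.inl ⟨?_, h0⟩
    simp only [State.layered, iInf_eq_top]
    intro u hu
    by_contra hc
    obtain ⟨k, hk, -⟩ := exists_resPath_of_ne_top hc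
    obtain ⟨w, h3, h4, -⟩ := key u k hu hk
    exact h u w h3 h4 hu
  · refine Or.inr ⟨le_antisymm ?_ ?_, by omega⟩
    · refine (hle u hu).trans ((twoEdgeLabel_inl_le hw).trans ?_)
      rw [hr]
      rcases hlab w with ⟨-, h3⟩ | h3
      · exact absurd h3 hlw
      · rw [h3]; push_cast; exact le_rfl
    · simp only [State.layered, le_iInf_iff]
      intro u' hu'
      refine le_twoEdgeLabel fun k hk => ?_
      obtain ⟨w', h3, h4, h5⟩ := key u' k hu' hk
      exact_mod_cast (hmin u' w' h3 h4 hu').trans h5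

/-- ST₁ branches are never enumerated, since there may be far more than κ of them. Instead each
labelled V₂-node looks for an unmatched in-neighbour with its pointer; the value `0` in `[15]` means
that none has been found so far. -/
theorem wp_findStage (hlam : 0 < lam) {A : AdjLists E} {s : Store lam} {T : ℕ}
    {par : Parents n₁ n₂} (hinj : ∀ u u' w, par u = some w → par u' = some w → u = u')
    (hI : Input A s) (hM : TreeRep E s par) (hP : PosRep A s par) (hk : s.reg 3 ≤ n₁)
    (hN : n₁ + n₂ + 2 ≤ N)
    (hwt : ∀ w : Fin n₂, IsWT1 par w → s.arr 10 (w.val + 1) 0 = 0)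
    (hle : ∀ w : Fin n₂, s.arr 10 (w.val + 1) 0 ≤ n₁)
    (hlay : ∀ p c, 1 ≤ p → 1 ≤ c → s.bit 4 p c = false)
    {Q : Store lam → ℕ → Prop}
    (hQ : ∀ s' T', s.Same [6, 7, 15, 20] [9] [4] s' → PosRep A s' par →
      T' + 2 * posSum n₁ n₂ s ≤ T + 2 * posSum n₁ n₂ s' + 10 * s.reg 3 + 3 →
      posSum n₁ n₂ s ≤ posSum n₁ n₂ s' →
      (∀ p c, 1 ≤ p → 1 ≤ c → (s'.bit 4 p c = true ↔ ∃ w : Fin n₂,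
        s.arr 4 (w.val + 1) 0 = c ∧ s.arr 10 (w.val + 1) 0 = p)) →
      ((s'.reg 15 = 0 ∧ ∀ u w, s.arr 10 (w.val + 1) 0 ≠ 0 → (u, w) ∈ E → par u ≠ none) ∨
        ∃ u w, s.arr 10 (w.val + 1) 0 ≠ 0 ∧ (u, w) ∈ E ∧ par u = none ∧
          s'.reg 15 = s.arr 10 (w.val + 1) 0 + 1 ∧
          ∀ u' w', s.arr 10 (w'.val + 1) 0 ≠ 0 → (u', w') ∈ E → par u' = none →
            s'.reg 15 ≤ s.arr 10 (w'.val + 1) 0 + 1) → Q s' T') :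
    wp N findStage Q s T := by
  simp only [findStage, wp, Expr.ev]
  refine ⟨by omega, by omega, ?_⟩
  apply wp_loop (I := fun s' T' => s.Same [6, 7, 15, 20] [9] [4] s' ∧ PosRep A s' par ∧
      1 ≤ s'.reg 20 ∧ s'.reg 20 ≤ s.reg 3 + 1 ∧
      T' + 2 * posSum n₁ n₂ s + 10 ≤ T + 2 * posSum n₁ n₂ s' + 10 * s'.reg 20 + 2 ∧
      posSum n₁ n₂ s ≤ posSum n₁ n₂ s' ∧
      (∀ p c, 1 ≤ p → 1 ≤ c → (s'.bit 4 p c = true ↔ c < s'.reg 20 ∧ ∃ w : Fin n₂,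
        s.arr 4 (w.val + 1) 0 = c ∧ s.arr 10 (w.val + 1) 0 = p)) ∧
      ((s'.reg 15 = 0 ∧ ∀ u w, s.arr 4 (w.val + 1) 0 < s'.reg 20 → s.arr 10 (w.val + 1) 0 ≠ 0 →
        (u, w) ∈ E → par u ≠ none) ∨
        ∃ u w, s.arr 10 (w.val + 1) 0 ≠ 0 ∧ (u, w) ∈ E ∧ par u = none ∧
          s'.reg 15 = s.arr 10 (w.val + 1) 0 + 1 ∧
          ∀ u' w', s.arr 4 (w'.val + 1) 0 < s'.reg 20 → s.arr 10 (w'.val + 1) 0 ≠ 0 →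
            (u', w') ∈ E → par u' = none → s'.reg 15 ≤ s.arr 10 (w'.val + 1) 0 + 1))
      (M := T + 4 * (s.reg 3 * s.reg 3) + 10 * s.reg 3 + 2)
  · refine ⟨(Store.Same.setReg (by simp)).trans (.setReg (by simp)), hP.congr rfl rfl, by simp,
      by simp, by simp; omega, by simp, ?_, ?_⟩
    · intro p c hp hc
      simp [hlay p c hp hc]
      omega
    · left
      refine ⟨by simp, fun u w h h1 => ?_⟩
      simp only [reg_setReg, ↓reduceIte] at h
      exact absurd (hwt w (by_contra fun hc => by have := (hM.ne₂ w).2 hc; omega)) h1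
  · rintro s' T' ⟨-, hP', h1, h2, h3, -⟩
    have := hP'.posSum_le hinj (hM.card.symm.le)
    omega
  · rintro s' T' ⟨hs, hP', h1, h2, h3, h4, h5, h6⟩ he
    simp only [Expr.ev, ne_eq, indic_eq_zero, not_not, hs.reg 3 (by simp)] at he
    obtain ⟨x, e1, e2⟩ := hM.idx₂ _ h1 (by omega)
    have hx : ¬ IsWT1 par x := by rw [← hM.ne₂]; omega
    have hlt : ∀ w : Fin n₂, s.arr 4 (w.val + 1) 0 < s'.reg 20 + 1 → s.arr 10 (w.val + 1) 0 ≠ 0 →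
        w = x ∨ s.arr 4 (w.val + 1) 0 < s'.reg 20 := by
      intro w hw hw'
      by_cases hc : s.arr 4 (w.val + 1) 0 = s'.reg 20
      · exact Or.inl (hM.idx₂_inj (fun h => hw' (hwt w h)) (hc.trans e2.symm))
      · right; omega
    simp only [wp, Expr.ev, reg_setReg, arr_setReg, Nat.reduceEqDiff, ↓reduceIte,
      hs.arr 6 (by simp), hs.arr 10 (by simp), e1]
    refine ⟨by omega, fun hlx => ⟨h1, ?_⟩, fun hlx => ⟨by omega, ?_⟩⟩
    swap
    · refine ⟨hs.trans ((Store.Same.setReg (by simp)).trans (.setReg (by simp))),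
        hP'.congr rfl rfl, by simp, by simp; omega, by simp; omega, by simpa using h4, ?_, ?_⟩
      · intro p c hp hc
        simp only [bit_setReg, reg_setReg, ↓reduceIte, h5 p c hp hc]
        refine and_congr_left ?_
        rintro ⟨w, hw1, hw2⟩
        refine ⟨fun h => by omega, fun h => ?_⟩
        rcases hlt w (by omega) (by omega) with rfl | h7 <;> omega
      · refine h6.imp ?_ ?_
        · rintro ⟨h7, h8⟩
          refine ⟨h7, fun u w hw hw' => ?_⟩
          rcases hlt w hw hw' with rfl | hw2
          · exact absurd hlx hw'
          · exact h8 u w hw2 hw'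
        · rintro ⟨u, w, q1, q2, q3, q4, q5⟩
          refine ⟨u, w, q1, q2, q3, q4, fun u' w' hw hw' => ?_⟩
          rcases hlt w' hw hw' with rfl | hw2
          · exact absurd hlx hw'
          · exact q5 u' w' hw2 hw'
    set s0 := (s'.setReg 6 (x.val + 1)).setBit 4 (s.arr 10 (x.val + 1) 0) (s'.reg 20) true with hs0
    have hs00 : s.Same [6, 7, 15, 20] [9] [4] s0 :=
      hs.trans ((Store.Same.setReg (by simp)).trans (.setBit (by simp)))
    refine wp_advance₂ (A := A) (par := par) (w := x) (s := s0)
      (hI.congr (fun r hr => hs00.reg r (by simp; omega)) (fun a ha => hs00.arr a (by simp; omega))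
        (hs00.wrd 0 (by simp)))
      (hM.congr (hs00.reg 3 (by simp)) (fun a _ _ => hs00.arr a (by simp; omega))
        (hs00.wrd 2 (by simp)) (hs00.wrd 3 (by simp))) (hP'.congr rfl rfl) hN (by simp [hs0]) hx ?_
    intro s1 T1 hs1 hP1 c1 c2 hres
    rw [hs0, posSum_setBit, posSum_setReg] at c1 c2
    have hss1 : s.Same [6, 7, 15, 20] [9] [4] s1 :=
      hs00.trans (hs1.mono (by simp) (by simp) (by simp))
    have r6 : s1.reg 6 = x.val + 1 := by rw [hs1.reg 6 (by simp)]; simp [hs0]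
    have r15 : s1.reg 15 = s'.reg 15 := by rw [hs1.reg 15 (by simp)]; simp [hs0]
    have r20 : s1.reg 20 = s'.reg 20 := by rw [hs1.reg 20 (by simp)]; simp [hs0]
    have hlex := hle x
    have hbit : ∀ p c, 1 ≤ p → 1 ≤ c → (s1.bit 4 p c = true ↔ c < s'.reg 20 + 1 ∧ ∃ w : Fin n₂,
        s.arr 4 (w.val + 1) 0 = c ∧ s.arr 10 (w.val + 1) 0 = p) := by
      intro p c hp hc
      rw [bit_congr (hs1.wrd 4 (by simp)), hs0, bit_setBit _ _ _ _ _ _ _ _ hlam h1 hc]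
      split_ifs with hpc
      · obtain ⟨-, rfl, rfl⟩ := hpc
        simp only [true_iff]
        exact ⟨by omega, x, e2, rfl⟩
      · rw [bit_setReg, h5 p c hp hc]
        refine and_congr_left ?_
        rintro ⟨w, hw1, hw2⟩
        refine ⟨fun h => by omega, fun h => ?_⟩
        rcases hlt w (by omega) (by omega) with rfl | h7
        · exact absurd ⟨rfl, hw2.symm, by omega⟩ hpc
        · omega
    have hskip : ((s'.reg 15 = 0 ∧ ∀ u w, s.arr 4 (w.val + 1) 0 < s'.reg 20 + 1 →
          s.arr 10 (w.val + 1) 0 ≠ 0 → (u, w) ∈ E → par u ≠ none) ∨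
        ∃ u w, s.arr 10 (w.val + 1) 0 ≠ 0 ∧ (u, w) ∈ E ∧ par u = none ∧
          s'.reg 15 = s.arr 10 (w.val + 1) 0 + 1 ∧
          ∀ u' w', s.arr 4 (w'.val + 1) 0 < s'.reg 20 + 1 → s.arr 10 (w'.val + 1) 0 ≠ 0 →
            (u', w') ∈ E → par u' = none → s'.reg 15 ≤ s.arr 10 (w'.val + 1) 0 + 1) →
        T1 + 3 + 2 * posSum n₁ n₂ s + 10 ≤
          T + 2 * posSum n₁ n₂ s1 + 10 * (s'.reg 20 + 1) + 2 := by
      intro _; omega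
    simp only [r15, r20, r6, hss1.arr 10 (by simp), ne_eq, indic_eq_zero, not_or, not_and,
      Nat.add_eq_zero_iff, not_not, reg_setReg, Nat.reduceEqDiff, ↓reduceIte, posSum_setReg,
      bit_setReg]
    refine ⟨fun h => ⟨fun hc => ⟨by omega, by omega, ?_⟩, fun hc => ⟨by omega, ?_⟩⟩,
      fun h => ⟨by omega, ?_⟩⟩
    · refine ⟨hss1.trans ((Store.Same.setReg (by simp)).trans (.setReg (by simp))),
        hP1.congr rfl rfl, by omega, by omega, by omega, by omega, hbit, Or.inr ?_⟩
      rcases hres with ⟨hres, -⟩ | ⟨u, hu1, hu2, -⟩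
      · exact absurd hres h
      refine ⟨u, x, hlx, hu1, hu2, rfl, fun u' w' hw hw' hue hu' => ?_⟩
      rcases hlt w' hw hw' with rfl | hw2
      · exact le_rfl
      · rcases h6 with ⟨h7, h8⟩ | ⟨u₀, w₀, q1, q2, q3, q4, q5⟩
        · exact absurd hu' (h8 u' w' hw2 hw' hue)
        · have := q5 u' w' hw2 hw' hue hu'
          by_cases h9 : s.arr 10 (x.val + 1) 0 + 1 < s'.reg 15
          · omega
          · exact absurd (hc (by omega)) h9
    · refine ⟨hss1.trans (.setReg (by simp)),
        hP1.congr rfl rfl, by omega, by omega, by omega, by omega, hbit, ?_⟩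
      obtain ⟨hc1, hc2⟩ := hc
      rcases h6 with ⟨h7, h8⟩ | ⟨u₀, w₀, q1, q2, q3, q4, q5⟩
      · exact absurd h7 hc1
      refine Or.inr ⟨u₀, w₀, q1, q2, q3, q4, fun u' w' hw hw' hue hu' => ?_⟩
      rcases hlt w' hw hw' with rfl | hw2
      · omega
      · exact q5 u' w' hw2 hw' hue hu'
    · refine ⟨hss1.trans (.setReg (by simp)),
        hP1.congr rfl rfl, by omega, by omega, by omega, by omega, hbit, ?_⟩
      rcases hres with ⟨-, hres⟩ | ⟨u, -, -, hu3⟩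
      swap
      · omega
      refine h6.imp ?_ ?_
      · rintro ⟨h7, h8⟩
        refine ⟨h7, fun u w hw hw' hue => ?_⟩
        rcases hlt w hw hw' with rfl | hw2
        · exact hres u hue
        · exact h8 u w hw2 hw' hue
      · rintro ⟨u, w, q1, q2, q3, q4, q5⟩
        refine ⟨u, w, q1, q2, q3, q4, fun u' w' hw hw' hue hu' => ?_⟩
        rcases hlt w' hw hw' with rfl | hw2
        · exact absurd hu' (hres u' hue)
        · exact q5 u' w' hw2 hw' hue hu'
  · rintro s' T' ⟨hs, hP', h1, h2, h3, h4, h5, h6⟩ he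
    simp only [Expr.ev, indic_eq_zero, hs.reg 3 (by simp)] at he
    have hlt : ∀ w : Fin n₂, s.arr 4 (w.val + 1) 0 < s'.reg 20 := by
      intro w
      have := hM.le₂ w
      omega
    refine hQ _ _ hs hP' (by omega) h4 ?_ ?_
    · intro p c hp hc
      rw [h5 p c hp hc]
      refine ⟨fun h => h.2, fun h => ⟨?_, h⟩⟩
      obtain ⟨w, rfl, -⟩ := h
      exact hlt w
    · refine h6.imp ?_ ?_
      · rintro ⟨h7, h8⟩
        exact ⟨h7, fun u w => h8 u w (hlt w)⟩
      · rintro ⟨u, w, q1, q2, q3, q4, q5⟩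
        exact ⟨u, w, q1, q2, q3, q4, fun u' w' => q5 u' w' (hlt w')⟩

/-- The time for a new layered network, up to the positions in the lists. -/
def phaseCost (lam k : ℕ) : ℕ := (k + 1) * (k / lam + 1)

theorem wp_prepare (hlam : 0 < lam) {A : AdjLists E} {s : Store lam} {T : ℕ}
    {par : Parents n₁ n₂} {label : Fin n₁ ⊕ Fin n₂ → ℕ∞} {stage : ℕ∞} {visited : Set (Fin n₂)}
    (h : StageRep A s par label stage visited)
    (hr : Reached E s.log ⟨par, label, stage, visited, []⟩) (hst : stage ≠ ⊤) (hs1 : 1 ≤ stage)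
    (hno : ∀ u w, ¬ State.MergerArc E ⟨par, label, stage, visited, []⟩ u w)
    (hl1 : lam ≤ n₁) (hN : 2 * (n₁ + n₂ + 1) ≤ N) {Q : Store lam → ℕ → Prop}
    (hQ : ∀ s' T', StageRep A s' par (State.layered E par).label (State.layered E par).stage ∅ →
      Reached E s'.log (State.layered E par) → s'.reg 3 = s.reg 3 →
      (((State.layered E par).stage = ⊤ ∧ s'.reg 15 = 0) ∨
        ((State.layered E par).stage = s'.reg 15 ∧ 2 ≤ s'.reg 15)) →
      T' + 2 * posSum n₁ n₂ s ≤ T + 2 * posSum n₁ n₂ s' + 73 * phaseCost lam (s.reg 3) →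
      posSum n₁ n₂ s ≤ posSum n₁ n₂ s' → Q s' T') :
    wp N prepare Q s T := by
  have hinj := h.inv.inj
  have hk : s.reg 3 ≤ n₁ := by
    rw [h.tree.card]
    exact (card_treeEdges_le h.inv.edge hinj).trans matchingNumber_le_left
  -- The finished stage had number at least `1` and has been exhausted.
  have hstage2 : 2 ≤ (State.layered E par).stage :=
    le_trans (by have := add_le_add_left hs1 1; norm_num at this; simpa [add_comm] using this) (h.inv.stage_lt hst hno)
  simp only [prepare, wp]
  refine wp_clearLabels hlam (s := s.addLog .relabel) (h.tree.congr rfl (fun _ _ _ => rfl) rfl rfl)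
    hk (by omega) ?_ ?_ h.unl ?_
  · intro p c hp hc hb
    obtain ⟨w, h1, h2, -⟩ := (h.layers p c hp hc).1 hb
    exact ⟨w, h1, h2⟩
  · intro w hw
    have h1 := (h.inv.wt w hw).1
    rcases h.lab w with ⟨h2, h3⟩ | h2
    · exact h3
    · rw [h1] at h2
      exact_mod_cast h2.symm
  intro s1 T1 f1 t1 z1 b1 u1
  have g1 : s.reg 3 = s1.reg 3 := (f1.reg 3 (by simp)).symm
  have I1 : Input A s1 := h.input.congr (fun r hr => f1.reg r (by simp; omega))
    (fun a ha => f1.arr a (by simp; omega)) (f1.wrd 0 (by simp))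
  have M1 : TreeRep E s1 par := h.tree.congr (f1.reg 3 (by simp))
    (fun a _ _ => f1.arr a (by simp; omega)) (f1.wrd 2 (by simp)) (f1.wrd 3 (by simp))
  have P1 : PosRep A s1 par := h.pos.congr (f1.arr 8 (by simp)) (f1.arr 9 (by simp))
  have p1 : posSum n₁ n₂ s1 = posSum n₁ n₂ s := posSum_congr (f1.arr 8 (by simp)) (f1.arr 9 (by simp))
  refine wp_seedLabels hlam hinj I1 M1 P1 (g1 ▸ hk) (by omega) z1 ?_ ?_
  · intro c hc
    rw [u1 c hc, ← g1]; rfl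
  intro s2 T2 f2 P2 t2 p2 L2 l2 e2
  have g2 : s2.reg 3 = s1.reg 3 := f2.reg 3 (by simp)
  have I2 : Input A s2 := I1.congr (fun r hr => f2.reg r (by simp; omega))
    (fun a ha => f2.arr a (by simp; omega)) (f2.wrd 0 (by simp))
  have M2 : TreeRep E s2 par := M1.congr (f2.reg 3 (by simp))
    (fun a _ _ => f2.arr a (by simp; omega)) (f2.wrd 2 (by simp)) (f2.wrd 3 (by simp))
  refine wp_spreadLabels hlam hinj I2 M2 (by omega) hl1 hN L2 l2 e2 ?_
  intro s3 T3 f3 t3 L3 c3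
  have g3 : s3.reg 3 = s2.reg 3 := f3.reg 3 (by simp)
  have I3 : Input A s3 := I2.congr (fun r hr => f3.reg r (by simp; omega))
    (fun a ha => f3.arr a (by simp; omega)) (f3.wrd 0 (by simp))
  have M3 : TreeRep E s3 par := M2.congr (f3.reg 3 (by simp))
    (fun a _ _ => f3.arr a (by simp; omega)) (f3.wrd 2 (by simp)) (f3.wrd 3 (by simp))
  have P3 : PosRep A s3 par := P2.congr (f3.arr 8 (by simp)) (f3.arr 9 (by simp))
  have p3 : posSum n₁ n₂ s3 = posSum n₁ n₂ s2 := posSum_congr (f3.arr 8 (by simp)) (f3.arr 9 (by simp))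
  have htl := L3.tail_le hinj
  rw [← M3.card] at htl
  refine wp_findStage hlam hinj I3 M3 P3 (by omega) (by omega) (fun w hw => L3.wt hw)
    (fun w => (L3.le w).trans (by omega)) ?_ ?_
  · intro p c hp hc
    rw [bit_congr (f3.wrd 4 (by simp)), bit_congr (f2.wrd 4 (by simp)), b1 p c hp hc]
  intro s4 T4 f4 P4 t4 p4 b4 r4
  have g4 : s4.reg 3 = s3.reg 3 := f4.reg 3 (by simp)
  have a10 := f4.arr 10 (by simp)
  refine hQ _ _ ⟨stageInv_layered h.inv.edge hinj,
    I3.congr (fun r hr => f4.reg r (by simp; omega))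
      (fun a ha => f4.arr a (by simp; omega)) (f4.wrd 0 (by simp)),
    M3.congr (f4.reg 3 (by simp))
      (fun a _ _ => f4.arr a (by simp; omega)) (f4.wrd 2 (by simp)) (f4.wrd 3 (by simp)),
    P4, ?_, ?_, ?_, ?_⟩ ?_ (by omega) (layered_stage_cases c3 hstage2 r4) ?_ (by omega)
  · intro w
    rw [a10]
    exact c3 w
  · intro p c hp hc
    rw [b4 p c hp hc, a10, f4.arr 4 (by simp)]
    simp
  · intro c hc
    rw [bit_congr (f4.wrd 5 (by simp)), g4]
    exact L3.unl_le c hc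
  · intro w
    rw [a10]
    exact (L3.le w).trans (by omega)
  · have := hr.step (.relabel rfl hst hno)
    rw [f4.log, f3.log, f2.log, f1.log]
    exact this
  · rw [reg_addLog] at t1
    have e : phaseCost lam (s.reg 3) = (s.reg 3 + 1) * (s.reg 3 / lam + 1) := rfl
    rw [g3, g2, ← g1] at t4
    rw [g2, ← g1] at t3
    rw [← g1] at t2
    generalize s.reg 3 / lam = L at *
    generalize s.reg 3 = k at *
    -- The four procedures and the announcement together: 27 is 5 + 12 + 10 from clearing, seeding
    -- and the search for the stage, 12 collects the constants, and the product comes from the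
    -- scans.
    have : (4 * (L + 1) + 19) * (2 * k + 1) + 27 * k + 12 ≤ 73 * phaseCost lam k := by
      rw [e]; nlinarith
    omega

/-- The untouched zeros of the memory are correct data for the exhausted greedy stage: pointers at
the start of the lists, empty layers, and label `0` for all of V₂, because the labels are still
those of the empty tree. -/
theorem GreedyInv.stageRep {A : AdjLists E} {s : Store lam} {par : Parents n₁ n₂}
    {visited : Set (Fin n₂)} (h : GreedyInv A s par visited) :
    StageRep A s par (State.initial E).label (State.initial E).stage visited where
  inv := h.inv
  input := h.input
  tree := h.tree
  pos := ⟨fun u => by rw [h.zero 8 (by simp) (by simp)]; intro i hi; omega,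
    fun u => by rw [h.zero 9 (by simp) (by simp)]; intro i hi; omega,
    fun u _ => h.zero 8 (by simp) (by simp) _ _, fun u _ => h.zero 9 (by simp) (by simp) _ _⟩
  lab w := Or.inr (by
    rw [h.zero 10 (by simp) (by simp)]
    exact twoEdgeLabel_none_inr w)
  layers p c hp hc := by
    rw [h.layers p c hc]
    simp only [Bool.false_eq_true, false_iff, not_exists, not_and]
    intro w _ h2
    rw [h.zero 10 (by simp) (by simp)] at h2
    omega
  unl c _ hb := by
    rw [h.unl c] at hb
    simp at hb
  lab_le w := by simp [h.zero 10]

end Prepare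

/-! ### Depth-first search for successful paths -/

/-- The node `[6]` becomes a child of the root `[5]`. -/
def pushMerge : Cmd :=
  .emit (.merge (ʀ 6) (ʀ 5)) ;; .assign 12 (ʀ 12 +ₑ ᴄ 1) ;;
  .write 12 (ʀ 12) (ᴄ 0) (ʀ 6) ;; .write 13 (ʀ 12) (ᴄ 0) (ʀ 5)

/-- The last merger is undone. -/
def popMerge : Cmd :=
  .emit .backtrack ;;
  .setBit 4 (.read 10 (.read 13 (ʀ 12) (ᴄ 0)) (ᴄ 0)) (.read 4 (.read 13 (ʀ 12) (ᴄ 0)) (ᴄ 0)) false ;;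
  .assign 12 (ʀ 12 -ₑ ᴄ 1)

/-- Register `6` becomes the right child of the `ST₂` branch, and register `7` the root to which it
can be merged, or `0`. -/
def findNext : Cmd :=
  .assign 6 (.read 7 (.read 13 (ʀ 12) (ᴄ 0)) (ᴄ 0)) ;;
  .assign 22 (.read 10 (.read 13 (ʀ 12) (ᴄ 0)) (ᴄ 0)) ;;
  .ite (ʀ 22 =ₑ ᴄ 1) (advance 0 8 4)
    (.assign 9 (.read 3 (ʀ 6) (ᴄ 0)) ;; .assign 10 (ʀ 22 -ₑ ᴄ 1) ;;
      .assign 11 (ʀ 17 /ₑ ʀ 2 +ₑ ᴄ 1) ;; scan 2 4 ;;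
      .ite (ʀ 7) (.assign 7 (.read 6 (ʀ 7) (ᴄ 0))) .skip)

/-- One step of a sequence of mergers. -/
def searchStep : Cmd :=
  findNext ;;
  .ite (ʀ 7) (.assign 5 (ʀ 7) ;; pushMerge ;; .ite (.read 10 (ʀ 5) (ᴄ 0)) .skip augmentPath) popMerge

section SearchRep

variable {n₁ n₂ lam N : ℕ} {E : Finset (Fin n₁ × Fin n₂)} {A : AdjLists E}

theorem StageRep.congr {s s' : Store lam} {par : Parents n₁ n₂} {label : Fin n₁ ⊕ Fin n₂ → ℕ∞}
    {stage : ℕ∞} {visited : Set (Fin n₂)} (h : StageRep A s par label stage visited)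
    (hr : ∀ r < 4, s'.reg r = s.reg r) (ha : ∀ a, a ≤ 10 → a ≠ 8 → a ≠ 9 → s'.arr a = s.arr a)
    (hw : ∀ a ≤ 5, s'.wrd a = s.wrd a) (hP : PosRep A s' par) :
    StageRep A s' par label stage visited where
  inv := h.inv
  input := h.input.congr (fun r h => hr r (by omega)) (fun a h => ha a (by omega) (by omega) (by omega))
    (hw 0 (by simp))
  tree := h.tree.congr (hr 3 (by simp)) (fun a _ _ => ha a (by omega) (by omega) (by omega))
    (hw 2 (by simp)) (hw 3 (by simp))
  pos := hP
  lab w := by rw [ha 10 (by simp) (by simp) (by simp)]; exact h.lab w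
  layers p c hp hc := by
    rw [bit_congr (hw 4 (by simp)), ha 10 (by simp) (by simp) (by simp),
      ha 4 (by simp) (by simp) (by simp)]
    exact h.layers p c hp hc
  unl c hc := by
    rw [bit_congr (hw 5 (by simp)), hr 3 (by simp)]
    exact h.unl c hc
  lab_le w := by
    rw [ha 10 (by simp) (by simp) (by simp)]
    exact h.lab_le w

/-- The representation of a state during a sequence of mergers; `par₀` is the tree without the
mergers of the current sequence. -/
structure SearchRep (A : AdjLists E) (s : Store lam) (par₀ : Parents n₁ n₂)
    (label : Fin n₁ ⊕ Fin n₂ → ℕ∞) (stage : ℕ∞) (visited : Set (Fin n₂))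
    (fs : List (Frame n₁ n₂)) (par : Parents n₁ n₂) : Prop where
  rep : StageRep A s par₀ label stage visited
  idx : ∀ w : Fin n₂, label (.inr w) ≠ 0 → s.arr 4 (w.val + 1) 0 ≤ s.reg 17
  chain : MergeChain E par₀ label stage visited fs par
  reached : Reached E s.log ⟨par, label, stage, visited, fs⟩
  stack : StackRep s fs
  depth : s.reg 12 = fs.length
  start : ∀ f, fs.getLast? = some f → s.reg 4 = f.node.val + 1
  roots : ∀ f ∈ fs, label (.inr f.root) ≠ 0

open Classical in
/-- The number of nodes with a non-zero label that are unvisited and do not lie on the path. -/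
noncomputable def freeCount (label : Fin n₁ ⊕ Fin n₂ → ℕ∞) (visited : Set (Fin n₂))
    (fs : List (Frame n₁ n₂)) : ℕ :=
  (Finset.univ.filter fun w : Fin n₂ =>
    label (.inr w) ≠ 0 ∧ w ∉ visited ∧ ∀ f ∈ fs, f.root ≠ w).card

theorem freeCount_cons {label : Fin n₁ ⊕ Fin n₂ → ℕ∞} {visited : Set (Fin n₂)}
    {fs : List (Frame n₁ n₂)} {f : Frame n₁ n₂} (h0 : label (.inr f.root) ≠ 0)
    (hv : f.root ∉ visited) (hf : ∀ g ∈ fs, g.root ≠ f.root) :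
    freeCount label visited (f :: fs) + 1 = freeCount label visited fs := by
  classical
  rw [freeCount, freeCount, ← Finset.card_insert_of_notMem (a := f.root) (by simp)]
  congr 1
  ext w
  simp only [List.mem_cons, forall_eq_or_imp, Finset.mem_insert, Finset.mem_filter,
    Finset.mem_univ, true_and]
  by_cases hw : w = f.root
  · subst hw
    simp only [true_or, true_iff]
    exact ⟨h0, hv, hf⟩
  · simp only [hw, false_or, Ne.symm hw, ne_eq, Ne.symm hw, not_false_eq_true, true_and]

theorem freeCount_anti {label : Fin n₁ ⊕ Fin n₂ → ℕ∞} {visited visited' : Set (Fin n₂)}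
    {fs fs' : List (Frame n₁ n₂)} (h : ∀ w, label (.inr w) ≠ 0 →
      (w ∈ visited ∨ ∃ f ∈ fs, f.root = w) → (w ∈ visited' ∨ ∃ f ∈ fs', f.root = w)) :
    freeCount label visited' fs' ≤ freeCount label visited fs := by
  refine Finset.card_le_card fun w => ?_
  simp only [Finset.mem_filter, Finset.mem_univ, true_and]
  rintro ⟨h0, h1, h2⟩
  refine ⟨h0, fun hv => ?_, fun f hf e => ?_⟩
  · rcases h w h0 (Or.inl hv) with h3 | ⟨f, hf, e⟩
    · exact h1 h3
    · exact h2 f hf e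
  · rcases h w h0 (Or.inr ⟨f, hf, e⟩) with h3 | ⟨f, hf, e⟩
    · exact h1 h3
    · exact h2 f hf e

/-- The effect of `pushMerge`. -/
structure Pushed (s s' : Store lam) (v w : ℕ) : Prop where
  depth : s'.reg 12 = s.reg 12 + 1
  reg : ∀ r, r ≠ 12 → s'.reg r = s.reg r
  arr : ∀ a, a ≠ 12 → a ≠ 13 → s'.arr a = s.arr a
  arr₁₂ : ∀ i, s'.arr 12 i 0 = if i = s.reg 12 + 1 then v else s.arr 12 i 0
  arr₁₃ : ∀ i, s'.arr 13 i 0 = if i = s.reg 12 + 1 then w else s.arr 13 i 0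
  wrd : s'.wrd = s.wrd
  log : s'.log = s.log ++ [.merge v w]

theorem wp_pushMerge {s : Store lam} {T : ℕ} (h12 : s.reg 12 + 1 ≤ N) (h6 : s.reg 6 ≤ N)
    (h5 : s.reg 5 ≤ N) {Q : Store lam → ℕ → Prop}
    (hQ : ∀ s', Pushed s s' (s.reg 6) (s.reg 5) → Q s' (T + 4)) : wp N pushMerge Q s T := by
  simp only [pushMerge, wp, Expr.ev, reg_setReg, reg_setArr, reg_addLog, Nat.reduceEqDiff,
    ↓reduceIte]
  refine ⟨h12, h6, h5, hQ _ ⟨by simp, ?_, ?_, by simp, by simp, rfl, by simp [Op.map, Expr.ev]⟩⟩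
  · intro r hr
    simp [hr]
  · intro a h1 h2
    simp [h1, h2]

theorem Pushed.stack {s s' : Store lam} {fs : List (Frame n₁ n₂)} {f : Frame n₁ n₂}
    (h : Pushed s s' (f.node.val + 1) (f.root.val + 1)) (hd : s.reg 12 = fs.length)
    (hs : StackRep s fs) : StackRep s' (f :: fs) := by
  refine ⟨by rw [h.arr₁₂, if_pos (by rw [hd])], by rw [h.arr₁₃, if_pos (by rw [hd])],
    hs.congr fun i hi => ?_⟩
  rw [h.arr₁₂, h.arr₁₃, if_neg (by omega), if_neg (by omega)]
  exact ⟨rfl, rfl⟩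

theorem Pushed.stageRep {s s' : Store lam} {v w : ℕ} {par : Parents n₁ n₂}
    {label : Fin n₁ ⊕ Fin n₂ → ℕ∞} {stage : ℕ∞} {visited : Set (Fin n₂)}
    (hp : Pushed s s' v w) (h : StageRep A s par label stage visited) :
    StageRep A s' par label stage visited :=
  h.congr (fun r _ => hp.reg r (by omega)) (fun a _ _ _ => hp.arr a (by omega) (by omega))
    (fun a _ => by rw [hp.wrd]) (h.pos.congr (hp.arr 8 (by simp) (by simp))
      (hp.arr 9 (by simp) (by simp)))

variable {s s' : Store lam} {T : ℕ} {par₀ par : Parents n₁ n₂} {label : Fin n₁ ⊕ Fin n₂ → ℕ∞}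
  {stage : ℕ∞} {visited : Set (Fin n₂)} {fs rest : List (Frame n₁ n₂)} {f : Frame n₁ n₂}

theorem SearchRep.length_le (h : SearchRep A s par₀ label stage visited fs par) (hst : stage ≠ ⊤) :
    fs.length ≤ n₂ := by
  have := (h.chain.par_eq h.rep.inv hst).2.2.2.length_le_card
  simpa using this

theorem SearchRep.extend (h : SearchRep A s par₀ label stage visited fs par) (hst : stage ≠ ⊤)
    {u : Fin n₁} {w : Fin n₂} (ha : State.MergerArc E ⟨par, label, stage, visited, fs⟩ u w)
    (h0 : label (.inr w) ≠ 0) (hp : Pushed s s' (u.val + 1) (w.val + 1))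
    (h4 : fs = [] → s.reg 4 = u.val + 1) :
    SearchRep A s' par₀ label stage visited (⟨u, par u, w⟩ :: fs)
      (Function.update par u (some w)) where
  rep := hp.stageRep h.rep
  idx w hw := by
    rw [hp.arr 4 (by simp) (by simp), hp.reg 17 (by simp)]
    exact h.idx w hw
  chain := h.chain.cons_of_mergerArc h.rep.inv hst ha
  reached := by
    rw [hp.log]
    exact h.reached.step (.extend ha h0)
  stack := hp.stack (f := ⟨u, par u, w⟩) h.depth h.stack
  depth := by rw [hp.depth, h.depth]; rfl
  start g hg := by
    rw [hp.reg 4 (by simp)]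
    cases fs with
    | nil =>
      simp only [List.getLast?_singleton, Option.some.injEq] at hg
      rw [← hg, h4 rfl]
    | cons f fs => exact h.start g (by simpa using hg)
  roots g hg := by
    rcases List.mem_cons.1 hg with rfl | hg
    · exact h0
    · exact h.roots g hg

/-- A push uses up one free node. With the potential `2 * freeCount + depth` it therefore gains one
unit, and a pop gains one through the depth. -/
theorem SearchRep.freeCount_extend (h : SearchRep A s par₀ label stage visited fs par)
    (hst : stage ≠ ⊤)
    {u : Fin n₁} {w : Fin n₂} (ha : State.MergerArc E ⟨par, label, stage, visited, fs⟩ u w)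
    (h0 : label (.inr w) ≠ 0) :
    freeCount label visited (⟨u, par u, w⟩ :: fs) + 1 = freeCount label visited fs := by
  have hc := h.chain.cons_of_mergerArc h.rep.inv hst ha
  have hn := (hc.par_eq h.rep.inv hst).2.2.2
  simp only [List.map_cons, List.nodup_cons, List.mem_map, not_exists, not_and] at hn
  exact freeCount_cons h0 ha.2.2.1 hn.1

/-- The modified tree becomes the new reference tree with an empty stack. Matched sets only grow, so
pointers stay valid; the only V₂-node that gets a number has label `0`, so the numbers used in the
layers are unchanged. The log is masked in the frame condition because the push before it has
extended it. -/
theorem wp_augmentSearch (hlam : 0 < lam) (h : SearchRep A s par₀ label stage visited fs par)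
    (hst : stage ≠ ⊤) {u : Fin n₁} {w : Fin n₂}
    (ha : State.MergerArc E ⟨par, label, stage, visited, fs⟩ u w) (h0 : label (.inr w) = 0)
    (hp : Pushed s s' (u.val + 1) (w.val + 1)) (h4 : fs = [] → s.reg 4 = u.val + 1)
    (h5 : s.reg 5 = w.val + 1) (hN : n₁ + n₂ + 2 ≤ N) {Q : Store lam → ℕ → Prop}
    (hQ : ∀ s₁ T', s.Same [3, 12, 20, 21] [2, 3, 4, 5, 6, 7, 12, 13] [2, 3, 4] { s₁ with log := s.log } →
      SearchRep A s₁ (Function.update par u (some w)) label stage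
        (visited ∪ {r | ∃ g ∈ (⟨u, par u, w⟩ : Frame n₁ n₂) :: fs, g.root = r}) []
        (Function.update par u (some w)) →
      (∀ u', par₀ u' ≠ none → Function.update par u (some w) u' ≠ none) →
      (∀ w : Fin n₂, label (.inr w) ≠ 0 → s₁.arr 4 (w.val + 1) 0 = s.arr 4 (w.val + 1) 0) →
      s₁.reg 3 = s.reg 3 + 1 → T' ≤ T + 17 * matchingNumber E + 8 → Q s₁ T') :
    wp N augmentPath Q s' T := by
  have hch := h.chain.cons_of_mergerArc h.rep.inv hst ha
  have hinv := hch.stageInv_success h.rep.inv hst h0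
  obtain ⟨f₀, hf₀⟩ : ∃ f₀, ((⟨u, par u, w⟩ : Frame n₁ n₂) :: fs).getLast? = some f₀ :=
    ⟨_, List.getLast?_eq_some_getLast (by simp)⟩
  have hflip := hch.flipSpec h.rep.inv hst h0 hf₀
  have hcard := card_treeEdges_le hinv.edge hinv.inj
  have hκ : matchingNumber E ≤ n₁ := matchingNumber_le_left
  have hrep := hp.stageRep h.rep
  have hr := h.reached.augment ha h0
  refine wp_augmentPath hlam hrep.input hrep.tree hflip (by rw [hp.depth, h.depth]; rfl)
    (hp.stack (f := ⟨u, par u, w⟩) h.depth h.stack) ?_ (by rw [hp.reg 5 (by simp), h5])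
    (hcard.trans hκ) hN ?_
  · rw [hp.reg 4 (by simp)]
    cases fs with
    | nil =>
      simp only [List.getLast?_singleton, Option.some.injEq] at hf₀
      rw [← hf₀, h4 rfl]
    | cons f fs => exact h.start f₀ (by simpa using hf₀)
  intro s₁ T' hs hT h12 htree e4 e4' e6 hbit
  have hreg : ∀ r, r ∉ [3, 12, 20, 21] → s₁.reg r = s.reg r := by
    intro r hr
    rw [hs.reg r hr, hp.reg r (by rintro rfl; simp at hr)]
  have harr : ∀ a, a ∉ [2, 3, 4, 5, 6, 7, 12, 13] → s₁.arr a = s.arr a := by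
    intro a ha
    simp only [List.mem_cons, List.not_mem_nil, or_false, not_or] at ha
    rw [hs.arr a (by simp [ha]), hp.arr a (by simp [ha]) (by simp [ha])]
  have hwrd : ∀ a, a ∉ [2, 3, 4] → s₁.wrd a = s.wrd a := by
    intro a ha
    rw [hs.wrd a ha, hp.wrd]
  have hlab : ∀ w : Fin n₂, (label (.inr w) = ⊤ ∧ s₁.arr 10 (w.val + 1) 0 = 0) ∨
      label (.inr w) = s₁.arr 10 (w.val + 1) 0 := by
    intro w
    rw [harr 10 (by simp)]
    exact h.rep.lab w
  have hlab0 : ∀ w : Fin n₂, label (.inr w) = 0 → s₁.arr 10 (w.val + 1) 0 = 0 := by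
    intro w hw
    rcases hlab w with ⟨-, h⟩ | h
    · exact h
    · rw [hw] at h; exact_mod_cast h.symm
  have hne : ∀ w' : Fin n₂, label (.inr w') ≠ 0 → s₁.arr 4 (w'.val + 1) 0 = s.arr 4 (w'.val + 1) 0 := by
    intro w' hw'
    rw [e4 w' (by rintro rfl; exact hw' h0), hp.arr 4 (by simp) (by simp)]
  have h3 : s₁.reg 3 = s.reg 3 + 1 := by
    rw [htree.card, hflip.card, h.rep.tree.card]
  refine hQ _ _ ⟨hreg, harr, hwrd, rfl⟩ ⟨⟨hinv, ?_, htree, ⟨?_, ?_, ?_, ?_⟩, hlab, ?_, ?_, ?_⟩, ?_, .nil, ?_, trivial, h12,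
    by simp, by simp⟩ ?_ hne h3 (by omega)
  · exact h.rep.input.congr (fun r hr => hreg r (by simp; omega)) (fun a ha => harr a (by simp; omega))
      (hwrd 0 (by simp))
  · intro u'
    rw [harr 8 (by simp)]
    refine (h.rep.pos.pos₁ u').mono fun x => ?_
    rw [mem_matched₂, mem_matched₂, hflip.wt_iff]
    tauto
  · intro u'
    rw [harr 9 (by simp)]
    refine (h.rep.pos.pos₂ u').mono fun x => ?_
    rw [mem_matched₁, mem_matched₁, ne_eq, ne_eq, hflip.none_iff]
    tauto
  · intro u' hu'
    rw [harr 8 (by simp)]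
    exact h.rep.pos.zero₁ u' ((hflip.none_iff u').1 hu').1
  · intro w' hw'
    rw [harr 9 (by simp)]
    exact h.rep.pos.zero₂ w' ((hflip.wt_iff w').1 hw').1
  · intro p c hpp hc
    rw [hbit p c hc, bit_congr (congrFun hp.wrd 4), h.rep.layers p c hpp hc,
      hp.arr 10 (by simp) (by simp), harr 10 (by simp)]
    rw [harr 10 (by simp)] at hlab0
    constructor
    · rintro ⟨⟨x, rfl, rfl, hx⟩, hnot⟩
      have hx0 : label (.inr x) ≠ 0 := fun e => by
        have := hlab0 x e
        omega
      refine ⟨x, hne x hx0, rfl, ?_⟩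
      rintro (hv | ⟨g, hg, rfl⟩)
      · exact hx hv
      · exact hnot ⟨g, hg, rfl, (hne _ hx0).symm⟩
    · rintro ⟨x, rfl, rfl, hx⟩
      have hx0 : label (.inr x) ≠ 0 := fun e => by
        have := hlab0 x e
        omega
      simp only [Set.mem_union, not_or] at hx
      refine ⟨⟨x, (hne x hx0).symm, rfl, hx.1⟩, ?_⟩
      rintro ⟨g, hg, -, e⟩
      have := htree.idx₂_inj (fun hwt => hx0 (hinv.wt x hwt).1) e
      exact hx.2 ⟨g, hg, this.symm⟩
  · intro c hc
    rw [bit_congr (hwrd 5 (by simp)), h3]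
    intro hb
    have := h.rep.unl c hc hb
    omega
  · intro x
    rw [harr 10 (by simp)]
    exact h.rep.lab_le x
  · intro x hx
    rw [hne x hx, hreg 17 (by simp)]
    exact h.idx x hx
  · rw [hs.log, hp.log]
    exact hr
  · intro u' hu'
    rw [ne_eq, hflip.none_iff]
    tauto

/-- The stored tree never contained the merger, so undoing it only means lowering the stack and
deleting the root from its layer. -/
theorem wp_popMerge (hlam : 0 < lam) (h : SearchRep A s par₀ label stage visited (f :: rest) par)
    (hst : stage ≠ ⊤)
    (hno : ∀ u w, ¬ State.MergerArc E ⟨par, label, stage, visited, f :: rest⟩ u w)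
    (hN : n₁ + n₂ + 2 ≤ N) {Q : Store lam → ℕ → Prop}
    (hQ : ∀ s', (∀ r, r ≠ 12 → s'.reg r = s.reg r) → s'.arr = s.arr →
      SearchRep A s' par₀ label stage (insert f.root visited) rest
        (Function.update par f.node f.old) → Q s' (T + 3)) :
    wp N popMerge Q s T := by
  have hlen := h.length_le hst
  have h0 := h.roots f (by simp)
  have hd := h.depth
  simp only [List.length_cons] at hlen hd
  obtain ⟨e1, e2, e3⟩ := h.stack
  have hnw : ¬ IsWT1 par₀ f.root := fun hwt => h0 (h.rep.inv.wt _ hwt).1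
  have h4 := (h.rep.tree.ne₂ f.root).2 hnw
  simp only [popMerge, wp, Expr.ev, reg_addLog, arr_addLog, hd, e2, reg_setBit]
  refine ⟨by omega, by omega, hQ _ ?_ rfl ⟨⟨h.chain.stageInv_fail h.rep.inv hst h0 hno,
    h.rep.input.congr ?_ (fun _ _ => rfl) rfl,
    h.rep.tree.congr (by simp) (fun _ _ _ => rfl) rfl rfl, h.rep.pos.congr rfl rfl, h.rep.lab, ?_, ?_, h.rep.lab_le⟩, h.idx,
    h.chain.tail_fail h.rep.inv hst, ?_, e3.congr fun _ _ => ⟨rfl, rfl⟩, ?_, ?_, ?_⟩⟩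
  · intro r hr
    simp [hr]
  · intro r hr
    simp [show r ≠ 12 by omega]
  · intro p c hp hc
    rw [bit_setReg, bit_setBit _ _ _ _ _ _ _ _ hlam (by omega) hc]
    simp only [arr_setReg, arr_setBit, arr_addLog, true_and]
    split_ifs with hpc
    · simp only [Bool.false_eq_true, Set.mem_insert_iff, not_or, false_iff, not_exists, not_and]
      intro x hx1 hx2 hx3
      exact absurd (h.rep.tree.idx₂_inj hnw (hpc.2.symm.trans hx1.symm)).symm hx3
    · rw [bit_addLog, h.rep.layers p c hp hc]
      refine exists_congr fun x => and_congr_right fun hx1 => and_congr_right fun hx2 => ?_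
      rw [Set.mem_insert_iff, not_or]
      refine ⟨fun hv => ⟨?_, hv⟩, fun hv => hv.2⟩
      rintro rfl
      exact hpc ⟨hx2.symm, hx1.symm⟩
  · intro c hc
    simp only [reg_setReg, bit_setReg, Nat.reduceEqDiff, ↓reduceIte, reg_setBit, reg_addLog]
    rw [bit_setBit_ne _ _ _ _ (by simp)]
    exact h.rep.unl c hc
  · simp only [log_setReg, log_setBit, log_addLog]
    exact h.reached.step (.backtrack rfl hno)
  · simp
  · intro g hg
    simp only [reg_setReg, Nat.reduceEqDiff, ↓reduceIte, reg_setBit, reg_addLog]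
    refine h.start g ?_
    cases rest with
    | nil => simp at hg
    | cons f' fs => simpa using hg
  · exact fun g hg => h.roots g (by simp [hg])

end SearchRep

section Search

variable {n₁ n₂ lam N : ℕ} {E : Finset (Fin n₁ × Fin n₂)} {A : AdjLists E}
variable {s s' : Store lam} {T : ℕ} {par₀ par : Parents n₁ n₂} {label : Fin n₁ ⊕ Fin n₂ → ℕ∞}
  {stage : ℕ∞} {visited : Set (Fin n₂)} {fs rest : List (Frame n₁ n₂)} {f : Frame n₁ n₂}

theorem SearchRep.congr (h : SearchRep A s par₀ label stage visited fs par)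
    (hr : ∀ r, r < 5 ∨ r = 12 ∨ r = 17 → s'.reg r = s.reg r)
    (ha : ∀ a, a ≠ 8 → a ≠ 9 → s'.arr a = s.arr a) (hw : s'.wrd = s.wrd)
    (hlog : s'.log = s.log) (hP : PosRep A s' par₀) :
    SearchRep A s' par₀ label stage visited fs par where
  rep := h.rep.congr (fun r _ => hr r (by omega)) (fun a _ => ha a) (fun a _ => by rw [hw]) hP
  idx w hw := by
    rw [hr 17 (by simp), ha 4 (by simp) (by simp)]
    exact h.idx w hw
  chain := h.chain
  reached := by rw [hlog]; exact h.reached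
  stack := h.stack.congr fun i _ => by
    rw [ha 12 (by simp) (by simp), ha 13 (by simp) (by simp)]
    exact ⟨rfl, rfl⟩
  depth := by rw [hr 12 (by simp), h.depth]
  start := by rw [hr 4 (by simp)]; exact h.start
  roots := h.roots

/-- From label `1` the path must end at a WT₁ branch, which has no number, so the list pointer is
used. From a larger label the target is a numbered node, found by intersecting the adjacency row of
the child with the unvisited nodes of the layer below. -/
theorem wp_findNext (hlam : 0 < lam) (hl1 : lam ≤ n₁)
    (h : SearchRep A s par₀ label stage visited (f :: rest) par)
    (hst : stage ≠ ⊤) (h17 : s.reg 17 ≤ n₁) (hN : 2 * (n₁ + n₂ + 1) ≤ N)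
    {Q : Store lam → ℕ → Prop}
    (hQ : ∀ s' T', s.Same [6, 7, 8, 9, 10, 11, 22] [8] [] s' →
      SearchRep A s' par₀ label stage visited (f :: rest) par →
      T' + 2 * posSum n₁ n₂ s ≤ T + 2 * posSum n₁ n₂ s' + 4 * (s.reg 17 / lam + 1) + 16 →
      posSum n₁ n₂ s ≤ posSum n₁ n₂ s' →
      ((s'.reg 7 = 0 ∧
          ∀ u w, ¬ State.MergerArc E ⟨par, label, stage, visited, f :: rest⟩ u w) ∨
        ∃ u w, State.MergerArc E ⟨par, label, stage, visited, f :: rest⟩ u w ∧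
          s'.reg 6 = u.val + 1 ∧ s'.reg 7 = w.val + 1) → Q s' T') :
    wp N findNext Q s T := by
  have h0 := h.roots f (by simp)
  have hd := h.depth
  simp only [List.length_cons] at hd
  obtain ⟨e1, e2, e3⟩ := h.stack
  have hI := h.rep.inv
  have hnw : ¬ IsWT1 par₀ f.root := fun hwt => h0 (hI.wt _ hwt).1
  obtain ⟨u, hu⟩ : ∃ u, par₀ u = some f.root := by
    simpa [IsWT1] using hnw
  have hpu : par₀ u ≠ none := by rw [hu]; simp
  obtain ⟨-, hv, hl⟩ := h.chain.forall_mem f (by simp)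
  have hlt := h.chain.label_ne_top hI hst f (by simp)
  have hlr : label (.inr f.root) = s.arr 10 (f.root.val + 1) 0 := by
    rcases h.rep.lab f.root with ⟨h1, -⟩ | h1
    · rw [hl, h1] at hlt
      simp at hlt
    · exact h1
  have hlu := hI.eq u f.root hv hu
  have hp0 : s.arr 10 (f.root.val + 1) 0 ≠ 0 := by
    intro e
    rw [hlr, e] at h0
    simp at h0
  have harc : ∀ u' w, State.MergerArc E ⟨par, label, stage, visited, f :: rest⟩ u' w ↔
      u' = u ∧ (u, w) ∈ E ∧ w ∉ visited ∧ (s.arr 10 (f.root.val + 1) 0 : ℕ∞) = label (.inr w) + 1 := by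
    intro u' w
    rw [h.chain.mergerArc_cons_iff hI hst]
    constructor
    · rintro ⟨h1, h2, h3, h4⟩
      obtain rfl := hI.inj _ _ _ h1 hu
      exact ⟨rfl, h2, h3, by rw [← h4, hlu, hlr]⟩
    · rintro ⟨rfl, h2, h3, h4⟩
      exact ⟨hu, h2, h3, by rw [← h4, hlu, hlr]⟩
  have hun := u.isLt
  have hlab : s.arr 10 (f.root.val + 1) 0 ≤ N :=
    (h.rep.lab_le f.root).trans (by omega)
  have hidx := h.rep.tree.le₁ u
  have hk3 : s.reg 3 ≤ n₁ := by
    rw [h.rep.tree.card]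
    exact (card_treeEdges_le hI.edge hI.inj).trans matchingNumber_le_left
  have hkl : s.reg 17 / lam ≤ s.reg 17 := Nat.div_le_self _ _
  have hkm : (s.reg 17 / lam + 1) * lam ≤ s.reg 17 + lam := by
    rw [Nat.succ_mul]; exact Nat.add_le_add_right (Nat.div_mul_le_self _ _) _
  simp only [findNext, wp, Expr.ev, reg_setReg, arr_setReg, Nat.reduceEqDiff, ↓reduceIte, hd, e2,
    h.rep.tree.child u f.root hu, ne_eq, indic_eq_zero, not_not, h.rep.input.reg2]
  set s0 := (s.setReg 6 (u.val + 1)).setReg 22 (s.arr 10 (f.root.val + 1) 0) with hs0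
  have hs00 : s.Same [6, 7, 8, 9, 10, 11, 22] [8] [] s0 :=
    (Store.Same.setReg (by simp)).trans (.setReg (by simp))
  refine ⟨by omega, hlab, fun hp => ?_, fun hp => ?_⟩
  · refine wp_advance₁ (A := A) (par := par₀) (u := u) (s := s0)
      (h.rep.input.congr (fun r hr => hs00.reg r (by simp; omega)) (fun _ _ => rfl) rfl)
      (h.rep.tree.congr (hs00.reg 3 (by simp)) (fun _ _ _ => rfl) rfl rfl)
      (h.rep.pos.congr rfl rfl) (by omega) (by simp [hs0]) hpu ?_
    intro s1 T1 hs1 hP1 c1 c2 hres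
    rw [hs0, posSum_setReg, posSum_setReg] at c1 c2
    have hss1 := hs00.trans (hs1.mono (by simp) (by simp) (by simp))
    have r6 : s1.reg 6 = u.val + 1 := by rw [hs1.reg 6 (by simp)]; simp [hs0]
    have harc1 : ∀ w, (w ∉ visited ∧ (s.arr 10 (f.root.val + 1) 0 : ℕ∞) = label (.inr w) + 1) ↔
        IsWT1 par₀ w := by
      intro w
      rw [hp]
      constructor
      · rintro ⟨h1, h2⟩
        refine hI.wt' w ?_ h1
        have h3 : label (.inr w) + 1 ≤ 0 + 1 := by simpa using h2.symm.le
        exact nonpos_iff_eq_zero.1 ((ENat.add_le_add_iff_right (by simp)).1 h3)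
      · intro h1
        refine ⟨(hI.wt w h1).2, ?_⟩
        rw [(hI.wt w h1).1]
        simp
    refine hQ _ _ hss1 (h.congr ?_ ?_ ?_ hss1.log hP1) (by omega) c2 ?_
    · intro r hr
      exact hss1.reg r (by simp; omega)
    · exact fun a h8 _ => hss1.arr a (by simpa using h8)
    · funext a
      exact hss1.wrd a (by simp)
    · rcases hres with ⟨h7, hres⟩ | ⟨w, hw1, hw2, h7⟩
      · refine Or.inl ⟨h7, fun u' w ha => ?_⟩
        obtain ⟨-, h8, h9⟩ := (harc u' w).1 ha
        exact hres w h8 ((harc1 w).1 h9)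
      · exact Or.inr ⟨u, w, (harc u w).2 ⟨rfl, hw1, (harc1 w).2 hw2⟩, r6, h7⟩
  · have r2 : s0.reg 2 = lam := by rw [hs00.reg 2 (by simp), h.rep.input.reg2]
    have r17 : s0.reg 17 = s.reg 17 := hs00.reg 17 (by simp)
    simp only [hs0, reg_setReg, Nat.reduceEqDiff, ↓reduceIte, arr_setReg]
    refine ⟨by omega, by omega, by omega, ?_⟩
    refine wp_scan hlam ?_ ?_ ?_
    · simp [h.rep.input.reg2]
    · simp; omega
    simp only [reg_setReg, bit_setReg, Nat.reduceEqDiff, ↓reduceIte]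
    intro s1 T1 hs1 hT1 hres
    have hss1 : s.Same [6, 7, 8, 9, 10, 11, 22] [8] [] s1 :=
      hs00.trans ((((Store.Same.setReg (by simp)).trans (.setReg (by simp))).trans
        (.setReg (by simp))).trans (hs1.mono (by simp) (by simp) (by simp)))
    have hp1 : posSum n₁ n₂ s1 = posSum n₁ n₂ s := by
      refine posSum_congr ?_ ?_
      · rw [hs1.arr 8 (by simp)]; rfl
      · rw [hs1.arr 9 (by simp)]; rfl
    have r6 : s1.reg 6 = u.val + 1 := by rw [hs1.reg 6 (by simp)]; simp
    have a1 : ∀ a, s1.arr a = s.arr a := by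
      intro a; rw [hs1.arr a (by simp)]; rfl
    have hpos : PosRep A s1 par₀ := h.rep.pos.congr (a1 8) (a1 9)
    -- The label of the root is at least `2` here, so a stored `0` that stands for ⊤ is not mistaken
    -- for the layer below.
    have hcast : ∀ w, (s.arr 10 (f.root.val + 1) 0 : ℕ∞) = label (.inr w) + 1 ↔
        s.arr 10 (w.val + 1) 0 = s.arr 10 (f.root.val + 1) 0 - 1 := by
      intro w
      rcases h.rep.lab w with ⟨q1, q2⟩ | q1
      · rw [q1, q2]
        simp only [top_add, ENat.natCast_ne_top, false_iff]
        omega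
      · rw [q1]
        norm_cast
        omega
    have hw0 : ∀ w : Fin n₂, s.arr 10 (w.val + 1) 0 ≠ 0 → label (.inr w) ≠ 0 := by
      intro w hw e
      rcases h.rep.lab w with ⟨q1, q2⟩ | q1
      · exact hw q2
      · rw [e] at q1
        exact hw (by exact_mod_cast q1.symm)
    have hw1 : ∀ w : Fin n₂, s.arr 10 (w.val + 1) 0 ≠ 0 → ¬ IsWT1 par₀ w :=
      fun w hw hwt => hw0 w hw (hI.wt w hwt).1
    have hbit : ∀ c, 1 ≤ c → (s.bit 4 (s.arr 10 (f.root.val + 1) 0 - 1) c = true ↔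
        ∃ w : Fin n₂, s.arr 4 (w.val + 1) 0 = c ∧
          s.arr 10 (w.val + 1) 0 = s.arr 10 (f.root.val + 1) 0 - 1 ∧ w ∉ visited) :=
      fun c hc => h.rep.layers _ c (by omega) hc
    refine ⟨fun h7 => ?_, fun h7 => ?_⟩
    · rcases hres with ⟨hres, -⟩ | ⟨q1, q2, q3⟩
      · exact absurd hres h7
      obtain ⟨w, hw2, hw3, hw4⟩ := (hbit _ q1).1 q3
      have hww := hw1 w (by omega)
      rw [← hw2, h.rep.tree.bit₂ u w hpu hww] at q2
      have hnode := h.rep.tree.node₂ w hww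
      rw [hw2] at hnode
      have hwn := w.isLt
      simp only [a1, hnode]
      refine ⟨by omega, hQ _ _ (hss1.trans (.setReg (by simp))) (h.congr ?_ ?_ ?_ ?_ ?_) ?_ ?_
        (Or.inr ⟨u, w, (harc u w).2 ⟨rfl, q2, hw4, (hcast w).2 hw3⟩, by simp [r6], by simp⟩)⟩
      · intro r hr
        rw [reg_setReg, if_neg (by omega), hss1.reg r (by simp; omega)]
      · exact fun a _ _ => a1 a
      · funext a
        exact hss1.wrd a (by simp)
      · exact hss1.log
      · exact hpos.congr rfl rfl
      · rw [posSum_setReg, hp1]; omega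
      · rw [posSum_setReg, hp1]
    · rcases hres with ⟨-, hres⟩ | ⟨q1, -, -⟩
      swap
      · change s1.reg 7 = 0 at h7
        omega
      refine hQ _ _ hss1 (h.congr ?_ ?_ ?_ hss1.log hpos) ?_ ?_ (Or.inl ⟨h7, fun u' w ha => ?_⟩)
      · intro r hr
        exact hss1.reg r (by simp; omega)
      · exact fun a _ _ => a1 a
      · funext a
        exact hss1.wrd a (by simp)
      · rw [hp1]; omega
      · rw [hp1]
      · obtain ⟨rfl, q1, q2, q3⟩ := (harc u' w).1 ha
        rw [hcast] at q3
        have hww := hw1 w (by omega)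
        have h4 := (h.rep.tree.ne₂ w).2 hww
        -- Nodes of nonzero label were numbered before the stage began, so the words up to the
        -- number `[17]` suffice even though the matrix has grown since.
        have hix := h.idx w (hw0 w (by omega))
        refine hres (s.arr 4 (w.val + 1) 0) (by omega) ?_
          ⟨(h.rep.tree.bit₂ u' w hpu hww).2 q1, (hbit _ (by omega)).2 ⟨w, rfl, q3, q2⟩⟩
        exact Nat.lt_succ_of_le (Nat.div_le_div_right (by omega))

/-- The time for one step of a sequence of mergers, up to the positions in the lists and the time
for augmentations. -/
def stepCost (lam k : ℕ) : ℕ := 4 * (k / lam + 1) + 26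

/-- The potential `2 * freeCount + depth` falls by at least one in every case: a push turns a free
node into a path node, a pop turns a path node into a visited one, and a success empties the path.
The cost of an augmentation is charged to the new pair, and pointer moves to `posSum`. -/
theorem wp_searchStep (hlam : 0 < lam) (hl1 : lam ≤ n₁)
    (h : SearchRep A s par₀ label stage visited (f :: rest) par)
    (hst : stage ≠ ⊤) (h17 : s.reg 17 ≤ n₁) (hN : 2 * (n₁ + n₂ + 1) ≤ N)
    {Q : Store lam → ℕ → Prop}
    (hQ : ∀ s' T' par₁ visited₁ fs' par', SearchRep A s' par₁ label stage visited₁ fs' par' →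
      visited ⊆ visited₁ → (∀ u, par₀ u ≠ none → par₁ u ≠ none) →
      (∀ g, (f :: rest).getLast? = some g → g.root ∈ visited₁ ∨ fs'.getLast? = some g) →
      ((par₁ = par₀ ∧ s'.reg 3 = s.reg 3) ∨ s'.reg 3 = s.reg 3 + 1) →
      (∀ r, r = 15 ∨ r = 16 ∨ r = 17 → s'.reg r = s.reg r) →
      (∀ w : Fin n₂, label (.inr w) ≠ 0 → s'.arr 4 (w.val + 1) 0 = s.arr 4 (w.val + 1) 0) →
      (s'.arr 10 = s.arr 10) →
      posSum n₁ n₂ s ≤ posSum n₁ n₂ s' →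
      T' + 2 * posSum n₁ n₂ s + (17 * matchingNumber E + 8) * s.reg 3 +
        stepCost lam (s.reg 17) * (2 * freeCount label visited₁ fs' + fs'.length) ≤
      T + 2 * posSum n₁ n₂ s' + (17 * matchingNumber E + 8) * s'.reg 3 +
        stepCost lam (s.reg 17) * (2 * freeCount label visited (f :: rest) + (f :: rest).length) →
      Q s' T') :
    wp N searchStep Q s (T + 1) := by
  have hlen := h.length_le hst
  have hd := h.depth
  simp only [searchStep, wp]
  refine wp_findNext hlam hl1 h hst h17 hN ?_
  intro s1 T1 hs1 h1 c1 c2 hres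
  have h12 := h1.depth
  have hc : stepCost lam (s.reg 17) = 4 * (s.reg 17 / lam + 1) + 26 := rfl
  set c := stepCost lam (s.reg 17)
  set κ := matchingNumber E
  refine ⟨fun h7 => ?_, fun h7 => ?_⟩
  · rcases hres with ⟨hres, -⟩ | ⟨u, w, ha, hr6, hr7⟩
    · exact absurd hres h7
    have hun := u.isLt
    have hwn := w.isLt
    simp only [Expr.ev]
    set s2 := s1.setReg 5 (s1.reg 7) with hs2
    have h2 : SearchRep A s2 par₀ label stage visited (f :: rest) par := by
      refine h1.congr (fun r hr => ?_) (fun _ _ _ => rfl) rfl rfl (h1.rep.pos.congr rfl rfl)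
      rw [hs2, reg_setReg, if_neg (by omega)]
    have q6 : s2.reg 6 = u.val + 1 := by simp [hs2, hr6]
    have q5 : s2.reg 5 = w.val + 1 := by simp [hs2, hr7]
    refine ⟨by omega, wp_pushMerge (by rw [h2.depth]; omega) (by omega) (by omega) ?_⟩
    rw [q6, q5]
    intro s3 hp
    have g5 : s3.reg 5 = w.val + 1 := by rw [hp.reg 5 (by simp), q5]
    have g10 : s3.arr 10 = s.arr 10 := by
      rw [hp.arr 10 (by simp) (by simp)]
      exact hs1.arr 10 (by simp)
    rw [g5, g10]
    -- The target of a merger has a finite label, so the test of the stored value really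
    -- distinguishes a WT₁ branch from a further extension.
    have hlw : label (.inr w) ≠ 0 ↔ s.arr 10 (w.val + 1) 0 ≠ 0 := by
      have hal := ha.2.2.2
      rcases h.rep.lab w with ⟨q1, q2⟩ | q1
      · simp only at hal
        rw [q1] at hal
        have h3 := (h.chain.mergerArc_cons_iff h.rep.inv hst).1 ha
        obtain ⟨-, hv, hl⟩ := h.chain.forall_mem f (by simp)
        have hlt := h.chain.label_ne_top h.rep.inv hst f (by simp)
        rw [hl, ← h.rep.inv.eq u f.root hv h3.1, hal] at hlt
        simp at hlt
      · rw [q1]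
        norm_cast
    have hss3 : ∀ r, r = 3 ∨ r = 15 ∨ r = 16 ∨ r = 17 → s3.reg r = s.reg r := by
      intro r hr
      rw [hp.reg r (by omega), hs2, reg_setReg, if_neg (by omega), hs1.reg r (by simp; omega)]
    have harr2 : ∀ a, a ≠ 8 → s2.arr a = s.arr a := fun a ha => hs1.arr a (by simpa using ha)
    refine ⟨fun h10 => ?_, fun h10 => ?_⟩
    · have hlw' := hlw.2 h10
      have h3 := h2.extend hst ha hlw' hp (by simp)
      have hfree := h2.freeCount_extend hst ha hlw'
      have hps : posSum n₁ n₂ s3 = posSum n₁ n₂ s1 :=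
        posSum_congr (hp.arr 8 (by simp) (by simp)) (hp.arr 9 (by simp) (by simp))
      refine hQ _ _ par₀ visited _ _ h3 le_rfl (fun _ h => h) ?_ (Or.inl ⟨rfl, hss3 3 (by simp)⟩)
        (fun r hr => hss3 r (by omega)) ?_ g10 (by omega) ?_
      · intro g hg
        right
        rw [List.getLast?_cons_cons]
        exact hg
      · intro x _
        rw [hp.arr 4 (by simp) (by simp), harr2 4 (by simp)]
      · rw [hss3 3 (by simp), hps]
        have e : c * (2 * freeCount label visited (f :: rest) + (f :: rest).length) =
            c * (2 * freeCount label visited (⟨u, par u, w⟩ :: f :: rest) +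
              ((⟨u, par u, w⟩ : Frame n₁ n₂) :: f :: rest).length) + c := by
          rw [← hfree]
          simp only [List.length_cons]
          ring
        omega
    · have hlw' : label (.inr w) = 0 := by
        by_contra hc
        exact hlw.1 hc h10
      refine wp_augmentSearch hlam h2 hst ha hlw' hp (by simp) q5 (by omega) ?_
      intro s4 T4 hs4 h4 hmono hne4 g3 hT4
      have hps : posSum n₁ n₂ s4 = posSum n₁ n₂ s1 :=
        posSum_congr (hs4.arr 8 (by simp)) (hs4.arr 9 (by simp))
      have gr : ∀ r, r = 15 ∨ r = 16 ∨ r = 17 → s4.reg r = s.reg r := by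
        intro r hr
        have := hs4.reg r (by simp; omega)
        simp only at this
        rw [this, hs2, reg_setReg, if_neg (by omega), hs1.reg r (by simp; omega)]
      have g3' : s4.reg 3 = s.reg 3 + 1 := by
        rw [g3, hs2, reg_setReg, if_neg (by simp), hs1.reg 3 (by simp)]
      refine hQ _ _ _ _ _ _ h4 Set.subset_union_left hmono ?_ (Or.inr g3') gr ?_ ?_ (by omega) ?_
      · intro g hg
        left
        right
        exact ⟨g, List.mem_cons_of_mem _ (List.mem_of_getLast? hg), rfl⟩
      · intro x hx
        rw [hne4 x hx, harr2 4 (by simp)]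
      · have := hs4.arr 10 (by simp)
        simp only at this
        rw [this, harr2 10 (by simp)]
      · have hfree : freeCount label (visited ∪ {r | ∃ g ∈ (⟨u, par u, w⟩ : Frame n₁ n₂) :: f :: rest,
            g.root = r}) [] ≤ freeCount label visited (f :: rest) := by
          refine freeCount_anti fun x hx hx' => Or.inl ?_
          rcases hx' with hx' | ⟨g, hg, rfl⟩
          · exact Or.inl hx'
          · exact Or.inr ⟨g, List.mem_cons_of_mem _ hg, rfl⟩
        have e : c * (2 * freeCount label (visited ∪ {r | ∃ g ∈ (⟨u, par u, w⟩ : Frame n₁ n₂) ::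
            f :: rest, g.root = r}) [] + 0) + c ≤
            c * (2 * freeCount label visited (f :: rest) + (f :: rest).length) := by
          rw [← Nat.mul_succ]
          refine Nat.mul_le_mul_left _ ?_
          simp only [List.length_cons]
          omega
        rw [g3', hps, List.length_nil]
        have e2 : (17 * κ + 8) * (s.reg 3 + 1) = (17 * κ + 8) * s.reg 3 + 17 * κ + 8 := by ring
        omega
  · rcases hres with ⟨-, hno⟩ | ⟨u, w, -, -, hr7⟩
    swap
    · change s1.reg 7 = 0 at h7
      omega
    refine wp_popMerge hlam h1 hst hno (by omega) ?_
    intro s2 hr ha h2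
    have hps : posSum n₁ n₂ s2 = posSum n₁ n₂ s1 := posSum_congr (by rw [ha]) (by rw [ha])
    have hss : ∀ r, r = 3 ∨ r = 15 ∨ r = 16 ∨ r = 17 → s2.reg r = s.reg r := by
      intro r hr'
      rw [hr r (by omega), hs1.reg r (by simp; omega)]
    refine hQ _ _ par₀ _ _ _ h2 (Set.subset_insert _ _) (fun _ h => h) ?_
      (Or.inl ⟨rfl, hss 3 (by simp)⟩) (fun r hr => hss r (by omega)) ?_ ?_ (by omega) ?_
    · intro g hg
      cases rest with
      | nil =>
        simp only [List.getLast?_singleton, Option.some.injEq] at hg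
        left
        simp [hg]
      | cons f' fs => right; simpa using hg
    · intro x _
      rw [ha, hs1.arr 4 (by simp)]
    · rw [ha, hs1.arr 10 (by simp)]
    · have hfree : freeCount label (insert f.root visited) rest ≤
          freeCount label visited (f :: rest) := by
        refine freeCount_anti fun x hx hx' => ?_
        rcases hx' with hx' | ⟨g, hg, rfl⟩
        · exact Or.inl (Or.inr hx')
        · rcases List.mem_cons.1 hg with rfl | hg
          · exact Or.inl (Or.inl rfl)
          · exact Or.inr ⟨g, hg, rfl⟩
      rw [hss 3 (by simp), hps]
      have e : c * (2 * freeCount label (insert f.root visited) rest + rest.length) + c ≤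
          c * (2 * freeCount label visited (f :: rest) + (f :: rest).length) := by
        rw [← Nat.mul_succ]
        refine Nat.mul_le_mul_left _ ?_
        simp only [List.length_cons]
        omega
      omega

end Search

/-! ### Running one stage -/

/-- A sequence of mergers. -/
def search : Cmd := .loop (ʀ 12) searchStep

/-- A sequence of mergers that begins at the node number `[16]` of `V₂`. -/
def stageStep : Cmd :=
  .getBit 21 4 (ʀ 15 -ₑ ᴄ 1) (ʀ 16) ;;
  .ite (ʀ 21)
    (.assign 6 (.read 6 (ʀ 16) (ᴄ 0)) ;; advance 1 9 3 ;;
      .ite (ʀ 7)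
        (.assign 4 (ʀ 7) ;; .assign 5 (ʀ 6) ;; .assign 6 (ʀ 4) ;; pushMerge ;; search)
        .skip)
    .skip

/-- The mergers of a stage. -/
def runStage : Cmd :=
  .assign 17 (ʀ 3) ;; .assign 12 (ᴄ 0) ;; .assign 16 (ᴄ 1) ;;
  .loop (ʀ 16 <ₑ ʀ 17 +ₑ ᴄ 1) (stageStep ;; .assign 16 (ʀ 16 +ₑ ᴄ 1))

section Stage

variable {n₁ n₂ lam N : ℕ} {E : Finset (Fin n₁ × Fin n₂)} {A : AdjLists E}
variable {s s' s'' : Store lam} {T : ℕ} {par₀ par₁ par₂ par : Parents n₁ n₂}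
  {label : Fin n₁ ⊕ Fin n₂ → ℕ∞} {stage : ℕ∞} {visited visited₁ visited₂ : Set (Fin n₂)}
  {fs rest : List (Frame n₁ n₂)} {f : Frame n₁ n₂}

/-- The progress during a stage. -/
structure Progress (label : Fin n₁ ⊕ Fin n₂ → ℕ∞) (s s' : Store lam) (par₀ par₁ : Parents n₁ n₂)
    (visited visited₁ : Set (Fin n₂)) : Prop where
  visited : visited ⊆ visited₁
  matched : ∀ u, par₀ u ≠ none → par₁ u ≠ none
  card : (par₁ = par₀ ∧ s'.reg 3 = s.reg 3) ∨ s.reg 3 < s'.reg 3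
  reg15 : s'.reg 15 = s.reg 15
  reg16 : s'.reg 16 = s.reg 16
  reg17 : s'.reg 17 = s.reg 17
  idx : ∀ w : Fin n₂, label (.inr w) ≠ 0 → s'.arr 4 (w.val + 1) 0 = s.arr 4 (w.val + 1) 0
  lab : s'.arr 10 = s.arr 10
  pos : posSum n₁ n₂ s ≤ posSum n₁ n₂ s'

theorem Progress.refl : Progress label s s par₀ par₀ visited visited :=
  ⟨le_rfl, fun _ h => h, Or.inl ⟨rfl, rfl⟩, rfl, rfl, rfl, fun _ _ => rfl, rfl, le_rfl⟩

theorem Progress.trans (h : Progress label s s' par₀ par₁ visited visited₁)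
    (h' : Progress label s' s'' par₁ par₂ visited₁ visited₂) :
    Progress label s s'' par₀ par₂ visited visited₂ where
  visited := h.visited.trans h'.visited
  matched u hu := h'.matched u (h.matched u hu)
  card := by
    rcases h.card with ⟨e1, e2⟩ | h1 <;> rcases h'.card with ⟨e3, e4⟩ | h2
    · exact Or.inl ⟨e3.trans e1, e4.trans e2⟩
    all_goals exact Or.inr (by omega)
  reg15 := h'.reg15.trans h.reg15
  reg16 := h'.reg16.trans h.reg16
  reg17 := h'.reg17.trans h.reg17
  idx w hw := (h'.idx w hw).trans (h.idx w hw)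
  lab := h'.lab.trans h.lab
  pos := h.pos.trans h'.pos

theorem StageRep.reg3_le (h : StageRep A s par label stage visited) :
    s.reg 3 ≤ matchingNumber E := by
  rw [h.tree.card]
  exact card_treeEdges_le h.inv.edge h.inv.inj

theorem StageRep.posSum_le (h : StageRep A s par label stage visited) :
    posSum n₁ n₂ s ≤ 2 * (matchingNumber E * matchingNumber E) :=
  h.pos.posSum_le h.inv.inj (card_treeEdges_le h.inv.edge h.inv.inj)

theorem SearchRep.par_eq (h : SearchRep A s par₀ label stage visited [] par) : par = par₀ := by
  cases h.chain
  rfl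

/-- The first root of the sequence ends up visited on success as on failure, so each starting node
needs only one search in a stage. -/
theorem wp_search (hlam : 0 < lam) (hl1 : lam ≤ n₁)
    (h : SearchRep A s par₀ label stage visited fs par)
    (hst : stage ≠ ⊤) (h17 : s.reg 17 ≤ n₁) (hN : 2 * (n₁ + n₂ + 1) ≤ N)
    {Q : Store lam → ℕ → Prop}
    (hQ : ∀ s' T' par₁ visited₁, SearchRep A s' par₁ label stage visited₁ [] par₁ →
      Progress label s s' par₀ par₁ visited visited₁ →
      (∀ g, fs.getLast? = some g → g.root ∈ visited₁) →
      T' + 2 * posSum n₁ n₂ s + (17 * matchingNumber E + 8) * s.reg 3 +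
        stepCost lam (s.reg 17) * (2 * freeCount label visited₁ []) ≤
      T + 2 * posSum n₁ n₂ s' + (17 * matchingNumber E + 8) * s'.reg 3 +
        stepCost lam (s.reg 17) * (2 * freeCount label visited fs + fs.length) + 1 →
      Q s' T') :
    wp N search Q s T := by
  simp only [search, wp]
  set κ := matchingNumber E with hκ
  set c := stepCost lam (s.reg 17) with hc
  apply wp_loop (I := fun s' T' => ∃ par₁ visited₁ fs' par',
      SearchRep A s' par₁ label stage visited₁ fs' par' ∧
      Progress label s s' par₀ par₁ visited visited₁ ∧
      (∀ g, fs.getLast? = some g → g.root ∈ visited₁ ∨ fs'.getLast? = some g) ∧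
      T' + 2 * posSum n₁ n₂ s + (17 * κ + 8) * s.reg 3 +
        c * (2 * freeCount label visited₁ fs' + fs'.length) ≤
      T + 2 * posSum n₁ n₂ s' + (17 * κ + 8) * s'.reg 3 +
        c * (2 * freeCount label visited fs + fs.length))
    (M := T + 2 * (2 * (κ * κ)) + (17 * κ + 8) * κ +
        c * (2 * freeCount label visited fs + fs.length))
  · exact ⟨par₀, visited, fs, par, h, .refl, fun g hg => Or.inr hg, le_rfl⟩
  · rintro s' T' ⟨par₁, visited₁, fs', par', h1, -, -, h2⟩
    have h3 := h1.rep.posSum_le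
    have h4 := Nat.mul_le_mul_left (17 * κ + 8) h1.rep.reg3_le
    rw [← hκ] at h3 h4
    omega
  · rintro s' T' ⟨par₁, visited₁, fs', par', h1, h2, h3, h4⟩ he
    cases fs' with
    | nil =>
      have := h1.depth
      simp only [Expr.ev] at he
      exact absurd this he
    | cons f rest =>
      refine wp_searchStep hlam hl1 h1 hst (by rw [h2.reg17]; exact h17) hN ?_
      intro s2 T2 par₂ visited₂ fs₂ par'' q1 q2 q3 q4 q5 q6 q7 q8 q9 q10
      refine ⟨par₂, visited₂, fs₂, par'', q1, h2.trans ⟨q2, q3, ?_, q6 15 (by simp), q6 16 (by simp), q6 17 (by simp), q7, q8, q9⟩, ?_, ?_⟩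
      · rcases q5 with q5 | q5
        · exact Or.inl q5
        · exact Or.inr (by omega)
      · intro g hg
        rcases h3 g hg with h5 | h5
        · exact Or.inl (q2 h5)
        · exact q4 g h5
      · rw [h2.reg17, ← hc, ← hκ] at q10
        omega
  · rintro s' T' ⟨par₁, visited₁, fs', par', h1, h2, h3, h4⟩ he
    have := h1.depth
    simp only [Expr.ev] at he
    obtain rfl : fs' = [] := by
      rw [he] at this
      exact List.length_eq_zero_iff.1 this.symm
    obtain rfl := h1.par_eq
    refine hQ _ _ _ _ h1 h2 (fun g hg => ?_) ?_
    · simpa using h3 g hg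
    · simp only [List.length_nil, add_zero] at h4
      omega

/-- A sequence is started from its first root, a numbered node of layer ℓ - 1, and not from an ST₁
branch; the in-list pointer of the root supplies the branch. The first push is paid for by the free
node that it uses. -/
theorem wp_stageStep (hlam : 0 < lam) (hl1 : lam ≤ n₁)
    (h : SearchRep A s par₀ label stage visited [] par₀)
    (hst : stage = s.reg 15) (h15 : 2 ≤ s.reg 15) (h16 : 1 ≤ s.reg 16) (h17 : s.reg 17 ≤ n₁)
    (hN : 2 * (n₁ + n₂ + 1) ≤ N)
    {Q : Store lam → ℕ → Prop}
    (hQ : ∀ s' T' par₁ visited₁, SearchRep A s' par₁ label stage visited₁ [] par₁ →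
      Progress label s s' par₀ par₁ visited visited₁ →
      (∀ w : Fin n₂, label (.inr w) ≠ 0 → s.arr 4 (w.val + 1) 0 = s.reg 16 →
        stage = label (.inr w) + 1 → w ∉ visited₁ → ∀ u, (u, w) ∈ E → par₁ u ≠ none) →
      T' + 2 * posSum n₁ n₂ s + (17 * matchingNumber E + 8) * s.reg 3 +
        stepCost lam (s.reg 17) * (2 * freeCount label visited₁ []) ≤
      T + 2 * posSum n₁ n₂ s' + (17 * matchingNumber E + 8) * s'.reg 3 +
        stepCost lam (s.reg 17) * (2 * freeCount label visited []) + 16 →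
      Q s' T') :
    wp N stageStep Q s T := by
  have hI := h.rep.inv
  have hst' : stage ≠ ⊤ := by rw [hst]; simp
  have hcast : ∀ w : Fin n₂, stage = label (.inr w) + 1 ↔
      s.arr 10 (w.val + 1) 0 = s.reg 15 - 1 := by
    intro w
    rw [hst]
    rcases h.rep.lab w with ⟨q1, q2⟩ | q1
    · rw [q1, q2]
      simp only [top_add, ENat.natCast_ne_top, false_iff]
      omega
    · rw [q1]
      norm_cast
      omega
  have hbit := h.rep.layers (s.reg 15 - 1) (s.reg 16) (by omega) h16
  set s1 := s.setReg 21 (indic (s.bit 4 (s.reg 15 - 1) (s.reg 16) = true)) with hs1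
  have h1 : SearchRep A s1 par₀ label stage visited [] par₀ := by
    refine h.congr (fun r hr => ?_) (fun _ _ _ => rfl) rfl rfl (h.rep.pos.congr rfl rfl)
    rw [hs1, reg_setReg, if_neg (by omega)]
  have r1 : ∀ r, r ≠ 21 → s1.reg r = s.reg r := fun r hr => by rw [hs1, reg_setReg, if_neg hr]
  simp only [stageStep, wp, Expr.ev, ← hs1]
  refine ⟨h16, by omega, fun hb => ?_, fun hb => ?_⟩
  swap
  · simp only [hs1, reg_setReg, ↓reduceIte, indic_eq_zero] at hb
    refine hQ s1 _ par₀ visited h1 ⟨le_rfl, fun _ h => h, Or.inl ⟨rfl, r1 3 (by simp)⟩,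
      r1 15 (by simp), r1 16 (by simp), r1 17 (by simp), fun _ _ => rfl, rfl, le_rfl⟩ ?_ ?_
    · intro w hw e1 e2 e3
      exact absurd (hbit.2 ⟨w, e1, (hcast w).1 e2, e3⟩) hb
    · rw [r1 3 (by simp), hs1, posSum_setReg]
      omega
  simp only [hs1, reg_setReg, ↓reduceIte, ne_eq, indic_eq_zero, not_not] at hb
  obtain ⟨w, hw1, hw2, hw3⟩ := hbit.1 hb
  have hw0 : label (.inr w) ≠ 0 := by
    have := (hcast w).2 hw2
    intro e
    rw [e, hst] at this
    norm_cast at this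
    omega
  have hww : ¬ IsWT1 par₀ w := fun hwt => hw0 (hI.wt w hwt).1
  have hwn := w.isLt
  have hnode := h.rep.tree.node₂ w hww
  rw [hw1] at hnode
  rw [r1 16 (by simp), show s1.arr = s.arr from rfl, hnode]
  refine ⟨by omega, ?_⟩
  set s2 := s1.setReg 6 (w.val + 1) with hs2
  have h2 : SearchRep A s2 par₀ label stage visited [] par₀ := by
    refine h1.congr (fun r hr => ?_) (fun _ _ _ => rfl) rfl rfl (h1.rep.pos.congr rfl rfl)
    rw [hs2, reg_setReg, if_neg (by omega)]
  refine wp_advance₂ (A := A) (par := par₀) (w := w) h2.rep.input h2.rep.tree h2.rep.pos (by omega)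
    (by simp [hs2]) hww ?_
  intro s3 T3 hs3 hP3 c1 c2 hres
  have h3 : SearchRep A s3 par₀ label stage visited [] par₀ :=
    h2.congr (fun r hr => hs3.reg r (by simp; omega)) (fun a h8 h9 => hs3.arr a (by simpa using h9))
      (funext fun a => hs3.wrd a (by simp)) hs3.log hP3
  have r3 : ∀ r, r ≠ 21 → r ≠ 6 → r ≠ 7 → s3.reg r = s.reg r := fun r q1 q2 q3 => by
    rw [hs3.reg r (by simpa using q3), hs2, reg_setReg, if_neg q2, r1 r q1]
  have e2 : posSum n₁ n₂ s2 = posSum n₁ n₂ s := rfl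
  rw [e2] at c1 c2
  have a3 : ∀ a, a ≠ 9 → s3.arr a = s.arr a := fun a ha => hs3.arr a (by simpa using ha)
  -- A V₂-node of nonzero label is matched and so is determined by its number; the node treated now
  -- is the only one meant by `[16]`.
  have huniq : ∀ w' : Fin n₂, label (.inr w') ≠ 0 → s.arr 4 (w'.val + 1) 0 = s.reg 16 → w' = w := by
    intro w' q1 q2
    have := h.rep.tree.node₂ w' fun hwt => q1 (hI.wt w' hwt).1
    rw [q2, hnode] at this
    exact Fin.ext (by omega)
  refine ⟨fun h7 => ?_, fun h7 => ?_⟩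
  swap
  · rcases hres with ⟨-, hres⟩ | ⟨u, -, -, h7'⟩
    swap
    · change s3.reg 7 = 0 at h7
      omega
    refine hQ s3 _ par₀ visited h3 ⟨le_rfl, fun _ h => h,
      Or.inl ⟨rfl, r3 3 (by simp) (by simp) (by simp)⟩,
      r3 15 (by simp) (by simp) (by simp), r3 16 (by simp) (by simp) (by simp),
      r3 17 (by simp) (by simp) (by simp), fun _ _ => by rw [a3 4 (by simp)], a3 10 (by simp), c2⟩ ?_ ?_
    · intro w' q1 q2 q3 q4 u hu
      obtain rfl := huniq w' q1 q2
      exact hres u hu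
    · rw [r3 3 (by simp) (by simp) (by simp)]
      omega
  rcases hres with ⟨h7', -⟩ | ⟨u, hu1, hu2, hu3⟩
  · exact absurd h7' h7
  have hun := u.isLt
  have r36 : s3.reg 6 = w.val + 1 := by rw [hs3.reg 6 (by simp)]; simp [hs2]
  simp only [Expr.ev, reg_setReg, Nat.reduceEqDiff, ↓reduceIte, hu3, r36]
  refine ⟨by omega, by omega, by omega, ?_⟩
  set s4 := ((s3.setReg 4 (u.val + 1)).setReg 5 (w.val + 1)).setReg 6 (u.val + 1) with hs4
  have r4 : ∀ r, r ≠ 4 → r ≠ 5 → r ≠ 6 → s4.reg r = s3.reg r := fun r q1 q2 q3 => by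
    simp [hs4, q1, q2, q3]
  have h4 : SearchRep A s4 par₀ label stage visited [] par₀ :=
    { rep := h3.rep.congr (fun r hr => r4 r (by omega) (by omega) (by omega)) (fun _ _ _ _ => rfl)
        (fun _ _ => rfl) (hP3.congr rfl rfl)
      idx := fun w hw => by
        rw [r4 17 (by simp) (by simp) (by simp)]
        exact h3.idx w hw
      chain := .nil
      reached := h3.reached
      stack := trivial
      depth := by rw [r4 12 (by simp) (by simp) (by simp), h3.depth]
      start := by simp
      roots := by simp }
  have ha : State.MergerArc E ⟨par₀, label, stage, visited, []⟩ u w := by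
    have q1 := (hcast w).2 hw2
    -- Feasibility bounds the label of the branch by ℓ from above, and the minimality of ℓ bounds it
    -- from below.
    have q2 : label (.inl u) = stage :=
      le_antisymm ((hI.feas u w hu1).trans q1.ge) (hI.st u hu2)
    exact ⟨⟨hu2, hst', q2⟩, hu1, hw3, q2.trans q1⟩
  have r45 : s4.reg 5 = w.val + 1 := by simp [hs4]
  have r46 : s4.reg 6 = u.val + 1 := by simp [hs4]
  have r44 : s4.reg 4 = u.val + 1 := by simp [hs4]
  refine wp_pushMerge (by rw [h4.depth]; simp; omega) (by omega) (by omega) ?_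
  rw [r45, r46]
  intro s5 hp
  have h5 := h4.extend hst' ha hw0 hp fun _ => r44
  have hfree := h4.freeCount_extend hst' ha hw0
  have r5 : ∀ r, r = 3 ∨ r = 15 ∨ r = 16 ∨ r = 17 → s5.reg r = s.reg r := fun r hr => by
    rw [hp.reg r (by omega), r4 r (by omega) (by omega) (by omega),
      r3 r (by omega) (by omega) (by omega)]
  have p5 : posSum n₁ n₂ s5 = posSum n₁ n₂ s3 :=
    posSum_congr (hp.arr 8 (by simp) (by simp)) (hp.arr 9 (by simp) (by simp))
  refine wp_search hlam hl1 h5 hst' (by rw [r5 17 (by simp)]; exact h17) hN ?_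
  intro s6 T6 par₁ visited₁ h6 hprog hlast ht
  have a5 : ∀ a, a ≠ 9 → a ≠ 12 → a ≠ 13 → s5.arr a = s.arr a := fun a q1 q2 q3 => by
    rw [hp.arr a q2 q3, ← a3 a q1]; rfl
  have hprog0 : Progress label s s5 par₀ par₀ visited visited :=
    ⟨le_rfl, fun _ h => h, Or.inl ⟨rfl, r5 3 (by simp)⟩, r5 15 (by simp), r5 16 (by simp),
      r5 17 (by simp), fun _ _ => by rw [a5 4 (by simp) (by simp) (by simp)],
      a5 10 (by simp) (by simp) (by simp), by omega⟩
  refine hQ s6 _ par₁ visited₁ h6 (hprog0.trans hprog) ?_ ?_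
  · intro w' q1 q2 q3 q4
    obtain rfl := huniq w' q1 q2
    exact absurd (hlast ⟨u, par₀ u, w'⟩ rfl) q4
  · rw [r5 3 (by simp), r5 17 (by simp), p5] at ht
    have e : stepCost lam (s.reg 17) * (2 * freeCount label visited [⟨u, par₀ u, w⟩] +
        [(⟨u, par₀ u, w⟩ : Frame n₁ n₂)].length) ≤
        stepCost lam (s.reg 17) * (2 * freeCount label visited []) := by
      refine Nat.mul_le_mul_left _ ?_
      simp only [List.length_singleton]
      omega
    omega

/-- One pass over the numbers existing at the start of the stage suffices: visited nodes stay
visited, matched nodes stay matched, and a starting node that is left unvisited has no unmatched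
in-neighbour. -/
theorem wp_runStage (hlam : 0 < lam) (hl1 : lam ≤ n₁)
    (h : StageRep A s par (State.layered E par).label (State.layered E par).stage ∅)
    (hr : Reached E s.log (State.layered E par))
    (hst : (State.layered E par).stage = s.reg 15) (h15 : 2 ≤ s.reg 15)
    (hN : 2 * (n₁ + n₂ + 1) ≤ N) {Q : Store lam → ℕ → Prop}
    (hQ : ∀ s' T' par' visited', StageRep A s' par' (State.layered E par).label
        (State.layered E par).stage visited' →
      Reached E s'.log ⟨par', (State.layered E par).label, (State.layered E par).stage,
        visited', []⟩ →
      (∀ u w, ¬ State.MergerArc E ⟨par', (State.layered E par).label,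
        (State.layered E par).stage, visited', []⟩ u w) →
      s.reg 3 < s'.reg 3 → s'.reg 15 = s.reg 15 → posSum n₁ n₂ s ≤ posSum n₁ n₂ s' →
      T' + 2 * posSum n₁ n₂ s + (17 * matchingNumber E + 8) * s.reg 3 ≤
        T + 2 * posSum n₁ n₂ s' + (17 * matchingNumber E + 8) * s'.reg 3 +
          78 * phaseCost lam (s.reg 3) → Q s' T') :
    wp N runStage Q s T := by
  have hk : s.reg 3 ≤ n₁ := h.reg3_le.trans matchingNumber_le_left
  set label := (State.layered E par).label with hlabel
  set stage := (State.layered E par).stage with hstage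
  have hst' : stage ≠ ⊤ := by rw [hst]; simp
  simp only [runStage, wp, Expr.ev, reg_setReg, Nat.reduceEqDiff, ↓reduceIte]
  refine ⟨by omega, by omega, by omega, ?_⟩
  set s0 := ((s.setReg 17 (s.reg 3)).setReg 12 0).setReg 16 1 with hs0
  have r0 : ∀ r, r ≠ 12 → r ≠ 16 → r ≠ 17 → s0.reg r = s.reg r := fun r q1 q2 q3 => by
    simp [hs0, q1, q2, q3]
  have r17 : s0.reg 17 = s.reg 3 := by simp [hs0]
  have p0 : posSum n₁ n₂ s0 = posSum n₁ n₂ s := rfl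
  have h0 : SearchRep A s0 par label stage ∅ [] par :=
    { rep := h.congr (fun r hr => r0 r (by omega) (by omega) (by omega)) (fun _ _ _ _ => rfl)
        (fun _ _ => rfl) (h.pos.congr rfl rfl)
      idx := fun w _ => by
        rw [r17]
        exact h.tree.le₂ w
      chain := .nil
      reached := hr
      stack := trivial
      depth := by simp [hs0]
      start := by simp
      roots := by simp }
  set κ := matchingNumber E with hκ
  set c := stepCost lam (s.reg 3) with hc
  -- Nodes of nonzero label are matched, so the initial potential is at most 2k.
  have hfree : freeCount label ∅ [] ≤ s.reg 3 := by
    rw [h.tree.card, ← card_matched₂ h.inv.inj]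
    refine Finset.card_le_card fun w hw => ?_
    rw [mem_matched₂]
    intro hwt
    simp only [Finset.mem_filter] at hw
    exact hw.2.1 (h.inv.wt w hwt).1
  -- `Progress` keeps register `16` fixed, so it is applied to a copy of the memory in which this
  -- counter is reset.
  apply wp_loop (I := fun s' T' => ∃ par₁ visited₁ s1, SearchRep A s' par₁ label stage visited₁ [] par₁ ∧
      s1 = s'.setReg 16 1 ∧ Progress label s0 s1 par par₁ ∅ visited₁ ∧
      1 ≤ s'.reg 16 ∧ s'.reg 16 ≤ s.reg 3 + 1 ∧
      (∀ w : Fin n₂, label (.inr w) ≠ 0 → s0.arr 4 (w.val + 1) 0 < s'.reg 16 →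
        stage = label (.inr w) + 1 → w ∉ visited₁ → ∀ u, (u, w) ∈ E → par₁ u ≠ none) ∧
      T' + 2 * posSum n₁ n₂ s + (17 * κ + 8) * s.reg 3 + c * (2 * freeCount label visited₁ []) ≤
      T + 2 * posSum n₁ n₂ s' + (17 * κ + 8) * s'.reg 3 + c * (2 * freeCount label ∅ []) +
        18 * (s'.reg 16 - 1) + 3)
    (M := T + 2 * (2 * (κ * κ)) + (17 * κ + 8) * κ + c * (2 * freeCount label ∅ []) +
        18 * s.reg 3 + 3)
  · refine ⟨par, ∅, _, h0, rfl, ?_, by simp [hs0], by simp [hs0], ?_, ?_⟩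
    · exact ⟨le_rfl, fun _ h => h, Or.inl ⟨rfl, by simp⟩, by simp, by simp [hs0], by simp,
        fun _ _ => rfl, rfl, le_rfl⟩
    · intro w hw hlt
      have := (h0.rep.tree.ne₂ w).2 fun hwt => hw (h.inv.wt w hwt).1
      have e16 : s0.reg 16 = 1 := by simp [hs0]
      omega
    · rw [r0 3 (by simp) (by simp) (by simp), p0]
      omega
  · rintro s' T' ⟨par₁, visited₁, s1, h1, -, -, h2, h3, -, h4⟩
    have h5 := h1.rep.posSum_le
    have h6 := Nat.mul_le_mul_left (17 * κ + 8) h1.rep.reg3_le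
    rw [← hκ] at h5 h6
    omega
  · rintro s' T' ⟨par₁, visited₁, s1, h1, rfl, h2, h3, h4, h5, h6⟩ he
    have q15 := h2.reg15
    have q17 := h2.reg17
    simp only [reg_setReg, Nat.reduceEqDiff, ↓reduceIte] at q15 q17
    rw [r0 15 (by simp) (by simp) (by simp)] at q15
    rw [r17] at q17
    simp only [Expr.ev, ne_eq, indic_eq_zero, not_not, q17] at he
    simp only [wp]
    refine wp_stageStep hlam hl1 h1 (by rw [q15]; exact hst) (by omega) h3 (by omega) hN ?_
    intro s2 T2 par₂ visited₂ g1 g2 g3 g4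
    simp only [Expr.ev]
    have e16 := g2.reg16
    rw [q17, ← hc, ← hκ] at g4
    refine ⟨by omega, par₂, visited₂, _, ?_, rfl, ?_, by simp, by simp; omega, ?_, ?_⟩
    · refine g1.congr (fun r hr => ?_) (fun _ _ _ => rfl) rfl rfl (g1.rep.pos.congr rfl rfl)
      rw [reg_setReg, if_neg (by omega)]
    · refine h2.trans ⟨g2.visited, g2.matched, ?_, ?_, ?_, ?_, g2.idx, g2.lab, g2.pos⟩
      · simpa using g2.card
      · simpa using g2.reg15
      · simp
      · simpa using g2.reg17
    · intro w q1 q2 q3 q4 u hu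
      simp only [reg_setReg, ↓reduceIte, e16] at q2
      have e4 := h2.idx w q1
      rcases Nat.lt_or_ge (s0.arr 4 (w.val + 1) 0) (s'.reg 16) with q5 | q5
      · exact g2.matched u (h5 w q1 q5 q3 (fun hv => q4 (g2.visited hv)) u hu)
      · exact g3 w q1 (by change s'.arr 4 (w.val + 1) 0 = _ at e4; omega) q3 q4 u hu
    · rw [posSum_setReg]
      simp only [reg_setReg, Nat.reduceEqDiff, ↓reduceIte, e16]
      omega
  · rintro s' T' ⟨par₁, visited₁, s1, h1, rfl, h2, h3, h4, h5, h6⟩ he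
    have q15 := h2.reg15
    have q17 := h2.reg17
    simp only [reg_setReg, Nat.reduceEqDiff, ↓reduceIte] at q15 q17
    rw [r0 15 (by simp) (by simp) (by simp)] at q15
    rw [r17] at q17
    simp only [Expr.ev, indic_eq_zero, q17] at he
    have hno : ∀ u w, ¬ State.MergerArc E ⟨par₁, label, stage, visited₁, []⟩ u w := by
      rintro u w ⟨⟨q1, q2, q3⟩, q4, q5, q6⟩
      simp only at q1 q2 q3 q4 q5 q6
      have q7 : stage = label (.inr w) + 1 := q3.symm.trans q6
      have hw0 : label (.inr w) ≠ 0 := by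
        intro e
        rw [e, hst] at q7
        norm_cast at q7
        omega
      have := h0.rep.tree.le₂ w
      rw [r0 3 (by simp) (by simp) (by simp)] at this
      exact h5 w hw0 (by omega) q7 q5 u q4 q1
    refine hQ s' _ par₁ visited₁ h1.rep h1.reached hno ?_ q15 h2.pos ?_
    · have q3 := h2.card
      simp only [reg_setReg, Nat.reduceEqDiff, ↓reduceIte] at q3
      rw [r0 3 (by simp) (by simp) (by simp)] at q3
      -- Without a new pair the tree would be unchanged, and its stage number would have to exceed
      -- itself.
      rcases q3 with ⟨rfl, -⟩ | q3
      · have := h1.rep.inv.stage_lt hst' hno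
        rw [← hstage] at this
        exact absurd this (not_add_one_le_of_ne_top hst')
      · exact q3
    · have e1 : c * (2 * freeCount label ∅ []) ≤ c * (2 * s.reg 3) :=
        Nat.mul_le_mul_left _ (by omega)
      have e2 : c * (2 * s.reg 3) + 18 * s.reg 3 + 4 ≤ 78 * phaseCost lam (s.reg 3) := by
        rw [hc, stepCost, phaseCost]
        generalize s.reg 3 / lam = L
        generalize s.reg 3 = k
        nlinarith
      omega

end Stage

/-! ## The program -/

/-- The matching-pseudoflow algorithm. -/
def matchingProgram : Cmd :=
  greedy ;; prepare ;; .loop (ʀ 15) (runStage ;; prepare)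

section Program

variable {n₁ n₂ lam N : ℕ} {E : Finset (Fin n₁ × Fin n₂)} {A : AdjLists E}
variable {s : Store lam} {T : ℕ} {par : Parents n₁ n₂}

/-- The representation of a new layered network. -/
structure LayeredRep (A : AdjLists E) (s : Store lam) (par : Parents n₁ n₂) : Prop where
  rep : StageRep A s par (State.layered E par).label (State.layered E par).stage ∅
  reached : Reached E s.log (State.layered E par)
  stage : ((State.layered E par).stage = ⊤ ∧ s.reg 15 = 0) ∨
    ((State.layered E par).stage = s.reg 15 ∧ 2 ≤ s.reg 15)

theorem phaseCost_mono {lam k k' : ℕ} (h : k ≤ k') : phaseCost lam k ≤ phaseCost lam k' :=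
  Nat.mul_le_mul (by omega) (Nat.succ_le_succ (Nat.div_le_div_right h))

theorem phaseCost_pos {lam k : ℕ} : 1 ≤ phaseCost lam k :=
  Nat.mul_pos (Nat.succ_pos _) (Nat.succ_pos _)

/-- A bound on the number of iterations of the main loop that are still to come. -/
def iterationsLeft (κ : ℕ) (s : Store lam) : ℕ :=
  if s.reg 15 = 0 then 0 else stagesLeft κ (s.reg 15) (s.reg 3) + 1

theorem iterationsLeft_le {κ : ℕ} {s : Store lam} : iterationsLeft κ s ≤ 2 * κ.sqrt + 4 := by
  unfold iterationsLeft stagesLeft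
  split_ifs <;> omega

/-- Pointer moves and augmentations are paid from potentials that are bounded over the whole run,
not per stage. Only the remaining cost of a stage is multiplied by the number of stages. -/
theorem wp_stages (hlam : 0 < lam) (hl1 : lam ≤ n₁) (h : LayeredRep A s par)
    (hN : 2 * (n₁ + n₂ + 1) ≤ N) {Q : Store lam → ℕ → Prop}
    (hQ : ∀ s' T' par', LayeredRep A s' par' → (State.layered E par').stage = ⊤ →
      T' ≤ T + 4 * (matchingNumber E * matchingNumber E) +
        (17 * matchingNumber E + 8) * matchingNumber E +
        152 * phaseCost lam (matchingNumber E) * ((matchingNumber E).sqrt * 2 + 4) + 1 → Q s' T') :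
    wp N (.loop (ʀ 15) (runStage ;; prepare)) Q s T := by
  simp only [wp]
  set κ := matchingNumber E with hκ
  -- 78 for running a stage, 73 for the next network, and one for the loop test.
  set G := 152 * phaseCost lam κ with hG
  have hbound : ∀ s' : Store lam, ∀ par', LayeredRep A s' par' →
      2 * posSum n₁ n₂ s' ≤ 4 * (κ * κ) ∧ (17 * κ + 8) * s'.reg 3 ≤ (17 * κ + 8) * κ := by
    intro s' par' h'
    have h1 := h'.rep.posSum_le
    rw [← hκ] at h1
    exact ⟨by omega, Nat.mul_le_mul_left _ h'.rep.reg3_le⟩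
  have hleft : G * iterationsLeft κ s ≤ G * (κ.sqrt * 2 + 4) :=
    Nat.mul_le_mul_left _ (by rw [mul_comm κ.sqrt]; exact iterationsLeft_le)
  apply wp_loop (I := fun s' T' => ∃ par', LayeredRep A s' par' ∧
      T' + 2 * posSum n₁ n₂ s + (17 * κ + 8) * s.reg 3 + G * iterationsLeft κ s' ≤
      T + 2 * posSum n₁ n₂ s' + (17 * κ + 8) * s'.reg 3 + G * iterationsLeft κ s)
    (M := T + 4 * (κ * κ) + (17 * κ + 8) * κ + G * (κ.sqrt * 2 + 4))
  · exact ⟨par, h, le_rfl⟩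
  · rintro s' T' ⟨par', h1, h2⟩
    obtain ⟨h3, h4⟩ := hbound s' par' h1
    omega
  · rintro s' T' ⟨par', h1, h2⟩ he
    change s'.reg 15 ≠ 0 at he
    obtain ⟨hst, h15⟩ := h1.stage.resolve_left fun h => he h.2
    have hst' : (State.layered E par').stage ≠ ⊤ := by rw [hst]; simp
    simp only [wp]
    refine wp_runStage hlam hl1 h1.rep h1.reached hst h15 hN ?_
    intro s1 T1 par₁ visited₁ q1 q2 q3 q4 q5 q6 q7
    refine wp_prepare hlam q1 q2 hst' ?_ q3 hl1 hN ?_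
    · rw [hst]
      exact_mod_cast (by omega : 1 ≤ s'.reg 15)
    intro s2 T2 g1 g2 g3 g4 g5 g6
    refine ⟨par₁, ⟨g1, g2, g4⟩, ?_⟩
    have hk1 : s1.reg 3 ≤ κ := q1.reg3_le
    have hp0 : phaseCost lam (s'.reg 3) ≤ phaseCost lam κ := phaseCost_mono (by omega)
    have hp1 : phaseCost lam (s1.reg 3) ≤ phaseCost lam κ := phaseCost_mono hk1
    have hp2 : 1 ≤ phaseCost lam κ := phaseCost_pos
    have hiter : iterationsLeft κ s2 + 1 ≤ iterationsLeft κ s' := by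
      unfold iterationsLeft
      rw [if_neg he]
      rcases g4 with ⟨-, g4⟩ | ⟨g4, g4'⟩
      · rw [if_pos g4]; omega
      · rw [if_neg (by omega)]
        have hlt := q1.inv.stage_lt hst' q3
        rw [hst, g4] at hlt
        have hlt' : s'.reg 15 + 1 ≤ s2.reg 15 := by exact_mod_cast hlt
        -- Applied at ℓ - 1, the largest value strictly below the current stage number.
        have hmul := mul_matchingNumber_sub_le (l := s'.reg 15 - 1) h1.rep.inv.edge h1.rep.inv.inj
          (by rw [hst]; exact_mod_cast (by omega : s'.reg 15 - 1 < s'.reg 15))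
        rw [← h1.rep.tree.card, ← hκ] at hmul
        have := stagesLeft_lt (κ := κ) (show s'.reg 15 < s2.reg 15 by omega) (by omega : s'.reg 3 < s2.reg 3) (by omega : s2.reg 3 ≤ κ) hmul
        omega
    rw [← hκ] at q7
    have hGi := Nat.mul_le_mul_left G hiter
    rw [Nat.mul_succ] at hGi
    rw [g3]
    omega
  · rintro s' T' ⟨par', h1, h2⟩ he
    change s'.reg 15 = 0 at he
    obtain ⟨h3, h4⟩ := hbound s' par' h1
    have hst : (State.layered E par').stage = ⊤ := by
      rcases h1.stage with ⟨h, -⟩ | ⟨-, h⟩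
      · exact h
      · omega
    refine hQ s' _ par' h1 hst ?_
    omega

theorem greedyInv_inputStore (hlam : 0 < lam) (A : AdjLists E) :
    GreedyInv A (inputStore lam E A) (fun _ => none) ∅ where
  reached := ⟨[], .nil, rfl⟩
  inv := stageInv_layered (by simp) (by simp)
  input :=
    { reg0 := rfl
      reg1 := rfl
      reg2 := rfl
      out := fun u j => by simp [inputStore, row_succ]
      inn := fun w j => by simp [inputStore, row_succ]
      bit := fun u k hk => by
        have hm := Nat.mod_lt (k - 1) hlam
        have hd := Nat.div_add_mod' (k - 1) lam
        simp only [Store.bit, Word.get, hm, dite_true, inputStore, decide_eq_true_eq, true_and,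
          zero_ne_one, false_and, or_false, Nat.add_right_cancel_iff, hd]
        constructor
        · rintro ⟨⟨u', w⟩, he, h1, h2⟩
          simp only at h1 h2
          obtain rfl : u = u' := Fin.ext h1
          exact ⟨w, by omega, he⟩
        · rintro ⟨w, rfl, he⟩
          exact ⟨(u, w), he, rfl, by simp⟩ }
  tree :=
    { card := by simp [inputStore, treeEdges]
      out := fun u => by simp [inputStore]
      le₁ := fun u => by simp [inputStore]
      le₂ := fun w => by simp [inputStore]
      ne₁ := fun u => by simp [inputStore]
      ne₂ := fun w => by simp [inputStore, IsWT1]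
      node₁ := fun u hu => absurd rfl hu
      node₂ := fun w hw => by simp [IsWT1] at hw
      idx₁ := fun a h1 h2 => by simp [inputStore] at h2; omega
      idx₂ := fun a h1 h2 => by simp [inputStore] at h2; omega
      child := fun u w h => by simp at h
      bit₂ := fun u w hu => absurd rfl hu
      bit₃ := fun u w hu => absurd rfl hu }
  zero a h1 h2 i j := by
    simp [inputStore, show a ≠ 0 by omega, show a ≠ 1 by omega]
  layers p c hc := by simp [Store.bit, Word.get, inputStore]
  unl c := by simp [Store.bit, Word.get, inputStore]

/-- The coefficient 42 is 17 + 17 for the greedy and the later augmentations plus 4 + 4 for the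
pointers. The first network is paid for by enlarging 152 to 152 + 73 = 225. -/
theorem wp_matchingProgram (hlam : 0 < lam) (hl1 : lam ≤ n₁)
    (hne : ∀ u : Fin n₁, ∃ w, (u, w) ∈ E) (hN : 2 * (n₁ + n₂ + 1) ≤ N)
    {Q : Store lam → ℕ → Prop}
    (hQ : ∀ s' T' par', LayeredRep A s' par' → (State.layered E par').stage = ⊤ →
      T' ≤ ∑ j ∈ Finset.range n₁,
          9 * searchCost A (matchingNumber E) (n₂ / lam + 1) j + 56 * n₁ + 4 +
        42 * (matchingNumber E * matchingNumber E) + 8 * matchingNumber E +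
        225 * phaseCost lam (matchingNumber E) * ((matchingNumber E).sqrt * 2 + 4) → Q s' T') :
    wp N matchingProgram Q (inputStore lam E A) 0 := by
  have hn : 1 ≤ n₁ := by omega
  have hst := stage_initial hn hne
  rw [matchingProgram, wp]
  refine wp_greedy hlam hn hl1 hne (greedyInv_inputStore hlam A) hN (by simp [inputStore]) ?_
  intro s1 T1 par₁ visited₁ h1 hno hT1
  rw [wp]
  refine wp_prepare hlam h1.stageRep h1.reached (by rw [hst]; simp) hst.ge hno hl1 hN ?_
  intro s2 T2 g1 g2 g3 g4 g5 g6
  refine wp_stages hlam hl1 ⟨g1, g2, g4⟩ hN ?_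
  intro s3 T3 par₃ q1 q2 q3
  refine hQ s3 T3 par₃ q1 q2 ?_
  have e1 := g1.posSum_le
  have e2 : phaseCost lam (s1.reg 3) ≤ phaseCost lam (matchingNumber E) :=
    phaseCost_mono h1.stageRep.reg3_le
  rw [Finset.sum_add_distrib, Finset.sum_const, Finset.card_range, smul_eq_mul] at hT1
  generalize phaseCost lam (matchingNumber E) = p at *
  generalize (matchingNumber E).sqrt = r at *
  generalize matchingNumber E = κ at *
  have e3 : 225 * p * (r * 2 + 4) = 152 * p * (r * 2 + 4) + 73 * (p * (r * 2)) + 292 * p := by ring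
  have e4 : (17 * κ + 8) * κ = 17 * (κ * κ) + 8 * κ := by ring
  have e5 : 17 * κ * κ = 17 * (κ * κ) := by ring
  omega

end Program

/-! ### From the step count to the stated bound -/

section Bounds

variable {n₁ n₂ lam : ℕ} {E : Finset (Fin n₁ × Fin n₂)}

theorem sum_length_outList (A : AdjLists E) : ∑ u, (A.outList u).length = E.card := by
  rw [Finset.card_eq_sum_card_fiberwise (f := Prod.fst) (t := Finset.univ) (by simp)]
  refine Finset.sum_congr rfl fun u _ => ?_
  rw [← List.toFinset_card_of_nodup (A.outList_nodup u),
    ← Finset.card_map ⟨fun w => (u, w), Prod.mk_right_injective u⟩]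
  congr 1
  ext ⟨u', w⟩
  simp only [Finset.mem_map, List.mem_toFinset, A.mem_outList, Function.Embedding.coeFn_mk,
    Prod.mk.injEq, Finset.mem_filter]
  constructor
  · rintro ⟨w', h1, rfl, rfl⟩
    exact ⟨h1, rfl⟩
  · rintro ⟨h1, rfl⟩
    exact ⟨w, h1, rfl, rfl⟩

theorem le_card_of_forall_exists (hne : ∀ u : Fin n₁, ∃ w, (u, w) ∈ E) : n₁ ≤ E.card := by
  have h : E.image Prod.fst = Finset.univ := by
    ext u
    obtain ⟨w, hw⟩ := hne u
    simp only [Finset.mem_image, Finset.mem_univ, iff_true]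
    exact ⟨(u, w), hw, rfl⟩
  have := Finset.card_image_le (s := E) (f := Prod.fst)
  rwa [h, Finset.card_univ, Fintype.card_fin] at this

theorem one_le_matchingNumber (hn : 1 ≤ n₁) (hne : ∀ u : Fin n₁, ∃ w, (u, w) ∈ E) :
    1 ≤ matchingNumber E := by
  obtain ⟨w, hw⟩ := hne ⟨0, hn⟩
  exact card_le_matchingNumber (M := {(⟨0, hn⟩, w)}) (by simpa using hw) (by simp [IsMatching])

/-- `min {n₁ κ, n₁ n₂ / lam, m}`. -/
noncomputable def searchBound (lam : ℕ) (E : Finset (Fin n₁ × Fin n₂)) : ℝ :=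
  min ((n₁ : ℝ) * matchingNumber E) (min ((n₁ : ℝ) * n₂ / lam) (E.card : ℝ))

/-- Each argument of the inner minima yields one argument of the outer minimum. The factor 2 absorbs
the rounding in `n₂ / lam + 1`, since `lam ≤ n₂`. -/
theorem sum_searchCost_le (A : AdjLists E) (hlam : 1 ≤ lam) (hl1 : lam ≤ n₁) (hn : n₁ ≤ n₂) :
    ((∑ j ∈ Finset.range n₁, searchCost A (matchingNumber E) (n₂ / lam + 1) j : ℕ) : ℝ) ≤
      2 * searchBound lam E := by
  have hl : (1 : ℝ) ≤ lam := by exact_mod_cast hlam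
  have h1 : ∑ j ∈ Finset.range n₁, searchCost A (matchingNumber E) (n₂ / lam + 1) j ≤
      n₁ * matchingNumber E := by
    refine (Finset.sum_le_card_nsmul _ _ (matchingNumber E) fun j _ => ?_).trans (by simp)
    exact (min_le_right _ _).trans (min_le_left _ _)
  have h2 : ∑ j ∈ Finset.range n₁, searchCost A (matchingNumber E) (n₂ / lam + 1) j ≤
      n₁ * (n₂ / lam + 1) := by
    refine (Finset.sum_le_card_nsmul _ _ (n₂ / lam + 1) fun j _ => ?_).trans (by simp)
    exact (min_le_right _ _).trans (min_le_right _ _)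
  have h3 : ∑ j ∈ Finset.range n₁, searchCost A (matchingNumber E) (n₂ / lam + 1) j ≤ E.card := by
    rw [← sum_length_outList A, Finset.sum_range]
    refine Finset.sum_le_sum fun u _ => ?_
    rw [← row_succ A.outList u]
    exact min_le_left _ _
  have h4 : ((n₁ * (n₂ / lam + 1) : ℕ) : ℝ) ≤ 2 * ((n₁ : ℝ) * n₂ / lam) := by
    have h5 : ((n₂ / lam : ℕ) : ℝ) ≤ n₂ / lam := Nat.cast_div_le
    have h6 : (1 : ℝ) ≤ n₂ / lam := by
      rw [le_div_iff₀ (by linarith), one_mul]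
      exact_mod_cast hl1.trans hn
    push_cast
    rw [mul_div_assoc, ← mul_assoc, mul_comm 2, mul_assoc]
    gcongr
    linarith
  have hc : ∀ a b : ℕ, a ≤ b → (a : ℝ) ≤ b := fun a b h => by exact_mod_cast h
  have h1' := hc _ _ h1
  have h2' := hc _ _ h2
  have h3' := hc _ _ h3
  rw [searchBound, mul_min_of_nonneg _ _ (by norm_num), mul_min_of_nonneg _ _ (by norm_num)]
  refine le_min ?_ (le_min (h2'.trans h4) ?_)
  · push_cast at h1' ⊢
    have := (Nat.cast_nonneg n₁ : (0 : ℝ) ≤ n₁)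
    have := mul_nonneg this (Nat.cast_nonneg (matchingNumber E))
    linarith
  · have := (Nat.cast_nonneg E.card : (0 : ℝ) ≤ E.card)
    linarith

/-- The steps linear in `n₁` disappear in the minimum: κ is at least `1`, `lam` is at most `n₂`, and
every node of V₁ has an edge. -/
theorem le_searchBound (hlam : 1 ≤ lam) (hl1 : lam ≤ n₁) (hn : n₁ ≤ n₂)
    (hne : ∀ u : Fin n₁, ∃ w, (u, w) ∈ E) : (n₁ : ℝ) ≤ searchBound lam E := by
  have hl : (1 : ℝ) ≤ lam := by exact_mod_cast hlam
  have h0 : (0 : ℝ) ≤ n₁ := Nat.cast_nonneg _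
  have hκ : (1 : ℝ) ≤ matchingNumber E := by
    exact_mod_cast one_le_matchingNumber (by omega) hne
  refine le_min (le_mul_of_one_le_right h0 hκ) (le_min ?_ ?_)
  · rw [mul_div_assoc]
    refine le_mul_of_one_le_right h0 ?_
    rw [le_div_iff₀ (by linarith), one_mul]
    exact_mod_cast hl1.trans hn
  · exact_mod_cast le_card_of_forall_exists hne

theorem rpow_five_halves {x : ℝ} (hx : 0 ≤ x) : x ^ (5 / 2 : ℝ) = x ^ 2 * √x := by
  rw [show (5 / 2 : ℝ) = (2 : ℕ) + 1 / 2 by norm_num, Real.rpow_add_of_nonneg hx (by norm_num) (by norm_num), Real.rpow_natCast,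
    Real.sqrt_eq_rpow]

/-- For κ ≥ 1 one has κ + 1 ≤ 2κ and 2√κ + 4 ≤ 6√κ, whence 12. The term κ√κ left by the rounding of
κ/λ is at most κ². -/
theorem phaseCost_mul_le {κ : ℕ} (hκ : 1 ≤ κ) (hlam : 1 ≤ lam) :
    ((phaseCost lam κ * (κ.sqrt * 2 + 4) : ℕ) : ℝ) ≤
      12 * ((κ : ℝ) ^ 2 + (κ : ℝ) ^ (5 / 2 : ℝ) / lam) := by
  have hk : (1 : ℝ) ≤ κ := by exact_mod_cast hκ
  have hl : (1 : ℝ) ≤ lam := by exact_mod_cast hlam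
  have h1 : ((κ / lam : ℕ) : ℝ) ≤ κ / lam := Nat.cast_div_le
  have h2 : (κ.sqrt : ℝ) ≤ √κ := Real.nat_sqrt_le_real_sqrt
  have h3 : 1 ≤ √(κ : ℝ) := Real.one_le_sqrt.2 hk
  have h4 : √(κ : ℝ) ≤ κ := by
    have := Real.sq_sqrt (by linarith : (0 : ℝ) ≤ κ)
    nlinarith
  have h0 : (0 : ℝ) ≤ κ / lam := by positivity
  rw [rpow_five_halves (by linarith), phaseCost]
  push_cast
  calc ((κ : ℝ) + 1) * (((κ / lam : ℕ) : ℝ) + 1) * (κ.sqrt * 2 + 4)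
      ≤ (2 * κ) * (κ / lam + 1) * (6 * √κ) := by
        gcongr
        · linarith
        · linarith
    _ = 12 * (κ * √κ + (κ : ℝ) ^ 2 * √κ / lam) := by field_simp; ring
    _ ≤ _ := by
        gcongr
        nlinarith

end Bounds

/-! ### Comparison with n^{2.5}/λ -/

section Comparison

variable {n₁ n₂ lam : ℕ} {E : Finset (Fin n₁ × Fin n₂)}

/-- The bound in terms of the number `n` of nodes and of `κ ≤ δ n`. -/
theorem wordBound_le_of_le {δ : ℝ} (hδ : 0 ≤ δ) (hlam : 1 ≤ lam) (hl : lam ^ 2 ≤ n₁ + n₂)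
    (hκ : (matchingNumber E : ℝ) ≤ δ * ((n₁ + n₂ : ℕ) : ℝ)) :
    wordBound lam E ≤ (1 / √((n₁ + n₂ : ℕ) : ℝ) + δ ^ 2 + δ ^ 2 * √δ) *
      (((n₁ + n₂ : ℕ) : ℝ) ^ (5 / 2 : ℝ) / lam) := by
  have hl1 : (1 : ℝ) ≤ lam := by exact_mod_cast hlam
  have hl0 : (0 : ℝ) < lam := by linarith
  set n : ℝ := ((n₁ + n₂ : ℕ) : ℝ) with hn
  have hl2 : (lam : ℝ) ^ 2 ≤ n := by rw [hn]; exact_mod_cast hl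
  have hn0 : 0 < n := by nlinarith
  have hls : (lam : ℝ) ≤ √n := Real.le_sqrt_of_sq_le hl2
  have hs0 : 0 < √n := Real.sqrt_pos.2 hn0
  have h1 : (n₁ : ℝ) * n₂ ≤ n ^ 2 := by
    have h3 : (0 : ℝ) ≤ n₁ := Nat.cast_nonneg _
    have h4 : (0 : ℝ) ≤ n₂ := Nat.cast_nonneg _
    rw [hn]
    push_cast
    nlinarith
  have hk0 : (0 : ℝ) ≤ matchingNumber E := Nat.cast_nonneg _
  rw [wordBound, rpow_five_halves hn0.le, rpow_five_halves hk0, add_mul, add_mul]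
  refine add_le_add (add_le_add ?_ ?_) ?_
  -- Of the minimum only n₁n₂/λ ≤ n²/λ is needed, which is smaller than n^{2.5}/λ by the factor √n.
  · refine ((min_le_right _ _).trans (min_le_left _ _)).trans ?_
    rw [show 1 / √n * (n ^ 2 * √n / lam) = n ^ 2 / lam by field_simp]
    gcongr
  · calc (matchingNumber E : ℝ) ^ 2 ≤ (δ * n) ^ 2 := by gcongr
      _ = δ ^ 2 * n ^ 2 * 1 := by ring
      -- Here λ ≤ √n enters: it turns κ² into a term of the order n^{2.5}/λ.
      _ ≤ δ ^ 2 * n ^ 2 * (√n / lam) := by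
        gcongr
        rwa [one_le_div hl0]
      _ = _ := by ring
  · calc (matchingNumber E : ℝ) ^ 2 * √(matchingNumber E : ℝ) / lam
        ≤ (δ * n) ^ 2 * √(δ * n) / lam := by gcongr
      _ = _ := by rw [Real.sqrt_mul hδ]; ring

end Comparison

/-! ### The main theorem -/

theorem mainTheorem2 :
    (∃ (P : Cmd) (C : ℕ), ∀ (n₁ n₂ lam : ℕ) (E : Finset (Fin n₁ × Fin n₂)),
      1 ≤ lam → lam ≤ n₁ → n₁ ≤ n₂ → (∀ u : Fin n₁, ∃ w : Fin n₂, (u, w) ∈ E) →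
      ∀ A : AdjLists E,
        ∃ (t : ℕ) (s : Store lam) (os : List (Op (Fin n₁) (Fin n₂))) (q : State n₁ n₂),
          Exec (C * (n₁ + n₂)) P (inputStore lam E A) s t ∧
          IsRun E os q ∧
          s.log = os.map (Op.map (fun u => u.val + 1) (fun w => w.val + 1)) ∧
          OutputIs s q.par ∧
          treeEdges q.par ⊆ E ∧ IsMatching (treeEdges q.par) ∧
          (treeEdges q.par).card = matchingNumber E ∧
          (t : ℝ) ≤ C * wordBound lam E) ∧
    (∃ C : ℝ, ∀ (n₁ n₂ lam : ℕ) (E : Finset (Fin n₁ × Fin n₂)),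
      1 ≤ lam → lam ≤ n₁ → n₁ ≤ n₂ → lam ^ 2 ≤ n₁ + n₂ →
        wordBound lam E ≤ C * (((n₁ + n₂ : ℕ) : ℝ) ^ (5 / 2 : ℝ) / lam)) ∧
    (∀ ε : ℝ, 0 < ε → ∃ (δ : ℝ) (N : ℕ), 0 < δ ∧
      ∀ (n₁ n₂ lam : ℕ) (E : Finset (Fin n₁ × Fin n₂)),
        1 ≤ lam → lam ≤ n₁ → n₁ ≤ n₂ → lam ^ 2 ≤ n₁ + n₂ → N ≤ n₁ + n₂ →
        (matchingNumber E : ℝ) ≤ δ * ((n₁ + n₂ : ℕ) : ℝ) →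
          wordBound lam E ≤ ε * (((n₁ + n₂ : ℕ) : ℝ) ^ (5 / 2 : ℝ) / lam)) := by
  -- 3000 exceeds 225 · 12 + 42 + 8, the coefficient of κ² after all estimates, and it also bounds
  -- the integers, which stay below 2(n₁ + n₂ + 1). In the comparison, 3 bounds 1/√n + δ² + δ²√δ at
  -- δ = 1.
  refine ⟨⟨matchingProgram, 3000, fun n₁ n₂ lam E hlam hl1 hn hne A => ?_⟩, ⟨3, ?_⟩, ?_⟩
  · obtain ⟨s, t, hexec, par, hrep, hst, ht⟩ := exists_exec_of_wp matchingProgram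
      (fun s' T' => ∃ par', LayeredRep A s' par' ∧ (State.layered E par').stage = ⊤ ∧ T' ≤ _) _ _
      (wp_matchingProgram (A := A) (N := 3000 * (n₁ + n₂)) hlam hl1 hne (by omega)
        fun s' T' par' h1 h2 h3 => ⟨par', h1, h2, h3⟩)
    obtain ⟨os, hsteps, hlog⟩ := hrep.reached
    have hI := hrep.rep.inv
    refine ⟨t, s, os, State.layered E par, hexec, ⟨hsteps, hst⟩, hlog, hrep.rep.tree.out,
      treeEdges_subset hI.edge, isMatching_treeEdges hI.inj,
      card_treeEdges_eq_of_stage_eq_top hI.edge hI.inj hst, ?_⟩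
    rw [zero_add, ← Finset.mul_sum] at ht
    have h1 := sum_searchCost_le A hlam hl1 hn
    have h2 := le_searchBound hlam hl1 hn hne
    have hκ := one_le_matchingNumber (by omega) hne
    have h3 := phaseCost_mul_le hκ hlam
    have h4 : (1 : ℝ) ≤ n₁ := by exact_mod_cast hlam.trans hl1
    have h5 : (1 : ℝ) ≤ matchingNumber E := by exact_mod_cast hκ
    have h6 : (0 : ℝ) ≤ (matchingNumber E : ℝ) ^ (5 / 2 : ℝ) / lam := by positivity
    have h7 : wordBound lam E = searchBound lam E + (matchingNumber E : ℝ) ^ 2 +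
      (matchingNumber E : ℝ) ^ (5 / 2 : ℝ) / lam := rfl
    rw [mul_assoc 225] at ht
    have ht' : (t : ℝ) ≤ ((9 * _ + 56 * n₁ + 4 + 42 * (matchingNumber E * matchingNumber E) +
      8 * matchingNumber E + 225 * _ : ℕ) : ℝ) := Nat.cast_le.2 ht
    rw [h7]
    generalize ∑ j ∈ Finset.range n₁, searchCost A (matchingNumber E) (n₂ / lam + 1) j = S at *
    generalize phaseCost lam (matchingNumber E) * ((matchingNumber E).sqrt * 2 + 4) = R at *
    push_cast at ht' ⊢
    nlinarith
  · intro n₁ n₂ lam E hlam hl1 hn hl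
    have hκ : (matchingNumber E : ℝ) ≤ 1 * ((n₁ + n₂ : ℕ) : ℝ) := by
      rw [one_mul]
      exact_mod_cast matchingNumber_le_left.trans (Nat.le_add_right _ _)
    refine (wordBound_le_of_le zero_le_one hlam hl hκ).trans ?_
    gcongr
    have h1 : (1 : ℝ) ≤ ((n₁ + n₂ : ℕ) : ℝ) := by exact_mod_cast (by omega : 1 ≤ n₁ + n₂)
    have h2 : 1 / √((n₁ + n₂ : ℕ) : ℝ) ≤ 1 := by
      rw [div_le_one (by positivity)]
      exact Real.one_le_sqrt.2 h1
    rw [Real.sqrt_one]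
    linarith
  · intro ε hε
    have hδ : 0 < min 1 (ε / 3) := lt_min one_pos (by linarith)
    -- With these choices each of 1/√n, δ² and δ²√δ is at most ε/3.
    refine ⟨min 1 (ε / 3), ⌈(3 / ε) ^ 2⌉₊, hδ, fun n₁ n₂ lam E hlam hl1 hn hl hN hκ => ?_⟩
    refine (wordBound_le_of_le hδ.le hlam hl hκ).trans ?_
    gcongr
    have h1 : (3 / ε) ^ 2 ≤ ((n₁ + n₂ : ℕ) : ℝ) :=
      (Nat.le_ceil _).trans (by exact_mod_cast hN)
    have h2 : 3 / ε ≤ √((n₁ + n₂ : ℕ) : ℝ) := Real.le_sqrt_of_sq_le h1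
    have h3 : 1 / √((n₁ + n₂ : ℕ) : ℝ) ≤ ε / 3 := by
      rw [show ε / 3 = 1 / (3 / ε) by field_simp]
      gcongr
    generalize 1 / √((n₁ + n₂ : ℕ) : ℝ) = x at *
    have h4 := min_le_left 1 (ε / 3)
    have h5 := min_le_right 1 (ε / 3)
    generalize min 1 (ε / 3) = δ at *
    have h6 : √δ ≤ 1 := Real.sqrt_le_one.2 h4
    have h7 : δ ^ 2 ≤ ε / 3 := by nlinarith
    have h8 : δ ^ 2 * √δ ≤ ε / 3 := by nlinarith [Real.sqrt_nonneg δ, sq_nonneg δ]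
    linarith
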